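/- Let $d\in\{2,3,\dots,\infty\}$, let $A_d=\mathbb Z/d\mathbb Z$ (and $A_\infty=\mathbb Z$), let $\star$ be an additional symbol, and let $\sigma$ be the left shift on sequences over $A_d\cup\{\star\}$. A *kneading sequence* $\nu$ is either a sequence in $A_d^{\mathbb N}$ that is not periodic (it may be strictly preperiodic), or a periodic sequence over $A_d\cup\{\star\}$ in which $\star$ occurs exactly once within the (exact) period $p$, at the last position ("$\star$-periodic"). The trivial sequence $\overline\star$ is excluded. *Symbolic space.* $X_\nu$ consists of all sequences $w\star\nu$ ($w$ a finite, possibly empty word over $A_d$; such a point is called precritical, of depth $|w|+1$), all $\sigma^k\nu$ ($k\ge0$), and all sequences in $A_d^{\mathbb N}$ that are not of the form $w\nu$ with $w$ a non-empty word. $\operatorname{diff}(a,b)\in\{1,2,\dots,\infty\}$ is the position of the first difference of $a$ and $b$, where $\star$ counts as different from no symbol. If $\nu$ is non-periodic, $X_\nu$ has the topology with basic open sets $U_k(a)=N_k(a)\setminus\partial_k(a)$ ($a\in X_\nu$, $k\ge1$), where $N_k(a)=\{b\in X_\nu:\operatorname{diff}(a,b)\ge k\}$ and $\partial_k(a)$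 is the set of precritical points in $N_k(a)\setminus\{a\}$ of depth at most $k-1$, except $\nu$. *Critical path.* Let $P_1=\{\star\nu\prec\nu\}$. Obtain $P_{n+1}$ from the finite ordered set $P_n$ by inserting, between any two neighbours $a\prec b$ with $k=\operatorname{diff}(a,b)<\infty$, the precritical point $w\star\nu$ of depth $k$ for which $w$ (of length $k-1$) agrees at each position with the symbols from $A_d$ that $a$ and $b$ have there. Let $P_\infty=\bigcup_n P_n$. Let $L_\nu$ be the set of all $a\in X_\nu\cap A_d^{\mathbb N}$ for which there is a strictly $\prec$-monotone sequence $(a_n)$ in $P_\infty$ with $\operatorname{diff}(a_n,a)\to\infty$. A *gap* is a pair of neighbours $c\prec c'$ in some $P_n$ with $\operatorname{diff}(c,c')=\infty$; its *central itinerary* is the $a\in X_\nu\cap A_d^{\mathbb N}$ with $\operatorname{diff}(c,a)=\operatorname{diff}(a,c')=\infty$, placed between $c$ and $c'$. If $\nu$ is $\star$-periodic, then for each $c\in P_\infty$ and each $a\in A_d^{\mathbb N}$ with $\operatorname{diff}(a,c)=\infty$ such that $a\in L_\nu$, or such that $a$ is the central itinerary of a gap with $c$ as one of its two points, insert between $a$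 and $c$ an abstract interval $[a,c]\cong[0,1]$, called a *Fatou interval*, which is determined by its endpoints; $\sigma$ maps $[a,c]$ homeomorphically to $[\sigma a,\sigma c]$, respecting the parametrizations. The *critical path* $C_\nu$ is the union of $P_\infty$, $L_\nu$ and all Fatou intervals with their endpoints, with the order induced by $\prec$, and with the order topology. *Hubbard tree.* $\mathcal H(\nu)=\bigcup_{n\ge0}\sigma^n(C_\nu)$. If $\nu$ is non-periodic, it carries the subspace topology of $X_\nu$. If $\nu$ is $\star$-periodic of period $p$, it carries the topology of the finite tree $H_{p-1}=\bigcup_{k=0}^{p-1}\sigma^k(C_\nu)$, that is, the quotient topology with respect to the maps $\sigma^k\colon C_\nu\to\mathcal H(\nu)$, $0\le k\le p-1$. **Lemma (Critical value endpoint).** For every kneading sequence $\nu\ne\overline\star$, whether $\mathcal H(\nu)$ is a finite or an infinite tree, the critical value $\nu$ is an endpoint of $\mathcal H(\nu)$; that is, $\mathcal H(\nu)\setminus\{\nu\}$ is connected. -/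

import Mathlib

open Set Filter Topology

noncomputable section

namespace HubbardTrees

/-- The alphabet `A_d`: it is `ℤ/dℤ` for finite `d`, and `ℤ` for `d = ∞`. -/
def Alphabet : ℕ∞ → Type
  | ⊤ => ℤ
  | (n : ℕ) => ZMod n

/-! Everything below makes sense over an arbitrary alphabet `A`. -/

/-- Infinite sequences over `A ∪ {⋆}`; the symbol `⋆` is `none`. The `k`-th entry
(`k = 1, 2, …`) is the value at `k - 1`. -/
abbrev StarSeq (A : Type) : Type := ℕ → Option A

variable {A : Type}

/-- The left shift `σ` on sequences. -/
def shift (a : StarSeq A) : StarSeq A := fun i => a (i + 1)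

/-- The sequence has no symbol `⋆`, i.e. it lies in `A^∞`. -/
def NoStar (a : StarSeq A) : Prop := ∀ i, a i ≠ none

/-- A `⋆`-periodic sequence: it is periodic, and within the (exact) period the symbol `⋆` occurs
exactly once, at the last position. -/
def IsStarPeriodic (ν : StarSeq A) : Prop :=
  ν ∈ Function.periodicPts shift ∧
    ∀ i < Function.minimalPeriod shift ν, ν i = none ↔ i + 1 = Function.minimalPeriod shift ν

/-- Abstract kneading sequences. "Non-periodic" means not purely periodic; strictly preperiodic
sequences over `A` are allowed. -/
def IsKneadingSeq (ν : StarSeq A) : Prop :=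
  (NoStar ν ∧ ν ∉ Function.periodicPts shift) ∨ IsStarPeriodic ν

/-- The trivial kneading sequence `⋆⋆⋆…`. -/
def trivialSeq (A : Type) : StarSeq A := fun _ => none

/-- The critical point `⋆ν`. -/
def critPt (ν : StarSeq A) : StarSeq A
  | 0 => none
  | i + 1 => ν i

/-- `a = w⋆ν` for a word `w` over `A` of length `m`: the precritical points of depth `m + 1`. -/
def IsWordStar (ν : StarSeq A) (m : ℕ) (a : StarSeq A) : Prop :=
  (∀ i < m, a i ≠ none) ∧ a m = none ∧ shift^[m + 1] a = ν

/-- The set `X_ν`: precritical points `w⋆ν` (with `w` possibly empty), postcritical points `σ^k ν`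
(`k ≥ 0`, including `ν`), and all sequences over `A` that are not of the form `wν` with `w`
a non-empty word. -/
def X (ν : StarSeq A) : Set (StarSeq A) :=
  {a | (∃ m, IsWordStar ν m a) ∨ (∃ k, a = shift^[k] ν) ∨
    (NoStar a ∧ ∀ m, 1 ≤ m → shift^[m] a ≠ ν)}

/-- Two entries differ; `⋆` is a wild card that differs from nothing. -/
def Differ (x y : Option A) : Prop := ∃ e f : A, x = some e ∧ y = some f ∧ e ≠ f

/-- The position (counted from `1`) of the first difference of `a` and `b`; `⊤` if there is none. -/
def diff (a b : StarSeq A) : ℕ∞ := ⨅ (i : ℕ) (_ : Differ (a i) (b i)), ((i + 1 : ℕ) : ℕ∞)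

/-! ### The topology of `X_ν` for non-periodic `ν` -/

/-- `N_k(a)`. -/
def cylinder (ν : StarSeq A) (k : ℕ) (a : StarSeq A) : Set (StarSeq A) :=
  {b | b ∈ X ν ∧ (k : ℕ∞) ≤ diff a b}

/-- `∂_k(a)`: the precritical points in `N_k(a) \ {a}` of depth at most `k - 1`, except `ν`. -/
def cylinderBdry (ν : StarSeq A) (k : ℕ) (a : StarSeq A) : Set (StarSeq A) :=
  {b | b ∈ cylinder ν k a \ {a} ∧ b ≠ ν ∧ ∃ m, m + 1 < k ∧ IsWordStar ν m b}

/-- `U_k(a) = N_k(a) \ ∂_k(a)`. -/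
def basicNhd (ν : StarSeq A) (k : ℕ) (a : StarSeq A) : Set (StarSeq A) :=
  cylinder ν k a \ cylinderBdry ν k a

/-- The topology on `X_ν` (used for non-periodic `ν`) with the `U_k(a)`, `a ∈ X_ν`, `k ≥ 1`,
as basic open sets. -/
@[reducible] def topologyX (ν : StarSeq A) : TopologicalSpace (X ν) :=
  TopologicalSpace.generateFrom
    {S | ∃ a ∈ X ν, ∃ k, 1 ≤ k ∧ S = (Subtype.val : X ν → StarSeq A) ⁻¹' basicNhd ν k a}

/-! ### Precritical points on the critical path -/

/-- The precritical point `w''⋆ν` of depth `k = diff a b < ∞` inserted between `a` and `b`: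
the word `w''` of length `k - 1` takes at each position the symbol of `a` or of `b` there. -/
def midpoint (ν a b : StarSeq A) : StarSeq A := fun i =>
  if i + 1 < (diff a b).toNat then (a i).or (b i)
  else if i + 1 = (diff a b).toNat then none
  else ν (i - (diff a b).toNat)

open Classical in
/-- Insert a precritical point between any two neighbours `a`, `b` with `diff a b < ∞`. -/
def refine (ν : StarSeq A) : List (StarSeq A) → List (StarSeq A)
  | [] => []
  | [a] => [a]
  | a :: b :: l =>
    if diff a b = ⊤ then a :: refine ν (b :: l)
    else a :: midpoint ν a b :: refine ν (b :: l)

/-- The finite totally ordered set `P_{n+1}`, listed in increasing order;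
`P_1` consists of `⋆ν ≺ ν`. -/
def P (ν : StarSeq A) : ℕ → List (StarSeq A)
  | 0 => [critPt ν, ν]
  | n + 1 => refine ν (P ν n)

/-- `P_∞`, the union of all `P_n`. -/
def PInf (ν : StarSeq A) : Set (StarSeq A) := {a | ∃ n, a ∈ P ν n}

/-- The order `≺` on `P_∞`. -/
def PLT (ν a b : StarSeq A) : Prop := ∃ n, [a, b].Sublist (P ν n)

/-- `c ≺ c'` are neighbours in some `P_n` with `diff c c' = ∞`, so that no precritical point is
ever inserted between them. -/
def IsGap (ν c c' : StarSeq A) : Prop := (∃ n, [c, c'] <:+: P ν n) ∧ diff c c' = ⊤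

/-- The central itinerary in the gap between `c` and `c'`. -/
def IsCentral (ν c c' a : StarSeq A) : Prop :=
  IsGap ν c c' ∧ a ∈ X ν ∧ NoStar a ∧ diff c a = ⊤ ∧ diff a c' = ⊤

/-- The sequence `u` in `P_∞` is strictly monotone with respect to `≺` (increasing or decreasing)
and it converges to `a`. -/
def ConvergesTo (ν : StarSeq A) (u : ℕ → StarSeq A) (a : StarSeq A) : Prop :=
  ((∀ n, PLT ν (u n) (u (n + 1))) ∨ (∀ n, PLT ν (u (n + 1)) (u n))) ∧
    Tendsto (fun n => diff (u n) a) atTop (𝓝 ⊤)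

/-- `L_ν`: the limit points of `P_∞` in `X_ν ∩ A^∞`. -/
def L (ν : StarSeq A) : Set (StarSeq A) :=
  {a | a ∈ X ν ∧ NoStar a ∧ ∃ u, ConvergesTo ν u a}

/-! ### Fatou intervals and the critical path -/

/-- Points: itineraries, and the interior points of Fatou intervals `[a, c]`. The abstract interval
`[a, c]` is determined by its endpoints and parametrized by `t ∈ [0, 1]` where `t = 0` is `a` and
`t = 1` is `c`. -/
inductive Pt (A : Type) : Type
  | itin (a : StarSeq A) : Pt A
  | fatou (a c : StarSeq A) (t : Ioo (0 : ℝ) 1) : Pt A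

/-- The map `σ` on points: the shift on itineraries, and the homeomorphism from the Fatou interval
`[a, c]` to the Fatou interval `[σ a, σ c]` that respects the parametrization. -/
def Pt.shift : Pt A → Pt A
  | .itin a => .itin (HubbardTrees.shift a)
  | .fatou a c t => .fatou (HubbardTrees.shift a) (HubbardTrees.shift c) t

/-- The Fatou intervals `[a, c]` on the critical path, for `⋆`-periodic `ν`: here `c` is precritical
in `P_∞` with `diff a c = ∞`, and either `a` is a limit point (so `a ∈ M_ν`), or `a` is the central
itinerary in a gap that has `c` on its boundary. -/
def IsFatou (ν a c : StarSeq A) : Prop :=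
  IsStarPeriodic ν ∧ c ∈ PInf ν ∧ diff a c = ⊤ ∧
    (a ∈ L ν ∨ ∃ c', IsCentral ν c c' a ∨ IsCentral ν c' c a)

/-- The critical path `C_ν`: `P_∞ ∪ L_ν` and all Fatou intervals, including their endpoints. -/
def critPath (ν : StarSeq A) : Set (Pt A) :=
  {x | (∃ a, x = .itin a ∧ (a ∈ PInf ν ∪ L ν ∨ ∃ c c', IsCentral ν c c' a)) ∨
    ∃ a c t, x = .fatou a c t ∧ IsFatou ν a c}

/-- The order `≺` on the critical path: the transitive relation generated by the order on `P_∞`, the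
positions of limit points relative to `P_∞`, the positions of central itineraries in their gaps, and
the parametrizations of the Fatou intervals (increasing or decreasing, according to the
order of the endpoints). -/
inductive CLT (ν : StarSeq A) : Pt A → Pt A → Prop
  | prec {a b} (h : PLT ν a b) : CLT ν (.itin a) (.itin b)
  | below_limit {p a u} (ha : a ∈ L ν) (hu : ConvergesTo ν u a)
      (h : ∀ᶠ n in atTop, PLT ν p (u n)) : CLT ν (.itin p) (.itin a)
  | above_limit {p a u} (ha : a ∈ L ν) (hu : ConvergesTo ν u a)
      (h : ∀ᶠ n in atTop, PLT ν (u n) p) : CLT ν (.itin a) (.itin p)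
  | below_central {c c' a} (h : IsCentral ν c c' a) : CLT ν (.itin c) (.itin a)
  | above_central {c c' a} (h : IsCentral ν c c' a) : CLT ν (.itin a) (.itin c')
  | fatou_inc_left {a c} (h : IsFatou ν a c) (hlt : CLT ν (.itin a) (.itin c)) (t) :
      CLT ν (.itin a) (.fatou a c t)
  | fatou_inc_right {a c} (h : IsFatou ν a c) (hlt : CLT ν (.itin a) (.itin c)) (t) :
      CLT ν (.fatou a c t) (.itin c)
  | fatou_inc {a c} (h : IsFatou ν a c) (hlt : CLT ν (.itin a) (.itin c)) {s t} (hst : s < t) :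
      CLT ν (.fatou a c s) (.fatou a c t)
  | fatou_dec_left {a c} (h : IsFatou ν a c) (hlt : CLT ν (.itin c) (.itin a)) (t) :
      CLT ν (.itin c) (.fatou a c t)
  | fatou_dec_right {a c} (h : IsFatou ν a c) (hlt : CLT ν (.itin c) (.itin a)) (t) :
      CLT ν (.fatou a c t) (.itin a)
  | fatou_dec {a c} (h : IsFatou ν a c) (hlt : CLT ν (.itin c) (.itin a)) {s t} (hst : s < t) :
      CLT ν (.fatou a c t) (.fatou a c s)
  | trans {x y z} (hxy : CLT ν x y) (hyz : CLT ν y z) : CLT ν x z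

/-- The order topology on the critical path. -/
@[reducible] def topologyC (ν : StarSeq A) : TopologicalSpace (critPath ν) :=
  TopologicalSpace.generateFrom
    {S | ∃ y : critPath ν, S = {x | CLT ν x.1 y.1} ∨ S = {x | CLT ν y.1 x.1}}

/-! ### The Hubbard tree -/

/-- The Hubbard tree `⋃_n σ^n(C_ν)`. -/
def hubbardSet (ν : StarSeq A) : Set (Pt A) := ⋃ n : ℕ, Pt.shift^[n] '' critPath ν

/-- The Hubbard tree as a type. -/
abbrev HubbardTree (ν : StarSeq A) : Type := hubbardSet ν

open Classical in
/-- The topology of the Hubbard tree. If `ν` is `⋆`-periodic of period `p`, it is that of the finite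
tree `H_{p-1}`: a set is open if and only if for every `k ≤ p - 1` its preimage under
`σ^k` in `C_ν` is open, i.e. the quotient topology with respect to the maps `σ^k`, `k ≤ p - 1`, from
the interval `C_ν`. If `ν` is non-periodic, it is the subspace topology of `X_ν`
(points of `X_ν` being identified with the corresponding `Pt.itin a`). -/
instance hubbardTopology (ν : StarSeq A) : TopologicalSpace (HubbardTree ν) :=
  TopologicalSpace.induced (Subtype.val : HubbardTree ν → Pt A) <|
    if IsStarPeriodic ν then
      ⨆ k : Fin (Function.minimalPeriod shift ν),
        TopologicalSpace.coinduced (fun x : critPath ν => Pt.shift^[k] x.1) (topologyC ν)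
    else
      TopologicalSpace.coinduced (fun a : X ν => Pt.itin a.1) (topologyX ν)

theorem criticalValue_mem (ν : StarSeq A) : Pt.itin ν ∈ hubbardSet ν :=
  mem_iUnion.2 ⟨0, Pt.itin ν, Or.inl ⟨ν, rfl, Or.inl (Or.inl ⟨0, by simp [P]⟩)⟩, rfl⟩

/-- The critical value `ν`, as a point of the Hubbard tree. -/
def criticalValue (ν : StarSeq A) : HubbardTree ν := ⟨Pt.itin ν, criticalValue_mem ν⟩

/-- A point `x` of a tree `T` is an endpoint if `T \ {x}` is connected. -/
def IsEndpoint {T : Type*} [TopologicalSpace T] (x : T) : Prop := IsConnected ({x}ᶜ : Set T)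

end HubbardTrees

end

namespace HubbardTrees
variable {A : Type}

/-! To follow a sequence `x` along a sequence `y` is to shift `x` while the first symbols agree and
to restart it at `ν` when they disagree (`chop`). If `x` and `z` are ever cut at the same time, they
lie on the same side of `y` (`Sync`); otherwise `y` lies between them. This symbolic betweenness
behaves as in a tree: for a fixed base point `b`, the relation "`y` lies between `b` and `w`" is a
strict order.

The combinatorial core is that `ν` never lies between `⋆ν` and another point of its orbit
(`sync_critPt`; `arm_zero_eq` in the `⋆`-periodic case, where a side is named by the symbol that
replaces `⋆`). Otherwise, chopping both points along `ν`, each `σ^n ν` would separate the two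
chopped points, so one of them would be farther than `σ^n ν` as seen from `⋆ν`. The chopped points
are again orbit points, and some finite set of orbit points would contain a farther point for each
of its members, which is absurd.

The link to the critical path is that chopping `⋆ν` and `ν` along `y` is the same as refining the
lists `P_n` towards `y` (`Resid`): each cut that is not simultaneous replaces an end of the current
pair of neighbours by their midpoint. Hence a sequence without `⋆` has a place in every `P_n`
exactly if it lies between `⋆ν` and `ν` (`Loc.notBoth`, `loc_of_notBoth`).

Now let open sets `U` and `V` separate the complement of `ν` in the tree, with `⋆ν` in `U`.
Neighbours whose images under `σ^k` lie in different sets could be bisected for ever, and openness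
at the limit gives a contradiction (`OpenSplit.node_iff`, `StarSplit.node_iff`). So the image of the
critical path can change sides only at a point `c` with `σ^k c = ν`. By the combinatorial core the
image leaves such a point in the direction of `⋆ν`, that is, along the critical path itself, which
lies in `U` (`OpenSplit.mem_of_dnode`, `StarSplit.mem_of_node`). Induction on `k` starts the walk
along `σ^k(C_ν)` because `σ^(k+1)(⋆ν) = σ^k ν`.

For `⋆`-periodic `ν` of period `p` the topology only sees the images with `k < p`, so the tree has
to be the union of these; this follows by pulling points back along the critical orbit
(`critPath_exists_shift_eq`). The order topology is made explicit there by the coordinates `pos` and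
`rk`. -/

/-! ### Shifts and first differences -/

theorem shift_iterate (a : StarSeq A) (n i : ℕ) : shift^[n] a i = a (i + n) := by
  induction n generalizing a with
  | zero => rfl
  | succ n ih => rw [Function.iterate_succ_apply, ih]; simp [shift]; ring_nf

theorem shift_iterate_add (a : StarSeq A) (m n : ℕ) :
    shift^[m] (shift^[n] a) = shift^[m + n] a := (Function.iterate_add_apply _ _ _ _).symm

theorem shift_critPt (ν : StarSeq A) : shift (critPt ν) = ν := rfl

theorem not_differ_iff {x y : Option A} : ¬ Differ x y ↔ x = none ∨ y = none ∨ x = y := by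
  unfold Differ
  cases x <;> cases y <;> simp

theorem differ_iff {x y : Option A} : Differ x y ↔ x ≠ none ∧ y ≠ none ∧ x ≠ y := by
  have := @not_differ_iff A x y
  tauto

theorem Differ.symm {x y : Option A} (h : Differ x y) : Differ y x := by
  rw [differ_iff] at *; tauto

/-- Positions are counted from 1 and indices from 0, so the strict bound corresponds to
compatibility at the indices `0, …, n - 1`. -/
theorem le_diff_iff {a b : StarSeq A} {n : ℕ} :
    (n : ℕ∞) < diff a b ↔ ∀ i < n, ¬ Differ (a i) (b i) := by
  rw [← not_le, ← not_iff_not, not_not]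
  push Not
  constructor
  · intro h
    by_contra! hc
    have : ((n + 1 : ℕ) : ℕ∞) ≤ diff a b := by
      refine le_iInf₂ fun i hi => ?_
      have : n ≤ i := by
        by_contra! hlt
        exact hc i hlt hi
      exact_mod_cast Nat.succ_le_succ this
    have h3 := this.trans h
    norm_cast at h3
    omega
  · rintro ⟨i, hi, hd⟩
    refine (iInf₂_le i hd).trans ?_
    exact_mod_cast hi

theorem diff_comm (a b : StarSeq A) : diff a b = diff b a := by
  have h : ∀ i, Differ (a i) (b i) ↔ Differ (b i) (a i) := fun i => ⟨Differ.symm, Differ.symm⟩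
  simp only [diff, h]

theorem diff_eq_top_iff {a b : StarSeq A} : diff a b = ⊤ ↔ ∀ i, ¬ Differ (a i) (b i) := by
  constructor
  · intro h i
    exact (le_diff_iff (n := i + 1)).1 (by rw [h]; exact ENat.natCast_lt_top _) i (by omega)
  · intro h
    simp [diff, h]

theorem diff_eq_succ_iff {a b : StarSeq A} {K : ℕ} : diff a b = ((K + 1 : ℕ) : ℕ∞) ↔
    Differ (a K) (b K) ∧ ∀ i < K, ¬ Differ (a i) (b i) := by
  constructor
  · intro h
    have h1 := (le_diff_iff (a := a) (b := b) (n := K)).1 (by rw [h]; exact_mod_cast Nat.lt_succ_self K)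
    refine ⟨?_, h1⟩
    by_contra hd
    have : ((K + 1 : ℕ) : ℕ∞) < diff a b := le_diff_iff.2 fun i hi => by
      rcases Nat.lt_succ_iff_lt_or_eq.1 hi with h | rfl
      exacts [h1 i h, hd]
    rw [h] at this
    exact lt_irrefl _ this
  · rintro ⟨hd, h⟩
    apply le_antisymm (iInf₂_le K hd)
    have := le_diff_iff.2 h
    have h2 := Order.add_one_le_of_lt this
    exact_mod_cast h2

theorem exists_diff_eq_succ {a b : StarSeq A} (h : diff a b ≠ ⊤) :
    ∃ K : ℕ, diff a b = ((K + 1 : ℕ) : ℕ∞) := by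
  classical
  have : ∃ i, Differ (a i) (b i) := by
    by_contra! hc
    exact h (diff_eq_top_iff.2 hc)
  exact ⟨Nat.find this, diff_eq_succ_iff.2 ⟨Nat.find_spec this, fun i hi => Nat.find_min this hi⟩⟩

/-! ### Chopping -/

open Classical in
/-- Follow the sequence `x` along the sequence `y`: shift as long as the first symbols coincide, and
restart at `ν` otherwise. -/
noncomputable def chop (ν x y : StarSeq A) : ℕ → StarSeq A
  | 0 => x
  | n + 1 => if chop ν x y n 0 = y n then shift (chop ν x y n) else ν

theorem chop_succ_of_eq {ν x y : StarSeq A} {n : ℕ} (h : chop ν x y n 0 = y n) :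
    chop ν x y (n + 1) = shift (chop ν x y n) := by
  simp [chop, h]

theorem chop_succ_of_ne {ν x y : StarSeq A} {n : ℕ} (h : chop ν x y n 0 ≠ y n) :
    chop ν x y (n + 1) = ν := by
  simp [chop, h]

/-- Chopping has no memory: after `n` steps the same process runs along the shifted sequence.
Betweenness can therefore be carried forward in time. -/
theorem chop_add (ν x y : StarSeq A) (n t : ℕ) :
    chop ν x y (n + t) = chop ν (chop ν x y n) (shift^[n] y) t := by
  induction t with
  | zero => rfl
  | succ t ih =>
    rw [← add_assoc]
    simp only [chop]
    rw [ih, shift_iterate, add_comm t n]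

theorem chop_congr {ν x y y' : StarSeq A} {n : ℕ} (h : ∀ i < n, y i = y' i) :
    chop ν x y n = chop ν x y' n := by
  induction n with
  | zero => rfl
  | succ n ih =>
    simp only [chop]
    rw [ih fun i hi => h i (by omega), h n (by omega)]

theorem chop_of_agree {ν x y : StarSeq A} {n : ℕ} (h : ∀ i < n, x i = y i) :
    chop ν x y n = shift^[n] x := by
  induction n with
  | zero => rfl
  | succ n ih =>
    have h1 := ih fun i hi => h i (by omega)
    rw [chop_succ_of_eq, h1, Function.iterate_succ_apply']
    rw [h1, shift_iterate]
    simpa using h n (by omega)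

/-- Both `x` and `z` are chopped off at the same time when they follow `y`. -/
def Sync (ν y x z : StarSeq A) : Prop := ∃ n, chop ν x y n 0 ≠ y n ∧ chop ν z y n 0 ≠ y n

/-- A simultaneous cut restarts both at `ν`, and the two processes coincide from then on. This makes
`Sync` transitive. -/
theorem chop_eq_of_cut {ν x y z : StarSeq A} {n m : ℕ} (hx : chop ν x y n 0 ≠ y n)
    (hz : chop ν z y n 0 ≠ y n) (h : n < m) : chop ν x y m = chop ν z y m := by
  obtain ⟨t, rfl⟩ := Nat.exists_eq_add_of_lt h
  rw [show n + t + 1 = (n + 1) + t by ring, chop_add, chop_add ν z, chop_succ_of_ne hx,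
    chop_succ_of_ne hz]

theorem Sync.symm {ν y x z : StarSeq A} (h : Sync ν y x z) : Sync ν y z x :=
  let ⟨n, h1, h2⟩ := h; ⟨n, h2, h1⟩

theorem Sync.trans {ν y x z v : StarSeq A} (h : Sync ν y x z) (h' : Sync ν y z v) :
    Sync ν y x v := by
  obtain ⟨n, hx, hz⟩ := h
  obtain ⟨m, hz', hv⟩ := h'
  rcases lt_trichotomy n m with hlt | rfl | hlt
  · exact ⟨m, by rwa [chop_eq_of_cut hx hz hlt], hv⟩
  · exact ⟨n, hx, hv⟩
  · exact ⟨n, hx, by rwa [← chop_eq_of_cut hz' hv hlt]⟩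

theorem exists_first_ne {y z : StarSeq A} (h : y ≠ z) :
    ∃ k, y k ≠ z k ∧ ∀ i < k, y i = z i := by
  classical
  have : ∃ k, y k ≠ z k := Function.ne_iff.1 h
  exact ⟨Nat.find this, Nat.find_spec this, fun i hi => not_not.1 (Nat.find_min this hi)⟩

/-- If `y` is between `x` and `z`, then `z` is not between `x` and `y`. -/
theorem sync_of_not_sync {ν x y z : StarSeq A} (hyz : y ≠ z) (h : ¬ Sync ν y x z) :
    Sync ν z x y := by
  obtain ⟨k, hk, hlt⟩ := exists_first_ne hyz
  -- Up to their first difference `k`, `y` and `z` follow each other, and at `k` each is cut along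
  -- the other. As `x` is not cut with `z`, it fits `y` at `k`, so along `z` it is cut together with
  -- `y`.
  have hz : chop ν z y k 0 = z k := by
    rw [chop_of_agree fun i hi => (hlt i hi).symm, shift_iterate, zero_add]
  have hy : chop ν y z k 0 = y k := by
    rw [chop_of_agree hlt, shift_iterate, zero_add]
  have hx : chop ν x y k 0 = y k := by
    by_contra hc
    exact h ⟨k, hc, by rw [hz]; exact hk.symm⟩
  refine ⟨k, ?_, by rwa [hy]⟩
  rw [chop_congr (y' := y) fun i hi => (hlt i hi).symm, hx]
  exact hk

/-- Transitivity of the order "farther from `b`". If `b` and `v` were on one side of `y` with `z` on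
the other, then `z` would see `b`, `y` and `v` on the same side. -/
theorem not_sync_trans {ν b y z v : StarSeq A} (hyz : y ≠ z) (hzv : z ≠ v)
    (h1 : ¬ Sync ν y b z) (h2 : ¬ Sync ν z b v) : y ≠ v ∧ ¬ Sync ν y b v := by
  have h3 := sync_of_not_sync hyz h1
  refine ⟨?_, fun h => ?_⟩
  · rintro rfl
    exact h2 h3
  · have h4 : ¬ Sync ν y v z := fun h' => h1 (h.trans h')
    exact h2 (h3.trans (sync_of_not_sync hyz h4).symm)

/-- A strict order on a non-empty finite set has a maximal element. Both arguments about the orbit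
of `ν` end by contradicting this. -/
theorem eq_empty_of_forall_exists_lt {α : Type*} {V : Set α} (hV : V.Finite) {r : α → α → Prop}
    (htrans : ∀ x y z, r x y → r y z → r x z) (hirr : ∀ x, ¬ r x x)
    (h : ∀ v ∈ V, ∃ w ∈ V, r v w) : V = ∅ := by
  by_contra hne
  obtain ⟨v0, hv0⟩ := nonempty_iff_ne_empty.2 hne
  have := hV.to_subtype
  have : IsTrans V (fun a b => r b.1 a.1) := ⟨fun a b c hab hbc => htrans _ _ _ hbc hab⟩
  have : Std.Irrefl (fun a b : V => r b.1 a.1) := ⟨fun a => hirr a.1⟩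
  have wf := Finite.wellFounded_of_trans_of_irrefl (fun a b : V => r b.1 a.1)
  obtain ⟨m, -, hm⟩ := wf.has_min Set.univ ⟨⟨v0, hv0⟩, trivial⟩
  obtain ⟨w, hw, hr⟩ := h m.1 m.2
  exact hm ⟨w, hw⟩ trivial hr

theorem isPeriodic_of_shift_eq {ν : StarSeq A} {n : ℕ} (hn : 0 < n) (h : shift^[n] ν = ν) :
    ν ∈ Function.periodicPts shift := ⟨n, hn, h⟩

/-- For a non-periodic kneading sequence, `ν` is not between `⋆ν` and any `σ^r ν`. -/
theorem sync_critPt {ν : StarSeq A} (hs : NoStar ν) (hp : ν ∉ Function.periodicPts shift)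
    {r : ℕ} (hr : 1 ≤ r) : Sync ν ν (critPt ν) (shift^[r] ν) := by
  by_contra hbad
  set x := chop ν (critPt ν) ν with hx
  set z := chop ν (shift^[r] ν) ν with hz
  -- A simultaneous cut seen from time `n` would be one for the original pair.
  have hns : ∀ n, ¬ Sync ν (shift^[n] ν) (x n) (z n) := by
    rintro n ⟨t, h1, h2⟩
    rw [← chop_add, shift_iterate, add_comm t n] at h1 h2
    exact hbad ⟨n + t, h1, h2⟩
  -- If no cut follows the one at time `t`, then `ν` restarted at time `t + 1` fits `ν` for ever, so
  -- `t + 1` is a period of `ν`.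
  have hcut : ∀ (u : StarSeq A) t, chop ν u ν t 0 ≠ ν t →
      ∃ t' > t, chop ν u ν t' 0 ≠ ν t' := by
    intro u t ht
    by_contra! hc
    have h1 : ∀ s, chop ν u ν (t + 1 + s) = shift^[s] ν := by
      intro s
      induction s with
      | zero => exact chop_succ_of_ne ht
      | succ s ih =>
        rw [← add_assoc, chop_succ_of_eq (hc _ (by omega)), ih, Function.iterate_succ_apply']
    refine hp (isPeriodic_of_shift_eq (n := t + 1) (by omega) ?_)
    funext s
    rw [shift_iterate, add_comm s, ← hc _ (by omega), h1, shift_iterate, zero_add]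
  -- A sequence that is cut once is cut infinitely often, whereas one that equals `σ^n ν` at time
  -- `n` is never cut again.
  have hinf : ∀ (u : StarSeq A) t, chop ν u ν t 0 ≠ ν t → ∀ n, chop ν u ν n ≠ shift^[n] ν := by
    intro u t ht n hn
    have h2 : ∀ m, ∃ t' ≥ m, chop ν u ν t' 0 ≠ ν t' := by
      intro m
      induction m with
      | zero => exact ⟨t, Nat.zero_le _, ht⟩
      | succ m ih =>
        obtain ⟨t', h, h'⟩ := ih
        obtain ⟨t'', h3, h4⟩ := hcut u t' h'
        exact ⟨t'', by omega, h4⟩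
    obtain ⟨t', h, h'⟩ := h2 n
    obtain ⟨s, rfl⟩ := Nat.exists_eq_add_of_le h
    apply h'
    rw [chop_add, hn, chop_of_agree fun i _ => rfl, shift_iterate, shift_iterate]
    simp [add_comm]
  have hx0 : x 0 0 ≠ ν 0 := fun h => hs 0 h.symm
  -- After a cut the sequence is `σ^i ν`, where `i` is the time since the last restart; it is less
  -- than the total time.
  have hfirst : ∀ (u : StarSeq A) k, chop ν u ν k 0 ≠ ν k → ∀ n ≥ k + 1, ∃ i < n,
      chop ν u ν n = shift^[i] ν := by
    intro u k hk n hn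
    induction n, hn using Nat.le_induction with
    | base => exact ⟨0, by omega, chop_succ_of_ne hk⟩
    | succ n hn ih =>
      obtain ⟨i, hi, he⟩ := ih
      by_cases h : chop ν u ν n 0 = ν n
      · exact ⟨i + 1, by omega, by rw [chop_succ_of_eq h, he, Function.iterate_succ_apply']⟩
      · exact ⟨0, by omega, chop_succ_of_ne h⟩
  obtain ⟨k, hk⟩ : ∃ k, z k 0 ≠ ν k := by
    by_contra! hc
    refine hp (isPeriodic_of_shift_eq (n := r) (by omega) ?_)
    have h1 : ∀ s, z s = shift^[s] (shift^[r] ν) := by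
      intro s
      induction s with
      | zero => rfl
      | succ s ih => rw [hz, chop_succ_of_eq (hc _), ← hz, ih, Function.iterate_succ_apply']
    funext s
    rw [← hc s, h1, shift_iterate, shift_iterate, shift_iterate, zero_add]
  -- `lt y w` says that `w` is beyond `y` as seen from `⋆ν`.
  set lt : StarSeq A → StarSeq A → Prop := fun y w => y ≠ w ∧ ¬ Sync ν y (critPt ν) w with hlt
  have htrans : ∀ y w v, lt y w → lt w v → lt y v := fun y w v h h' =>
    not_sync_trans h.1 h'.1 h.2 h'.2
  -- Since `σ^n ν` separates `x n` from `z n`, at most one of them shares the side of `⋆ν`. At `n =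
  -- 0` it is `x 0 = ⋆ν` itself; the bound `1 ≤ n` is kept because `x n` is an orbit point only
  -- then.
  have step : ∀ n, (1 ≤ n ∧ lt (shift^[n] ν) (x n)) ∨ lt (shift^[n] ν) (z n) := by
    intro n
    rcases Nat.eq_zero_or_pos n with rfl | hn
    · exact Or.inr ⟨(hinf _ k hk 0).symm, hns 0⟩
    · by_cases h : Sync ν (shift^[n] ν) (critPt ν) (x n)
      · refine Or.inr ⟨(hinf _ k hk n).symm, fun h' => hns n (h.symm.trans h')⟩
      · exact Or.inl ⟨hn, (hinf _ 0 hx0 n).symm, h⟩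
  -- For `n > k` both chopped points are orbit points of smaller index, so passing to a farther one
  -- lowers the index until it is at most `k`.
  have down : ∀ n, ∃ j < k + 1, shift^[n] ν = shift^[j] ν ∨ lt (shift^[n] ν) (shift^[j] ν) := by
    intro n
    induction n using Nat.strong_induction_on with
    | _ n ih =>
      rcases Nat.lt_or_ge n (k + 1) with hn | hn
      · exact ⟨n, hn, Or.inl rfl⟩
      · obtain ⟨i, hi, h⟩ : ∃ i < n, lt (shift^[n] ν) (shift^[i] ν) := by
          rcases step n with ⟨_, h⟩ | h
          · obtain ⟨i, hi, he⟩ := hfirst _ 0 hx0 n (by omega)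
            exact ⟨i, hi, he ▸ h⟩
          · obtain ⟨i, hi, he⟩ := hfirst _ k hk n hn
            exact ⟨i, hi, he ▸ h⟩
        obtain ⟨j, hj, h'⟩ := ih i hi
        refine ⟨j, hj, Or.inr ?_⟩
        rcases h' with h' | h'
        · rwa [← h']
        · exact htrans _ _ _ h h'
  have hex : ∀ n, ∃ m, lt (shift^[n] ν) (shift^[m] ν) := by
    have horb : ∀ n, ∃ m, z n = shift^[m] ν := by
      intro n
      induction n with
      | zero => exact ⟨r, rfl⟩
      | succ n ih =>
        obtain ⟨m, hm⟩ := ih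
        by_cases h : z n 0 = ν n
        · exact ⟨m + 1, by rw [hz, chop_succ_of_eq h, ← hz, hm, Function.iterate_succ_apply']⟩
        · exact ⟨0, chop_succ_of_ne h⟩
    intro n
    rcases step n with ⟨hn, h⟩ | h
    · obtain ⟨i, hi, he⟩ := hfirst _ 0 hx0 n (by omega)
      exact ⟨i, he ▸ h⟩
    · obtain ⟨m, hm⟩ := horb n
      exact ⟨m, hm ▸ h⟩
  have := eq_empty_of_forall_exists_lt (V := (fun j => shift^[j] ν) '' Iio (k + 1))
    ((finite_Iio _).image _) (r := lt) htrans (fun y h => h.1 rfl) (by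
      rintro _ ⟨n, -, rfl⟩
      obtain ⟨m, hm⟩ := hex n
      obtain ⟨j, hj, h⟩ := down m
      refine ⟨_, ⟨j, hj, rfl⟩, ?_⟩
      rcases h with h | h
      · simpa only [← h] using hm
      · exact htrans _ _ _ hm h)
  exact (this ▸ (⟨0, by simp, rfl⟩ : shift^[0] ν ∈ (fun j => shift^[j] ν) '' Iio (k + 1)) :
    shift^[0] ν ∈ (∅ : Set (StarSeq A)))


/-! ### Arms at the orbit points of a `⋆`-periodic sequence -/

/-- The exact period. -/
noncomputable abbrev period (ν : StarSeq A) : ℕ := Function.minimalPeriod shift ν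

theorem IsStarPeriodic.period_pos {ν : StarSeq A} (h : IsStarPeriodic ν) : 0 < period ν :=
  Function.minimalPeriod_pos_of_mem_periodicPts h.1

theorem shift_period (ν : StarSeq A) : shift^[period ν] ν = ν :=
  Function.iterate_minimalPeriod

theorem shift_mod_period (ν : StarSeq A) (i : ℕ) : shift^[i % period ν] ν = shift^[i] ν :=
  Function.iterate_mod_minimalPeriod_eq

theorem IsStarPeriodic.eq_none_iff {ν : StarSeq A} (h : IsStarPeriodic ν) (i : ℕ) :
    ν i = none ↔ period ν ∣ i + 1 := by
  have h1 : ν i = ν (i % period ν) := by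
    have := congrFun (shift_mod_period ν i) 0
    simpa [shift_iterate] using this.symm
  have hlt := Nat.mod_lt i h.period_pos
  rw [h1, h.2 _ hlt]
  have h2 := Nat.div_add_mod i (period ν)
  constructor
  · intro h3
    exact ⟨i / period ν + 1, by rw [mul_add]; change _ + 1 = period ν at h3; omega⟩
  · rintro ⟨k, hk⟩
    change i % period ν + 1 = period ν
    have h3 : period ν ∣ i % period ν + 1 := by
      have h4 : period ν ∣ period ν * (i / period ν) + (i % period ν + 1) :=
        ⟨k, by omega⟩
      exact (Nat.dvd_add_right (Dvd.intro _ rfl)).1 h4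
    exact le_antisymm hlt (Nat.le_of_dvd (by omega) h3)

theorem IsStarPeriodic.two_le_period {ν : StarSeq A} (h : IsStarPeriodic ν)
    (hne : ν ≠ trivialSeq A) : 2 ≤ period ν := by
  by_contra! hlt
  have h1 : period ν = 1 := by have := h.period_pos; omega
  apply hne
  funext i
  exact (h.eq_none_iff i).2 (by rw [h1]; exact one_dvd _)

/-- The predecessor of `ν` on its cycle is `⋆ν`, so here both ends of the critical path lie in a
finite orbit which chopping never leaves. -/
theorem IsStarPeriodic.critPt_eq {ν : StarSeq A} (h : IsStarPeriodic ν) :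
    critPt ν = shift^[period ν - 1] ν := by
  funext i
  have hp := h.period_pos
  rw [shift_iterate]
  cases i with
  | zero =>
    rw [zero_add, (h.eq_none_iff _).2 (by rw [Nat.sub_add_cancel hp])]
    rfl
  | succ i =>
    have := congrFun (shift_period ν) i
    rw [shift_iterate] at this
    rw [show i + 1 + (period ν - 1) = i + period ν by omega, this]
    rfl

/-- The forward orbit of `ν`. -/
def orb (ν : StarSeq A) : Set (StarSeq A) := {x | ∃ i, x = shift^[i] ν}

theorem self_mem_orb (ν : StarSeq A) : ν ∈ orb ν := ⟨0, rfl⟩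

theorem iterate_mem_orb (ν : StarSeq A) (i : ℕ) : shift^[i] ν ∈ orb ν := ⟨i, rfl⟩

theorem IsStarPeriodic.critPt_mem_orb {ν : StarSeq A} (h : IsStarPeriodic ν) :
    critPt ν ∈ orb ν := ⟨_, h.critPt_eq⟩

theorem chop_mem_orb {ν x y : StarSeq A} (hx : x ∈ orb ν) (n : ℕ) : chop ν x y n ∈ orb ν := by
  induction n with
  | zero => exact hx
  | succ n ih =>
    by_cases h : chop ν x y n 0 = y n
    · obtain ⟨i, hi⟩ := ih
      exact ⟨i + 1, by rw [chop_succ_of_eq h, hi, Function.iterate_succ_apply']⟩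
    · exact ⟨0, chop_succ_of_ne h⟩

theorem exists_lt_period_of_mem_orb {ν x : StarSeq A} (h : IsStarPeriodic ν) (hx : x ∈ orb ν) :
    ∃ i < period ν, x = shift^[i] ν := by
  obtain ⟨i, rfl⟩ := hx
  exact ⟨i % period ν, Nat.mod_lt _ h.period_pos, (shift_mod_period ν i).symm⟩

/-- The arm at `σ^n ν` (where `n < p`) that contains `x`. -/
noncomputable def arm (ν : StarSeq A) (n : ℕ) (x : StarSeq A) : Option A :=
  -- `period ν - 1 - n` is the index of the first `⋆` of `σ^n ν`; the symbol that the chopped `x`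
  -- shows there names the arm.
  chop ν x (shift^[n] ν) (period ν - 1 - n) 0

/-- The counterpart of `sync_of_not_sync` for arms. The comparison is settled at the first
difference of the two orbit points, which comes no later than the index at which either arm is read.
-/
theorem arm_eq_of_arm_ne {ν x : StarSeq A} (h : IsStarPeriodic ν) {n m : ℕ} (hn : n < period ν)
    (hm : m < period ν) (hnm : n ≠ m) (hne : arm ν n x ≠ arm ν n (shift^[m] ν)) :
    arm ν m x = arm ν m (shift^[n] ν) := by
  have hstar : ∀ j < period ν, shift^[j] ν (period ν - 1 - j) = none := by
    intro j hj
    rw [shift_iterate, show period ν - 1 - j + j = period ν - 1 by omega, h.eq_none_iff]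
    exact ⟨1, by omega⟩
  have hns : ∀ j < period ν, ∀ i < period ν - 1 - j, shift^[j] ν i ≠ none := by
    intro j hj i hi
    rw [shift_iterate, Ne, h.eq_none_iff]
    intro hd
    have := Nat.le_of_dvd (by omega) hd
    omega
  have hyz : shift^[n] ν ≠ shift^[m] ν := by
    intro he
    rcases lt_or_gt_of_ne hnm with hlt | hlt
    · exact hns n hn (period ν - 1 - m) (by omega) (by rw [he]; exact hstar m hm)
    · exact hns m hm (period ν - 1 - n) (by omega) (by rw [← he]; exact hstar n hn)
  obtain ⟨k, hk, hlt⟩ := exists_first_ne hyz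
  set y := shift^[n] ν with hy
  set z := shift^[m] ν with hz
  -- Agreement beyond the first `⋆` of one point would put the first `⋆` of the other at the same
  -- index, forcing `n = m`.
  have hkn : k ≤ period ν - 1 - n := by
    by_contra! hc
    have h1 := hstar n hn
    rw [← hy, hlt _ hc] at h1
    have : ¬ period ν - 1 - n < period ν - 1 - m := fun h' => hns m hm _ h' h1
    have h2 := hstar m hm
    rw [← hz, ← hlt _ (by omega)] at h2
    have : ¬ period ν - 1 - m < period ν - 1 - n := fun h' => hns n hn _ h' h2
    omega
  have hkm : k ≤ period ν - 1 - m := by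
    by_contra! hc
    have h2 := hstar m hm
    rw [← hz, ← hlt _ hc] at h2
    have : ¬ period ν - 1 - m < period ν - 1 - n := fun h' => hns n hn _ h' h2
    have h1 := hstar n hn
    rw [← hy, hlt _ (by omega)] at h1
    have : ¬ period ν - 1 - n < period ν - 1 - m := fun h' => hns m hm _ h' h1
    omega
  have hzk : chop ν z y k 0 = z k := by
    rw [chop_of_agree fun i hi => (hlt i hi).symm, shift_iterate, zero_add]
  have hyk : chop ν y z k 0 = y k := by
    rw [chop_of_agree hlt, shift_iterate, zero_add]
  have hxk : chop ν x z k = chop ν x y k := chop_congr fun i hi => (hlt i hi).symm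
  -- At index `k` either `σ^n ν` shows its `⋆`, or `σ^m ν` does, or both show symbols.
  by_cases hk1 : k = period ν - 1 - n
  · have hx : chop ν x y k 0 ≠ z k := by
      rw [← hzk, hk1]; exact hne
    have hkm' : k < period ν - 1 - m := by omega
    unfold arm
    rw [chop_eq_of_cut (n := k) _ _ hkm']
    · rw [← hz, hxk]; exact hx
    · rw [← hz, hyk]; exact hk
  · have hkn' : k < period ν - 1 - n := by omega
    have hx : chop ν x y k 0 = y k := by
      by_contra hc
      apply hne
      unfold arm
      rw [chop_eq_of_cut (n := k) hc _ hkn']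
      rw [hzk]; exact hk.symm
    by_cases hk2 : k = period ν - 1 - m
    · unfold arm
      rw [← hk2, ← hz, hxk, hx, hyk]
    · have hkm' : k < period ν - 1 - m := by omega
      unfold arm
      rw [chop_eq_of_cut (n := k) _ _ hkm']
      · rw [← hz, hxk, hx]; exact hk
      · rw [← hz, hyk]; exact hk

/-- If the orbit point is never cut, a `⋆` at the reading time would mean that it has the phase of
`σ^n ν`. If it is cut, the last restart at `ν` is too recent for a `⋆` to appear. -/
theorem arm_ne_none {ν : StarSeq A} (h : IsStarPeriodic ν) {n i : ℕ} (hn : n < period ν)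
    (hi : ¬ i ≡ n [MOD period ν]) : arm ν n (shift^[i] ν) ≠ none := by
  have key : ∀ t, chop ν (shift^[i] ν) (shift^[n] ν) t = shift^[i + t] ν ∨
      ∃ j < t, chop ν (shift^[i] ν) (shift^[n] ν) t = shift^[j] ν := by
    intro t
    induction t with
    | zero => exact Or.inl rfl
    | succ t ih =>
      by_cases hc : chop ν (shift^[i] ν) (shift^[n] ν) t 0 = shift^[n] ν t
      · rw [chop_succ_of_eq hc]
        rcases ih with ih | ⟨j, hj, ih⟩
        · left; rw [ih, ← add_assoc, Function.iterate_succ_apply']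
        · right; exact ⟨j + 1, by omega, by rw [ih, Function.iterate_succ_apply']⟩
      · right; exact ⟨0, by omega, chop_succ_of_ne hc⟩
  unfold arm
  rcases key (period ν - 1 - n) with h1 | ⟨j, hj, h1⟩
  · rw [h1, shift_iterate, Ne, h.eq_none_iff]
    intro hd
    apply hi
    have h2 : i + period ν ≡ n [MOD period ν] := by
      refine ((Nat.modEq_iff_dvd' (by omega)).2 ?_).symm
      convert hd using 1
      omega
    simpa using h2
  · rw [h1, shift_iterate, Ne, h.eq_none_iff]
    intro hd
    have := Nat.le_of_dvd (by omega) hd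
    omega

/-- Both arms are read at the first `⋆` of `ν`; chopping along `ν` merely splits the time until
then. -/
theorem chop_arm {ν x : StarSeq A} {n : ℕ} (hn : n < period ν) :
    arm ν n (chop ν x ν n) = arm ν 0 x := by
  unfold arm
  rw [← chop_add, Nat.sub_zero, show n + (period ν - 1 - n) = period ν - 1 by omega]
  rfl

/-- For a `⋆`-periodic sequence, all points of the orbit other than `ν` are in the same arm
at `ν`. -/
theorem arm_zero_eq {ν : StarSeq A} (h : IsStarPeriodic ν) (h2 : 2 ≤ period ν) {r : ℕ}
    (hr : ¬ period ν ∣ r) : arm ν 0 (shift^[r] ν) = arm ν 0 (critPt ν) := by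
  by_contra hbad
  have hcr : critPt ν = shift^[period ν - 1] ν := h.critPt_eq
  have hp1 : ¬ period ν - 1 ≡ 0 [MOD period ν] := by
    rw [Nat.modEq_zero_iff_dvd]
    intro hd
    have := Nat.le_of_dvd (by omega) hd
    omega
  have hr' : ¬ r ≡ 0 [MOD period ν] := by rwa [Nat.modEq_zero_iff_dvd]
  set lt : ℕ → ℕ → Prop := fun n m => n < period ν ∧ m < period ν ∧ n ≠ m ∧
    arm ν n (critPt ν) ≠ arm ν n (shift^[m] ν) with hlt
  have htrans : ∀ n m v, lt n m → lt m v → lt n v := by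
    rintro n m v ⟨hn, hm, hnm, h1⟩ ⟨-, hv, hmv, h3⟩
    have h4 := arm_eq_of_arm_ne h hn hm hnm h1
    have hnv : n ≠ v := by
      rintro rfl
      exact h3 h4
    refine ⟨hn, hv, hnv, fun he => ?_⟩
    have h5 := arm_eq_of_arm_ne h hn hm hnm (x := shift^[v] ν) (by rwa [← he])
    exact h3 (by rw [h4, h5])
  have hself : ∀ n < period ν, arm ν n (shift^[n] ν) = none := by
    intro n hn
    unfold arm
    rw [chop_of_agree fun _ _ => rfl, shift_iterate, shift_iterate, h.eq_none_iff]
    exact ⟨1, by omega⟩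
  -- The two points, chopped along `ν` for `n` steps, are in different arms at `σ^n ν`, so at least
  -- one is not in the arm of `⋆ν`. It is a farther orbit point, and it is not `⋆ν` itself, which
  -- has index `period ν - 1`.
  have hex : ∀ n < period ν - 1, ∃ m < period ν - 1, lt n m := by
    intro n hn
    have key : ∀ w ∈ orb ν, arm ν n w ≠ none → arm ν n (critPt ν) ≠ arm ν n w →
        ∃ m < period ν - 1, lt n m := by
      intro w hw hw1 hw2
      obtain ⟨m, hm, rfl⟩ := exists_lt_period_of_mem_orb h hw
      have hne : m ≠ period ν - 1 := by
        rintro rfl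
        exact hw2 (by rw [hcr])
      refine ⟨m, by omega, by omega, hm, ?_, hw2⟩
      rintro rfl
      exact hw1 (hself _ hm)
    have ha : arm ν n (chop ν (critPt ν) ν n) = arm ν 0 (critPt ν) := chop_arm (by omega)
    have hb : arm ν n (chop ν (shift^[r] ν) ν n) = arm ν 0 (shift^[r] ν) := chop_arm (by omega)
    by_cases hc : arm ν n (critPt ν) = arm ν n (chop ν (critPt ν) ν n)
    · refine key (chop ν (shift^[r] ν) ν n) (chop_mem_orb (iterate_mem_orb ν r) n) ?_ ?_
      · rw [hb]; exact arm_ne_none h (by omega) hr'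
      · rw [hc, ha, hb]; exact fun he => hbad he.symm
    · refine key (chop ν (critPt ν) ν n) (chop_mem_orb h.critPt_mem_orb n) ?_ hc
      rw [ha, hcr]
      exact arm_ne_none h (by omega) hp1
  have := eq_empty_of_forall_exists_lt (V := Iio (period ν - 1)) (finite_Iio _) (r := lt) htrans
    (fun n hn => hn.2.2.1 rfl) hex
  exact (this ▸ (show 0 ∈ Iio (period ν - 1) from by simp; omega) : 0 ∈ (∅ : Set ℕ))


/-! ### Midpoints -/

/-- The properties of a non-trivial kneading sequence that are common to both cases. -/
structure Knead (ν : StarSeq A) : Prop where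
  zero : ν 0 ≠ none
  -- Index form of the fact that two positions of `⋆` differ by a multiple of the period; vacuous if
  -- `ν` has no `⋆`.
  gap : ∀ i j, ν i = none → ν (i + j + 1) = none → ν j = none
  restart : ∀ i, ν i = none → shift^[i + 1] ν = ν

theorem IsStarPeriodic.knead {ν : StarSeq A} (h : IsStarPeriodic ν) (h2 : 2 ≤ period ν) :
    Knead ν where
  zero := by
    rw [Ne, h.eq_none_iff]
    intro hd
    have := Nat.le_of_dvd (by omega) hd
    omega
  gap i j := by
    simp only [h.eq_none_iff]
    intro h1 h3
    rw [show i + j + 1 + 1 = (i + 1) + (j + 1) by ring] at h3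
    exact (Nat.dvd_add_right h1).1 h3
  restart i hi := by
    rw [h.eq_none_iff] at hi
    rw [← shift_mod_period, Nat.mod_eq_zero_of_dvd hi]
    rfl

theorem NoStar.knead {ν : StarSeq A} (h : NoStar ν) : Knead ν :=
  ⟨h 0, fun i _ hi => (h i hi).elim, fun i hi => (h i hi).elim⟩

section midpoint

variable {ν e e' : StarSeq A} {K : ℕ}

theorem midpoint_of_lt (h : diff e e' = ((K + 1 : ℕ) : ℕ∞)) {i : ℕ} (hi : i < K) :
    midpoint ν e e' i = (e i).or (e' i) := by
  simp only [midpoint, h, ENat.toNat_natCast]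
  rw [if_pos (by omega)]

theorem midpoint_self (h : diff e e' = ((K + 1 : ℕ) : ℕ∞)) : midpoint ν e e' K = none := by
  simp only [midpoint, h, ENat.toNat_natCast]
  simp

theorem midpoint_of_gt (h : diff e e' = ((K + 1 : ℕ) : ℕ∞)) (i : ℕ) :
    midpoint ν e e' (i + (K + 1)) = ν i := by
  simp only [midpoint, h, ENat.toNat_natCast]
  rw [if_neg (by omega), if_neg (by omega)]
  simp

theorem shift_midpoint (h : diff e e' = ((K + 1 : ℕ) : ℕ∞)) :
    shift^[K + 1] (midpoint ν e e') = ν := by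
  funext i
  rw [shift_iterate, midpoint_of_gt h]

theorem or_comm_of_not_differ {x y : Option A} (h : ¬ Differ x y) : x.or y = y.or x := by
  rw [not_differ_iff] at h
  rcases h with rfl | rfl | rfl <;> simp

theorem midpoint_comm (ν : StarSeq A) (h : diff e e' ≠ ⊤) : midpoint ν e e' = midpoint ν e' e := by
  obtain ⟨K, hK⟩ := exists_diff_eq_succ h
  have hK' := hK
  rw [diff_comm] at hK'
  funext i
  rcases lt_trichotomy i K with hi | rfl | hi
  · rw [midpoint_of_lt hK hi, midpoint_of_lt hK' hi,
      or_comm_of_not_differ ((diff_eq_succ_iff.1 hK).2 i hi)]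
  · rw [midpoint_self hK, midpoint_self hK']
  · obtain ⟨j, rfl⟩ := Nat.exists_eq_add_of_lt hi
    rw [show K + j + 1 = j + (K + 1) by ring, midpoint_of_gt hK, midpoint_of_gt hK']

end midpoint

/-! ### Depths of precritical points and invariants of neighbours -/

/-- `a` is precritical of depth `l ≥ 1`, or it is `ν` and `l = 0`. -/
def HasDepth (ν : StarSeq A) : ℕ → StarSeq A → Prop
  | 0, a => a = ν
  | m + 1, a => IsWordStar ν m a

theorem HasDepth.shift_eq {ν a : StarSeq A} {l : ℕ} (h : HasDepth ν l a) : shift^[l] a = ν := by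
  cases l with
  | zero => exact h
  | succ m => exact h.2.2

theorem HasDepth.apply_add {ν a : StarSeq A} {l : ℕ} (h : HasDepth ν l a) (i : ℕ) :
    a (i + l) = ν i := by
  rw [← shift_iterate a l i, h.shift_eq]

/-- Properties of neighbours of depths `l` and `l'` in some `P_n`. -/
structure Good (ν : StarSeq A) (l l' : ℕ) (e e' : StarSeq A) : Prop where
  depth : HasDepth ν l e
  depth' : HasDepth ν l' e'
  ne : l ≠ l'
  lt : (l : ℕ∞) < diff e e'
  lt' : (l' : ℕ∞) < diff e e'
  star : ∀ i, e i ≠ none ∨ e' i ≠ none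

theorem Good.symm {ν e e' : StarSeq A} {l l' : ℕ} (h : Good ν l l' e e') : Good ν l' l e' e where
  depth := h.depth'
  depth' := h.depth
  ne := h.ne.symm
  lt := by rw [diff_comm]; exact h.lt'
  lt' := by rw [diff_comm]; exact h.lt
  star i := (h.star i).symm

theorem Good.isWordStar_midpoint {ν e e' : StarSeq A} {l l' K : ℕ} (h : Good ν l l' e e')
    (hK : diff e e' = ((K + 1 : ℕ) : ℕ∞)) : IsWordStar ν K (midpoint ν e e') := by
  refine ⟨fun i hi => ?_, midpoint_self hK, shift_midpoint hK⟩
  rw [midpoint_of_lt hK hi]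
  have := h.star i
  rw [Ne, Option.or_eq_none_iff]
  tauto

theorem lt_diff_midpoint {ν e e' : StarSeq A} {K : ℕ} (hK : diff e e' = ((K + 1 : ℕ) : ℕ∞)) :
    ((K + 1 : ℕ) : ℕ∞) < diff e (midpoint ν e e') := by
  refine le_diff_iff.2 fun i hi => ?_
  rw [not_differ_iff]
  rcases Nat.lt_succ_iff_lt_or_eq.1 hi with hi | rfl
  · rw [midpoint_of_lt hK hi]
    cases e i <;> simp
  · rw [midpoint_self hK]
    tauto

theorem Good.left {ν e e' : StarSeq A} {l l' K : ℕ} (hν : Knead ν) (h : Good ν l l' e e')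
    (hK : diff e e' = ((K + 1 : ℕ) : ℕ∞)) : Good ν l (K + 1) e (midpoint ν e e') := by
  have hl : l < K + 1 := by
    have := h.lt
    rw [hK] at this
    exact_mod_cast this
  have hd := lt_diff_midpoint (ν := ν) hK
  refine ⟨h.depth, h.isWordStar_midpoint hK, by omega, lt_trans (by exact_mod_cast hl) hd, hd, ?_⟩
  intro i
  rcases lt_trichotomy i K with hi | rfl | hi
  · right
    exact (h.isWordStar_midpoint hK).1 i hi
  · left
    exact (differ_iff.1 (diff_eq_succ_iff.1 hK).1).1
  · obtain ⟨j, rfl⟩ := Nat.exists_eq_add_of_lt hi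
    -- A common `⋆` beyond `K` would, by the spacing of the `⋆`s in `ν`, put a `⋆` at index `K` of
    -- `e`, where `e` and `e'` differ.
    by_contra! hc
    obtain ⟨h1, h2⟩ := hc
    rw [show K + j + 1 = j + (K + 1) by ring, midpoint_of_gt hK] at h2
    rw [show K + j + 1 = (j + (K - l) + 1) + l by omega, h.depth.apply_add] at h1
    have h3 := hν.gap _ _ h2 h1
    have h4 := (differ_iff.1 (diff_eq_succ_iff.1 hK).1).1
    rw [show K = (K - l) + l by omega, h.depth.apply_add] at h4
    exact h4 h3

theorem Good.right {ν e e' : StarSeq A} {l l' K : ℕ} (hν : Knead ν) (h : Good ν l l' e e')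
    (hK : diff e e' = ((K + 1 : ℕ) : ℕ∞)) : Good ν (K + 1) l' (midpoint ν e e') e' := by
  have hK' := hK
  rw [diff_comm] at hK'
  rw [midpoint_comm ν (by rw [hK]; exact ENat.natCast_ne_top _)]
  exact (h.symm.left hν hK').symm

theorem good_root {ν : StarSeq A} (hν : Knead ν) : Good ν 1 0 (critPt ν) ν := by
  have h1 : ((1 : ℕ) : ℕ∞) < diff (critPt ν) ν := le_diff_iff.2 fun i hi => by
    rw [not_differ_iff]
    left
    rw [show i = 0 by omega]
    rfl
  refine ⟨⟨by simp, rfl, shift_critPt ν⟩, rfl, one_ne_zero, h1, lt_trans (by norm_num) h1, ?_⟩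
  intro i
  cases i with
  | zero => exact Or.inr hν.zero
  | succ i =>
    by_contra! hc
    exact hν.zero (hν.gap i 0 hc.1 hc.2)

/-! ### The lists `P_n` -/

open Classical in
/-- The points inserted between `a` and `b`. -/
noncomputable def inserted (ν a b : StarSeq A) : List (StarSeq A) :=
  if diff a b = ⊤ then [] else [midpoint ν a b]

theorem refine_cons_cons (ν a b : StarSeq A) (l : List (StarSeq A)) :
    refine ν (a :: b :: l) = a :: (inserted ν a b ++ refine ν (b :: l)) := by
  simp only [refine, inserted]
  split_ifs <;> rfl

/-- Insertion only looks at adjacent entries, so a list may be cut at any entry and its two parts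
refined independently. -/
theorem refine_append (ν : StarSeq A) (l₁ : List (StarSeq A)) (b : StarSeq A)
    (l₂ : List (StarSeq A)) : ∃ r₁ r₂, refine ν (l₁ ++ [b]) = r₁ ++ [b] ∧
      refine ν (b :: l₂) = b :: r₂ ∧ refine ν (l₁ ++ b :: l₂) = r₁ ++ b :: r₂ := by
  induction l₁ with
  | nil =>
    cases l₂ with
    | nil => exact ⟨[], [], rfl, rfl, rfl⟩
    | cons c l₂ => exact ⟨[], _, rfl, refine_cons_cons _ _ _ _, refine_cons_cons _ _ _ _⟩
  | cons a l₁ ih =>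
    obtain ⟨r₁, r₂, h1, h2, h3⟩ := ih
    cases l₁ with
    | nil =>
      refine ⟨a :: inserted ν a b, r₂, ?_, h2, ?_⟩
      · simp [refine_cons_cons, refine]
      · simp [refine_cons_cons, h2]
    | cons a' l₁ =>
      refine ⟨a :: (inserted ν a a' ++ r₁), r₂, ?_, h2, ?_⟩
      · simp only [List.cons_append] at h1 ⊢
        rw [refine_cons_cons, h1]
        simp
      · simp only [List.cons_append] at h3 ⊢
        rw [refine_cons_cons, h3]
        simp

theorem refine_iterate_append (ν : StarSeq A) (n : ℕ) (l₁ : List (StarSeq A)) (b : StarSeq A)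
    (l₂ : List (StarSeq A)) : ∃ r₁ r₂, (refine ν)^[n] (l₁ ++ [b]) = r₁ ++ [b] ∧
      (refine ν)^[n] (b :: l₂) = b :: r₂ ∧ (refine ν)^[n] (l₁ ++ b :: l₂) = r₁ ++ b :: r₂ := by
  induction n with
  | zero => exact ⟨l₁, l₂, rfl, rfl, rfl⟩
  | succ n ih =>
    obtain ⟨r₁, r₂, h1, h2, h3⟩ := ih
    simp only [Function.iterate_succ_apply']
    rw [h1, h2, h3]
    exact refine_append ν r₁ b r₂

theorem P_eq_iterate (ν : StarSeq A) (n : ℕ) : P ν n = (refine ν)^[n] [critPt ν, ν] := by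
  induction n with
  | zero => rfl
  | succ n ih => rw [Function.iterate_succ_apply', ← ih]; rfl

theorem P_add (ν : StarSeq A) (n j : ℕ) : P ν (n + j) = (refine ν)^[j] (P ν n) := by
  rw [P_eq_iterate, P_eq_iterate, add_comm, Function.iterate_add_apply]

theorem sublist_refine (ν : StarSeq A) (l : List (StarSeq A)) : l.Sublist (refine ν l) := by
  match l with
  | [] => exact List.Sublist.refl _
  | [a] => exact List.Sublist.refl _
  | a :: b :: l =>
    rw [refine_cons_cons]
    exact ((sublist_refine ν (b :: l)).trans (List.sublist_append_right _ _)).cons_cons a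

theorem P_sublist {ν : StarSeq A} {n m : ℕ} (h : n ≤ m) : (P ν n).Sublist (P ν m) := by
  induction m, h using Nat.le_induction with
  | base => exact List.Sublist.refl _
  | succ m _ ih => exact ih.trans (sublist_refine ν _)

theorem mem_P_of_le {ν q : StarSeq A} {n m : ℕ} (h : n ≤ m) (hq : q ∈ P ν n) : q ∈ P ν m :=
  (P_sublist h).subset hq

theorem refine_pair_of_ne_top {ν e e' : StarSeq A} (h : diff e e' ≠ ⊤) :
    refine ν [e, e'] = [e, midpoint ν e e', e'] := by
  simp [refine, h]

theorem refine_pair_of_eq_top {ν e e' : StarSeq A} (h : diff e e' = ⊤) :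
    refine ν [e, e'] = [e, e'] := by
  simp [refine, h]

theorem refine_iterate_pair_succ {ν e e' : StarSeq A} (h : diff e e' ≠ ⊤) (n : ℕ) :
    ∃ r₁ r₂, (refine ν)^[n] [e, midpoint ν e e'] = r₁ ++ [midpoint ν e e'] ∧
      (refine ν)^[n] [midpoint ν e e', e'] = midpoint ν e e' :: r₂ ∧
      (refine ν)^[n + 1] [e, e'] = r₁ ++ midpoint ν e e' :: r₂ := by
  have := refine_iterate_append ν n [e] (midpoint ν e e') [e']
  rw [Function.iterate_succ_apply, refine_pair_of_ne_top h]
  exact this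

theorem refine_iterate_pair_of_eq_top {ν e e' : StarSeq A} (h : diff e e' = ⊤) (n : ℕ) :
    (refine ν)^[n] [e, e'] = [e, e'] := by
  induction n with
  | zero => rfl
  | succ n ih => rw [Function.iterate_succ_apply, refine_pair_of_eq_top h, ih]

/-- What can be said about a point that is inserted between the neighbours `e` and `e'`. -/
structure Inside (e e' q : StarSeq A) : Prop where
  ne : q ≠ e
  ne' : q ≠ e'
  apply_eq : ∀ i : ℕ, ((i + 1 : ℕ) : ℕ∞) < diff e e' → q i = (e i).or (e' i)

theorem inside_midpoint {ν e e' : StarSeq A} (h : diff e e' ≠ ⊤) :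
    Inside e e' (midpoint ν e e') := by
  obtain ⟨K, hK⟩ := exists_diff_eq_succ h
  have h1 := differ_iff.1 (diff_eq_succ_iff.1 hK).1
  refine ⟨fun he => ?_, fun he => ?_, fun i hi => ?_⟩
  · exact h1.1 (by rw [← he, midpoint_self hK])
  · exact h1.2.1 (by rw [← he, midpoint_self hK])
  · rw [hK] at hi
    exact midpoint_of_lt hK (by norm_cast at hi; omega)

theorem Inside.symm {e e' q : StarSeq A} (h : Inside e e' q) : Inside e' e q := by
  refine ⟨h.ne', h.ne, fun i hi => ?_⟩
  rw [diff_comm] at hi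
  rw [h.apply_eq i hi, or_comm_of_not_differ (le_diff_iff.1 hi i (by omega))]

/-- Points between `e` and the midpoint of `e` and `e'`. -/
theorem Inside.of_left {ν e e' q : StarSeq A} (h : diff e e' ≠ ⊤)
    (hq : Inside e (midpoint ν e e') q) : Inside e e' q ∧ ∀ K : ℕ, diff e e' = ((K + 1 : ℕ) : ℕ∞) →
      q K = e K := by
  obtain ⟨K, hK⟩ := exists_diff_eq_succ h
  have hd := lt_diff_midpoint (ν := ν) hK
  have h1 := differ_iff.1 (diff_eq_succ_iff.1 hK).1
  have hqK : q K = e K := by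
    rw [hq.apply_eq K hd, midpoint_self hK]; simp
  refine ⟨⟨hq.ne, fun he => ?_, fun i hi => ?_⟩, fun K' hK' => ?_⟩
  · exact h1.2.2 (by rw [← hqK, he])
  · rw [hK] at hi
    rw [hq.apply_eq i (hi.trans hd), midpoint_of_lt hK (by norm_cast at hi; omega)]
    cases e i <;> simp
  · have : K = K' := by rw [hK] at hK'; norm_cast at hK'; omega
    rwa [← this]

theorem Inside.of_right {ν e e' q : StarSeq A} (h : diff e e' ≠ ⊤)
    (hq : Inside (midpoint ν e e') e' q) : Inside e e' q ∧ ∀ K : ℕ, diff e e' = ((K + 1 : ℕ) : ℕ∞) →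
      q K = e' K := by
  rw [midpoint_comm ν h] at hq
  have h' : diff e' e ≠ ⊤ := by rwa [diff_comm]
  obtain ⟨h1, h2⟩ := hq.symm.of_left h'
  exact ⟨h1.symm, fun K hK => h2 K (by rwa [diff_comm])⟩

theorem mem_refine_iterate_pair {ν e e' q : StarSeq A} {n : ℕ}
    (hq : q ∈ (refine ν)^[n] [e, e']) : q = e ∨ q = e' ∨ Inside e e' q := by
  induction n generalizing e e' with
  | zero => simp at hq; tauto
  | succ n ih =>
    by_cases h : diff e e' = ⊤
    · rw [refine_iterate_pair_of_eq_top h] at hq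
      simp at hq; tauto
    · obtain ⟨r₁, r₂, h1, h2, h3⟩ := refine_iterate_pair_succ (ν := ν) h n
      rw [h3] at hq
      have : q ∈ r₁ ++ [midpoint ν e e'] ∨ q ∈ midpoint ν e e' :: r₂ := by
        simp only [List.mem_append, List.mem_cons] at hq ⊢
        tauto
      have hm := inside_midpoint (ν := ν) h
      rcases this with hq | hq
      · rw [← h1] at hq
        rcases ih hq with rfl | rfl | h4
        · exact Or.inl rfl
        · exact Or.inr (Or.inr hm)
        · exact Or.inr (Or.inr (h4.of_left h).1)
      · rw [← h2] at hq
        rcases ih hq with rfl | rfl | h4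
        · exact Or.inr (Or.inr hm)
        · exact Or.inr (Or.inl rfl)
        · exact Or.inr (Or.inr (h4.of_right h).1)

/-- At the first difference `K`, everything to the left of the midpoint carries the symbol of `e`,
while the midpoint and everything to its right do not. The two halves are therefore disjoint. -/
theorem nodup_refine_iterate_pair {ν e e' : StarSeq A} {n : ℕ} (hne : e ≠ e') :
    ((refine ν)^[n] [e, e']).Nodup := by
  induction n generalizing e e' with
  | zero => simpa using hne
  | succ n ih =>
    by_cases h : diff e e' = ⊤
    · rw [refine_iterate_pair_of_eq_top h]
      simpa using hne
    · obtain ⟨r₁, r₂, h1, h2, h3⟩ := refine_iterate_pair_succ (ν := ν) h n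
      obtain ⟨K, hK⟩ := exists_diff_eq_succ h
      have hd := differ_iff.1 (diff_eq_succ_iff.1 hK).1
      have hm := inside_midpoint (ν := ν) h
      have n1 := ih (e := e) (e' := midpoint ν e e') hm.ne.symm
      have n2 := ih (e := midpoint ν e e') (e' := e') hm.ne'
      have key1 : ∀ q ∈ r₁, q K = e K := by
        intro q hq
        have hqm : q ≠ midpoint ν e e' := by
          rintro rfl
          rw [h1, List.nodup_append] at n1
          exact n1.2.2 _ hq _ (by simp) rfl
        rcases mem_refine_iterate_pair (ν := ν) (n := n) (e := e) (e' := midpoint ν e e')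
          (q := q) (by rw [h1]; simp [hq]) with rfl | rfl | h4
        · rfl
        · exact absurd rfl hqm
        · exact (h4.of_left h).2 K hK
      have key2 : ∀ q ∈ midpoint ν e e' :: r₂, q K ≠ e K := by
        intro q hq
        rcases mem_refine_iterate_pair (ν := ν) (n := n) (e := midpoint ν e e') (e' := e')
          (q := q) (by rw [h2]; exact hq) with rfl | rfl | h4
        · rw [midpoint_self hK]; exact hd.1.symm
        · exact hd.2.2.symm
        · rw [(h4.of_right h).2 K hK]; exact hd.2.2.symm
      rw [h3, List.nodup_append]
      refine ⟨?_, h2 ▸ n2, ?_⟩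
      · rw [h1] at n1
        exact n1.of_append_left
      · rintro a ha b hb rfl
        exact key2 a hb (key1 a ha)

theorem critPt_ne {ν : StarSeq A} (hν : Knead ν) : critPt ν ≠ ν := fun h =>
  hν.zero (by rw [← h]; rfl)

theorem nodup_P {ν : StarSeq A} (hν : Knead ν) (n : ℕ) : (P ν n).Nodup := by
  rw [P_eq_iterate]
  exact nodup_refine_iterate_pair (critPt_ne hν)

/-! ### The order on `P_∞` -/

open Classical in
theorem pair_sublist_iff {α : Type*} {l : List α} (hl : l.Nodup) {a b : α} :
    [a, b].Sublist l ↔ a ∈ l ∧ b ∈ l ∧ l.idxOf a < l.idxOf b := by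
  constructor
  · intro h
    rw [List.cons_sublist_iff] at h
    obtain ⟨r₁, r₂, rfl, ha, hb⟩ := h
    rw [List.singleton_sublist] at hb
    have hb' : b ∉ r₁ := fun h => (List.nodup_append.1 hl).2.2 b h b hb rfl
    refine ⟨by simp [ha], by simp [hb], ?_⟩
    rw [List.idxOf_append_of_mem ha, List.idxOf_append_of_notMem hb']
    have := List.idxOf_lt_length_iff.2 ha
    omega
  · rintro ⟨ha, hb, h⟩
    rw [List.cons_sublist_iff]
    refine ⟨l.take (l.idxOf b), l.drop (l.idxOf b), (List.take_append_drop _ _).symm, ?_, ?_⟩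
    · rw [List.mem_take_iff_getElem]
      refine ⟨l.idxOf a, ?_, by simp⟩
      have := List.idxOf_lt_length_iff.2 ha
      omega
    · rw [List.singleton_sublist, List.mem_drop_iff_getElem]
      have := List.idxOf_lt_length_iff.2 hb
      exact ⟨0, by omega, by simp⟩

section order

variable {ν : StarSeq A}

theorem PLT.mem_left {a b : StarSeq A} (h : PLT ν a b) : a ∈ PInf ν :=
  let ⟨n, hn⟩ := h; ⟨n, hn.subset (by simp)⟩

theorem PLT.mem_right {a b : StarSeq A} (h : PLT ν a b) : b ∈ PInf ν :=
  let ⟨n, hn⟩ := h; ⟨n, hn.subset (by simp)⟩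

theorem exists_common_level {a b : StarSeq A} (ha : a ∈ PInf ν) (hb : b ∈ PInf ν) :
    ∃ n, a ∈ P ν n ∧ b ∈ P ν n := by
  obtain ⟨n, hn⟩ := ha
  obtain ⟨m, hm⟩ := hb
  exact ⟨max n m, mem_P_of_le (le_max_left _ _) hn, mem_P_of_le (le_max_right _ _) hm⟩

/-- Each list is a sublist of the later ones and none has repetitions, so the order of two points
does not depend on the list in which it is read. -/
theorem PLT.sublist_of_mem (hν : Knead ν) {a b : StarSeq A} (h : PLT ν a b) {n : ℕ}
    (ha : a ∈ P ν n) (hb : b ∈ P ν n) : [a, b].Sublist (P ν n) := by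
  classical
  obtain ⟨m, hm⟩ := h
  rcases le_total m n with hmn | hmn
  · exact hm.trans (P_sublist hmn)
  · rw [pair_sublist_iff (nodup_P hν n)]
    refine ⟨ha, hb, ?_⟩
    by_contra! hc
    rcases hc.lt_or_eq with hc | hc
    · have h1 : [b, a].Sublist (P ν m) :=
        ((pair_sublist_iff (nodup_P hν n)).2 ⟨hb, ha, hc⟩).trans (P_sublist hmn)
      rw [pair_sublist_iff (nodup_P hν m)] at h1 hm
      omega
    · have : a = b := (List.idxOf_inj ha).1 hc.symm
      subst this
      rw [pair_sublist_iff (nodup_P hν m)] at hm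
      omega

theorem PLT.trans (hν : Knead ν) {a b c : StarSeq A} (h : PLT ν a b) (h' : PLT ν b c) :
    PLT ν a c := by
  obtain ⟨n, ha, hb⟩ := exists_common_level h.mem_left h.mem_right
  obtain ⟨m, hc⟩ := h'.mem_right
  have ha := mem_P_of_le (le_max_left n m) ha
  have hb := mem_P_of_le (le_max_left n m) hb
  have hc := mem_P_of_le (le_max_right n m) hc
  have h1 := h.sublist_of_mem hν ha hb
  have h2 := h'.sublist_of_mem hν hb hc
  refine ⟨max n m, ?_⟩
  rw [pair_sublist_iff (nodup_P hν _)] at *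
  exact ⟨ha, hc, h1.2.2.trans h2.2.2⟩

theorem PLT.irrefl (hν : Knead ν) (a : StarSeq A) : ¬ PLT ν a a := by
  rintro ⟨n, hn⟩
  rw [pair_sublist_iff (nodup_P hν n)] at hn
  omega

theorem PLT.asymm (hν : Knead ν) {a b : StarSeq A} (h : PLT ν a b) : ¬ PLT ν b a := fun h' =>
  PLT.irrefl hν a (h.trans hν h')

theorem PLT.trichotomy (hν : Knead ν) {a b : StarSeq A} (ha : a ∈ PInf ν) (hb : b ∈ PInf ν) :
    PLT ν a b ∨ a = b ∨ PLT ν b a := by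
  classical
  obtain ⟨n, ha, hb⟩ := exists_common_level ha hb
  rcases lt_trichotomy ((P ν n).idxOf a) ((P ν n).idxOf b) with h | h | h
  · exact Or.inl ⟨n, (pair_sublist_iff (nodup_P hν n)).2 ⟨ha, hb, h⟩⟩
  · exact Or.inr (Or.inl ((List.idxOf_inj ha).1 h))
  · exact Or.inr (Or.inr ⟨n, (pair_sublist_iff (nodup_P hν n)).2 ⟨hb, ha, h⟩⟩)

/-- `e` and `e'` are neighbours in the `n`-th list. -/
def Node (ν : StarSeq A) (n : ℕ) (e e' : StarSeq A) : Prop := [e, e'] <:+: P ν n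

variable {n : ℕ} {e e' : StarSeq A}

theorem Node.mem_left (h : Node ν n e e') : e ∈ P ν n := h.subset (by simp)

theorem Node.mem_right (h : Node ν n e e') : e' ∈ P ν n := h.subset (by simp)

theorem Node.plt (h : Node ν n e e') : PLT ν e e' := ⟨n, h.sublist⟩

theorem Node.cases (hν : Knead ν) (h : Node ν n e e') {q : StarSeq A} (hq : q ∈ P ν n) :
    (q = e ∨ PLT ν q e) ∨ (q = e' ∨ PLT ν e' q) := by
  classical
  have hnd := nodup_P hν n
  have h1 : (P ν n).idxOf e' = (P ν n).idxOf e + 1 := by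
    obtain ⟨s, t, hst⟩ := h
    rw [← hst] at hnd ⊢
    have he : e ∉ s := fun hs => by
      rw [List.append_assoc, List.nodup_append] at hnd
      exact hnd.2.2 e hs e (by simp) rfl
    have he' : e' ∉ s := fun hs => by
      rw [List.append_assoc, List.nodup_append] at hnd
      exact hnd.2.2 e' hs e' (by simp) rfl
    have hee : e ≠ e' := by
      rintro rfl
      rw [List.append_assoc, List.nodup_append] at hnd
      simp at hnd
    rw [List.append_assoc, List.idxOf_append_of_notMem he, List.idxOf_append_of_notMem he']
    simp [hee]
  rcases PLT.trichotomy hν ⟨n, hq⟩ ⟨n, h.mem_left⟩ with h2 | h2 | h2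
  · exact Or.inl (Or.inr h2)
  · exact Or.inl (Or.inl h2)
  · rcases PLT.trichotomy hν ⟨n, hq⟩ ⟨n, h.mem_right⟩ with h3 | h3 | h3
    · have h4 := ((pair_sublist_iff hnd).1 (h2.sublist_of_mem hν h.mem_left hq)).2.2
      have h5 := ((pair_sublist_iff hnd).1 (h3.sublist_of_mem hν hq h.mem_right)).2.2
      omega
    · exact Or.inr (Or.inl h3)
    · exact Or.inr (Or.inr h3)

theorem P_add_of_node (h : Node ν n e e') (j : ℕ) :
    ∃ r₁ r₂, P ν (n + j) = r₁ ++ (refine ν)^[j] [e, e'] ++ r₂ := by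
  obtain ⟨s, t, hst⟩ := h
  rw [P_add, ← hst]
  obtain ⟨r₁, r₂, h1, h2, h3⟩ := refine_iterate_append ν j s e (e' :: t)
  obtain ⟨u₁, u₂, k1, k2, k3⟩ := refine_iterate_append ν j [e] e' t
  simp only [List.singleton_append] at k1 k3
  rw [k3] at h2
  refine ⟨r₁, u₂, ?_⟩
  simp only [List.append_assoc, List.cons_append, List.nil_append]
  rw [h3, k1, ← h2]
  simp

theorem Node.left (h : Node ν n e e') (hd : diff e e' ≠ ⊤) :
    Node ν (n + 1) e (midpoint ν e e') := by
  obtain ⟨r₁, r₂, h1⟩ := P_add_of_node h 1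
  rw [Function.iterate_one, refine_pair_of_ne_top hd] at h1
  exact ⟨r₁, e' :: r₂, by rw [h1]; simp⟩

theorem Node.right (h : Node ν n e e') (hd : diff e e' ≠ ⊤) :
    Node ν (n + 1) (midpoint ν e e') e' := by
  obtain ⟨r₁, r₂, h1⟩ := P_add_of_node h 1
  rw [Function.iterate_one, refine_pair_of_ne_top hd] at h1
  exact ⟨r₁ ++ [e], r₂, by rw [h1]; simp⟩

theorem Node.same (h : Node ν n e e') (hd : diff e e' = ⊤) : Node ν (n + 1) e e' := by
  obtain ⟨r₁, r₂, h1⟩ := P_add_of_node h 1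
  rw [Function.iterate_one, refine_pair_of_eq_top hd] at h1
  exact ⟨r₁, r₂, by rw [h1]⟩

theorem pair_infix_refine {x y : StarSeq A} {l : List (StarSeq A)} (h : [x, y] <:+: refine ν l) :
    ∃ a b, [a, b] <:+: l ∧ ((diff a b = ⊤ ∧ x = a ∧ y = b) ∨
      (diff a b ≠ ⊤ ∧ ((x = a ∧ y = midpoint ν a b) ∨ (x = midpoint ν a b ∧ y = b)))) := by
  match l with
  | [] => simp [refine] at h
  | [a] =>
    have := h.length_le
    simp [refine] at this
  | a :: b :: l =>
    obtain ⟨r₁, r₂, -, h2, -⟩ := refine_append ν [] b l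
    have ih : [x, y] <:+: refine ν (b :: l) → _ := pair_infix_refine (l := b :: l)
    rw [refine_cons_cons] at h
    have done : [x, y] <:+: refine ν (b :: l) → ∃ a' b', [a', b'] <:+: a :: b :: l ∧
        ((diff a' b' = ⊤ ∧ x = a' ∧ y = b') ∨
      (diff a' b' ≠ ⊤ ∧ ((x = a' ∧ y = midpoint ν a' b') ∨ (x = midpoint ν a' b' ∧ y = b')))) := by
      intro h'
      obtain ⟨a', b', h3, h4⟩ := ih h'
      exact ⟨a', b', h3.trans (List.suffix_cons _ _).isInfix, h4⟩
    have hab : [a, b] <:+: a :: b :: l := ⟨[], l, rfl⟩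
    unfold inserted at h
    split_ifs at h with hd
    · rw [List.nil_append, List.infix_cons_iff] at h
      rcases h with h | h
      · rw [h2, List.cons_prefix_cons] at h
        obtain ⟨rfl, h⟩ := h
        rw [List.cons_prefix_cons] at h
        exact ⟨x, b, hab, Or.inl ⟨hd, rfl, h.1⟩⟩
      · exact done h
    · rw [List.singleton_append, List.infix_cons_iff] at h
      rcases h with h | h
      · rw [List.cons_prefix_cons] at h
        obtain ⟨rfl, h⟩ := h
        rw [List.cons_prefix_cons] at h
        exact ⟨x, b, hab, Or.inr ⟨hd, Or.inl ⟨rfl, h.1⟩⟩⟩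
      · rw [List.infix_cons_iff] at h
        rcases h with h | h
        · rw [h2, List.cons_prefix_cons] at h
          obtain ⟨rfl, h⟩ := h
          rw [List.cons_prefix_cons] at h
          exact ⟨a, b, hab, Or.inr ⟨hd, Or.inr ⟨rfl, h.1⟩⟩⟩
        · exact done h

theorem Node.exists_parent {x y : StarSeq A} (h : Node ν (n + 1) x y) :
    ∃ a b, Node ν n a b ∧ ((diff a b = ⊤ ∧ x = a ∧ y = b) ∨
      (diff a b ≠ ⊤ ∧ ((x = a ∧ y = midpoint ν a b) ∨ (x = midpoint ν a b ∧ y = b)))) :=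
  pair_infix_refine h

theorem node_root (ν : StarSeq A) : Node ν 0 (critPt ν) ν := List.infix_refl _

theorem node_zero {x y : StarSeq A} (h : Node ν 0 x y) : x = critPt ν ∧ y = ν := by
  have : [x, y] = [critPt ν, ν] := List.IsInfix.eq_of_length h rfl
  simpa using this

theorem Node.good (hν : Knead ν) (h : Node ν n e e') : ∃ l l', Good ν l l' e e' := by
  induction n generalizing e e' with
  | zero =>
    obtain ⟨rfl, rfl⟩ := node_zero h
    exact ⟨1, 0, good_root hν⟩
  | succ n ih =>
    obtain ⟨a, b, hab, h1⟩ := h.exists_parent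
    obtain ⟨l, l', hg⟩ := ih hab
    rcases h1 with ⟨_, rfl, rfl⟩ | ⟨hd, ⟨rfl, rfl⟩ | ⟨rfl, rfl⟩⟩
    · exact ⟨l, l', hg⟩
    · obtain ⟨K, hK⟩ := exists_diff_eq_succ hd
      exact ⟨_, _, hg.left hν hK⟩
    · obtain ⟨K, hK⟩ := exists_diff_eq_succ hd
      exact ⟨_, _, hg.right hν hK⟩

theorem lt_diff_midpoint_right {ν e e' : StarSeq A} {K : ℕ}
    (hK : diff e e' = ((K + 1 : ℕ) : ℕ∞)) :
    ((K + 1 : ℕ) : ℕ∞) < diff (midpoint ν e e') e' := by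
  have hK' := hK
  rw [diff_comm] at hK'
  rw [midpoint_comm ν (by rw [hK]; exact ENat.natCast_ne_top _), diff_comm]
  exact lt_diff_midpoint hK'

/-- The `⋆` of an inserted point sits where its parents first differ, so it is compatible with each
parent through that position. Compatibility of neighbours grows with the level, and this controls
all the limits. -/
theorem Node.lt_diff (hν : Knead ν) (h : Node ν n e e') : (n : ℕ∞) < diff e e' := by
  induction n generalizing e e' with
  | zero =>
    obtain ⟨rfl, rfl⟩ := node_zero h
    exact lt_trans (by norm_num) (good_root hν).lt
  | succ n ih =>
    obtain ⟨a, b, hab, h1⟩ := h.exists_parent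
    have h2 := ih hab
    rcases h1 with ⟨h3, rfl, rfl⟩ | ⟨hd, h1⟩
    · rw [h3]; exact ENat.natCast_lt_top _
    · obtain ⟨K, hK⟩ := exists_diff_eq_succ hd
      have h4 : ((n + 1 : ℕ) : ℕ∞) ≤ ((K + 1 : ℕ) : ℕ∞) := by
        rw [hK] at h2
        norm_cast at h2 ⊢
      rcases h1 with ⟨rfl, rfl⟩ | ⟨rfl, rfl⟩
      · exact h4.trans_lt (lt_diff_midpoint hK)
      · exact h4.trans_lt (lt_diff_midpoint_right hK)

/-- Refinement is local, so a point between two neighbours in the order must have been inserted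
between them later. -/
theorem Node.inside (hν : Knead ν) (h : Node ν n e e') {q : StarSeq A} (h1 : PLT ν e q)
    (h2 : PLT ν q e') : Inside e e' q := by
  obtain ⟨m, hm⟩ := h1.mem_right
  obtain ⟨j, hj⟩ := Nat.exists_eq_add_of_le (le_max_left n m)
  have hq : q ∈ P ν (n + j) := hj ▸ mem_P_of_le (le_max_right n m) hm
  have he := mem_P_of_le (Nat.le_add_right n j) h.mem_left
  have he' := mem_P_of_le (Nat.le_add_right n j) h.mem_right
  obtain ⟨r₁, r₂, h3⟩ := P_add_of_node h j
  have hnd := nodup_P hν (n + j)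
  have hnr : ∀ c, ¬ PLT ν c c := PLT.irrefl hν
  have hsub := sublist_refine ν
  have hep : [e, e'].Sublist ((refine ν)^[j] [e, e']) := by
    clear * - hsub
    induction j with
    | zero => exact List.Sublist.refl _
    | succ j ih => rw [Function.iterate_succ_apply']; exact ih.trans (hsub _)
  have hmem : q ∈ (refine ν)^[j] [e, e'] := by
    rw [h3] at hq
    simp only [List.mem_append] at hq
    rcases hq with (hq | hq) | hq
    · exfalso
      refine (h1.asymm hν) ⟨n + j, ?_⟩
      rw [h3, List.append_assoc, List.cons_sublist_iff]
      refine ⟨_, _, rfl, hq, ?_⟩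
      rw [List.singleton_sublist]
      exact List.mem_append_left _ (hep.subset (by simp))
    · exact hq
    · exfalso
      refine (h2.asymm hν) ⟨n + j, ?_⟩
      rw [h3, List.cons_sublist_iff]
      refine ⟨_, _, rfl, List.mem_append_right _ (hep.subset (by simp)), ?_⟩
      rwa [List.singleton_sublist]
  rcases mem_refine_iterate_pair hmem with rfl | rfl | h4
  · exact (hnr _ h1).elim
  · exact (hnr _ h2).elim
  · exact h4

theorem exists_adjacent_of_head {α : Type*} {Q : α → Prop} {a : α} {l : List α} (ha : Q a)
    (h : ∃ y ∈ a :: l, ¬ Q y) : ∃ x y, [x, y] <:+: a :: l ∧ Q x ∧ ¬ Q y := by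
  induction l generalizing a with
  | nil =>
    obtain ⟨y, hy, hq⟩ := h
    simp at hy
    exact absurd (hy ▸ ha) hq
  | cons b l ih =>
    by_cases hb : Q b
    · obtain ⟨y, hy, hq⟩ := h
      have hy' : y ∈ b :: l := by
        rcases List.mem_cons.1 hy with rfl | hy
        · exact absurd ha hq
        · exact hy
      obtain ⟨x, y, h1, h2⟩ := ih hb ⟨y, hy', hq⟩
      exact ⟨x, y, h1.trans (List.suffix_cons _ _).isInfix, h2⟩
    · exact ⟨a, b, ⟨[], l, rfl⟩, ha, hb⟩

theorem P_eq_cons (ν : StarSeq A) (n : ℕ) : ∃ l, P ν n = critPt ν :: l := by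
  obtain ⟨r₁, r₂, -, h2, -⟩ := refine_iterate_append ν n [] (critPt ν) [ν]
  exact ⟨r₂, by rw [P_eq_iterate, h2]⟩

/-- Walk along `P_n` from the left end. -/
theorem exists_node_of_critPt {Q : StarSeq A → Prop} (n : ℕ) (h0 : Q (critPt ν))
    (h : ∃ y ∈ P ν n, ¬ Q y) : ∃ x y, Node ν n x y ∧ Q x ∧ ¬ Q y := by
  obtain ⟨l, hl⟩ := P_eq_cons ν n
  unfold Node
  rw [hl] at h ⊢
  exact exists_adjacent_of_head h0 h

theorem critPt_mem_P (ν : StarSeq A) (n : ℕ) : critPt ν ∈ P ν n :=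
  mem_P_of_le (Nat.zero_le n) (by simp [P])

theorem self_mem_P (ν : StarSeq A) (n : ℕ) : ν ∈ P ν n :=
  mem_P_of_le (Nat.zero_le n) (by simp [P])

theorem plt_ends {q : StarSeq A} (hq : q ∈ PInf ν) :
    (q = critPt ν ∨ PLT ν (critPt ν) q) ∧ (q = ν ∨ PLT ν q ν) := by
  obtain ⟨n, hn⟩ := hq
  have h0 : P ν (0 + n) = (refine ν)^[n] [critPt ν, ν] := by rw [zero_add, P_eq_iterate]
  constructor
  · by_contra! hc
    obtain ⟨l, hl⟩ := P_eq_cons ν n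
    apply hc.2
    refine ⟨n, ?_⟩
    rw [hl] at hn ⊢
    exact (List.singleton_sublist.2 ((List.mem_cons.1 hn).resolve_left hc.1)).cons_cons _
  · by_contra! hc
    obtain ⟨r₁, r₂, h1, -, -⟩ := refine_iterate_append ν n [critPt ν] ν []
    have hl : P ν n = r₁ ++ [ν] := by rw [P_eq_iterate]; exact h1
    apply hc.2
    refine ⟨n, ?_⟩
    rw [hl] at hn ⊢
    have : q ∈ r₁ := by simpa [hc.1] using hn
    exact (List.singleton_sublist.2 this).append (List.Sublist.refl _)

theorem exists_node_of_notMem (hν : Knead ν) {q : StarSeq A} (hq : q ∈ PInf ν) {n : ℕ}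
    (hn : q ∉ P ν n) : ∃ e e', Node ν n e e' ∧ PLT ν e q ∧ PLT ν q e' := by
  have h := plt_ends hq
  have h1 : PLT ν (critPt ν) q := h.1.resolve_left fun h => hn (h ▸ critPt_mem_P ν n)
  have h2 : PLT ν q ν := h.2.resolve_left fun h => hn (h ▸ self_mem_P ν n)
  obtain ⟨x, y, hxy, hx, hy⟩ := exists_node_of_critPt (Q := fun x => PLT ν x q) n h1
    ⟨ν, self_mem_P ν n, h2.asymm hν⟩
  refine ⟨x, y, hxy, hx, ?_⟩
  rcases PLT.trichotomy hν ⟨n, hxy.mem_right⟩ hq with h3 | h3 | h3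
  · exact absurd h3 hy
  · exact absurd (h3 ▸ hxy.mem_right) hn
  · exact h3

theorem exists_hasDepth (hν : Knead ν) {q : StarSeq A} {n : ℕ} (hq : q ∈ P ν n) :
    ∃ l, HasDepth ν l q := by
  by_cases h : q = critPt ν
  · exact ⟨1, h ▸ (good_root hν).depth⟩
  · obtain ⟨x, y, hxy, h1, h2⟩ := exists_node_of_critPt (ν := ν)
      (Q := fun x => x ≠ q) n (fun h' => h h'.symm) ⟨q, hq, by simp⟩
    obtain ⟨l, l', hg⟩ := hxy.good hν
    rw [not_not] at h2
    exact ⟨l', h2 ▸ hg.depth'⟩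

end order


/-! ### Neighbours with their depths -/

/-- `e` and `e'` are neighbours in `P_{n+1}`, and they have depths `l` and `l'`. -/
inductive DNode (ν : StarSeq A) : ℕ → ℕ → ℕ → StarSeq A → StarSeq A → Prop
  | root : DNode ν 0 1 0 (critPt ν) ν
  | same {n l l' e e'} (h : DNode ν n l l' e e') (hd : diff e e' = ⊤) : DNode ν (n + 1) l l' e e'
  | left {n l l' e e'} {K : ℕ} (h : DNode ν n l l' e e') (hK : diff e e' = ((K + 1 : ℕ) : ℕ∞)) :
      DNode ν (n + 1) l (K + 1) e (midpoint ν e e')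
  | right {n l l' e e'} {K : ℕ} (h : DNode ν n l l' e e') (hK : diff e e' = ((K + 1 : ℕ) : ℕ∞)) :
      DNode ν (n + 1) (K + 1) l' (midpoint ν e e') e'

theorem ne_top_of_eq_succ {e e' : StarSeq A} {K : ℕ} (h : diff e e' = ((K + 1 : ℕ) : ℕ∞)) :
    diff e e' ≠ ⊤ := by
  rw [h]; exact ENat.natCast_ne_top _

section

variable {ν : StarSeq A} {n l l' : ℕ} {e e' : StarSeq A}

theorem DNode.node (h : DNode ν n l l' e e') : Node ν n e e' := by
  induction h with
  | root => exact node_root ν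
  | same _ hd ih => exact ih.same hd
  | left _ hK ih => exact ih.left (ne_top_of_eq_succ hK)
  | right _ hK ih => exact ih.right (ne_top_of_eq_succ hK)

theorem DNode.good (hν : Knead ν) (h : DNode ν n l l' e e') : Good ν l l' e e' := by
  induction h with
  | root => exact good_root hν
  | same _ hd ih => exact ih
  | left _ hK ih => exact ih.left hν hK
  | right _ hK ih => exact ih.right hν hK

theorem DNode.one_le (h : DNode ν n l l' e e') : 1 ≤ l := by
  induction h with
  | root => exact le_rfl
  | same _ hd ih => exact ih
  | left _ hK ih => exact ih
  | right _ hK ih => omega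

theorem Node.exists_dnode (h : Node ν n e e') : ∃ l l', DNode ν n l l' e e' := by
  induction n generalizing e e' with
  | zero =>
    obtain ⟨rfl, rfl⟩ := node_zero h
    exact ⟨1, 0, .root⟩
  | succ n ih =>
    obtain ⟨a, b, hab, h1⟩ := h.exists_parent
    obtain ⟨l, l', hg⟩ := ih hab
    rcases h1 with ⟨hd, rfl, rfl⟩ | ⟨hd, ⟨rfl, rfl⟩ | ⟨rfl, rfl⟩⟩
    · exact ⟨l, l', hg.same hd⟩
    · obtain ⟨K, hK⟩ := exists_diff_eq_succ hd
      exact ⟨_, _, hg.left hK⟩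
    · obtain ⟨K, hK⟩ := exists_diff_eq_succ hd
      exact ⟨_, _, hg.right hK⟩

/-! ### Chopping as refinement of the critical path -/

/-- Following `y`, the end points `⋆ν` and `ν` of the critical path have been replaced by the
neighbours `e` and `e'` at time `t`. -/
structure Resid (ν y : StarSeq A) (n l l' : ℕ) (e e' : StarSeq A) (t : ℕ) : Prop where
  node : DNode ν n l l' e e'
  le : l ≤ t
  le' : l' ≤ t
  lt : (t : ℕ∞) < diff e e'
  eq : chop ν (critPt ν) y t = shift^[t] e
  eq' : chop ν ν y t = shift^[t] e'
  fits : ∀ i < t, y i = (e i).or (e' i)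

/-- Not both end points of the critical path are chopped off at time `t`. -/
def NotBoth (ν y : StarSeq A) (t : ℕ) : Prop :=
  chop ν (critPt ν) y t 0 = y t ∨ chop ν ν y t 0 = y t

theorem resid_root {y : StarSeq A} (hν : Knead ν) (h : ν 0 = y 0) :
    Resid ν y 0 1 0 (critPt ν) ν 1 where
  node := .root
  le := le_rfl
  le' := Nat.zero_le _
  lt := (good_root hν).lt
  eq := by
    rw [chop_succ_of_ne, Function.iterate_one, shift_critPt]
    rw [← h]
    exact fun h' => hν.zero h'.symm
  eq' := by
    rw [chop_succ_of_eq (by exact h)]; rfl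
  fits i hi := by
    rw [show i = 0 by omega, ← h]; rfl

/-- A `⋆` of `e` against a symbol of `y` counts as a cut, but the restart is harmless: what follows
a `⋆` in `e` is `ν` anyway. -/
theorem chop_succ_of_not_differ {x y : StarSeq A} {t : ℕ} (hν : Knead ν)
    (hd : HasDepth ν l e) (hl : l ≤ t) (h : chop ν x y t = shift^[t] e) (hy : y t ≠ none)
    (hc : ¬ Differ (y t) (e t)) : chop ν x y (t + 1) = shift^[t + 1] e := by
  rw [not_differ_iff] at hc
  have h0 : chop ν x y t 0 = e t := by rw [h, shift_iterate, zero_add]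
  rcases hc with hc | hc | hc
  · exact (hy hc).elim
  · rw [chop_succ_of_ne (by rw [h0, hc]; exact hy.symm)]
    have h1 : ν (t - l) = none := by
      rw [← hd.apply_add, Nat.sub_add_cancel hl, hc]
    rw [show t + 1 = (t - l + 1) + l by omega, ← shift_iterate_add, hd.shift_eq, hν.restart _ h1]
  · rw [chop_succ_of_eq (by rw [h0, hc]), h, Function.iterate_succ_apply']

theorem Resid.step_same {y : StarSeq A} {t : ℕ} (hν : Knead ν) (h : Resid ν y n l l' e e' t)
    (ht : ((t + 1 : ℕ) : ℕ∞) < diff e e') (hy : y t = (e t).or (e' t)) :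
    Resid ν y n l l' e e' (t + 1) ∧ NotBoth ν y t := by
  have hg := h.node.good hν
  have hd : ¬ Differ (e t) (e' t) := le_diff_iff.1 ht t (by omega)
  have hs := hg.star t
  have hyt : y t ≠ none := by rw [hy, Ne, Option.or_eq_none_iff]; tauto
  have hor : (e t = none ∧ e' t = y t) ∨ (e t = y t ∧ (e' t = none ∨ e' t = y t)) := by
    rw [not_differ_iff] at hd
    cases h1 : e t
    · left
      rw [h1] at hy
      exact ⟨rfl, by simpa using hy.symm⟩
    · right
      rw [h1] at hy hd
      refine ⟨by simpa using hy.symm, ?_⟩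
      rw [hy]
      rcases hd with hd | hd | hd
      · simp at hd
      · exact Or.inl hd
      · right; rw [← hd]; simp
  refine ⟨⟨h.node, h.le.trans (Nat.le_succ t), h.le'.trans (Nat.le_succ t), ht, ?_, ?_, ?_⟩, ?_⟩
  · refine chop_succ_of_not_differ hν hg.depth h.le h.eq hyt ?_
    rw [not_differ_iff]
    rcases hor with ⟨h1, h2⟩ | ⟨h1, h2⟩
    · exact Or.inr (Or.inl h1)
    · exact Or.inr (Or.inr h1.symm)
  · refine chop_succ_of_not_differ hν hg.depth' h.le' h.eq' hyt ?_
    rw [not_differ_iff]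
    rcases hor with ⟨h1, h2⟩ | ⟨h1, h2 | h2⟩
    · exact Or.inr (Or.inr h2.symm)
    · exact Or.inr (Or.inl h2)
    · exact Or.inr (Or.inr h2.symm)
  · intro i hi
    rcases Nat.lt_succ_iff_lt_or_eq.1 hi with hi | rfl
    exacts [h.fits i hi, hy]
  · unfold NotBoth
    rw [h.eq, h.eq', shift_iterate, shift_iterate, zero_add]
    tauto

/-- When `y` sides with `e` at the first difference, the right end is cut and restarts at `ν`, which
is `σ^(t+1)` of the midpoint. So the cut has the effect of replacing `e'` by the midpoint. -/
theorem Resid.step_left {y : StarSeq A} {t : ℕ} (h : Resid ν y n l l' e e' t)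
    (ht : diff e e' = ((t + 1 : ℕ) : ℕ∞)) (hy : y t = e t) :
    Resid ν y (n + 1) l (t + 1) e (midpoint ν e e') (t + 1) ∧ NotBoth ν y t := by
  have hd := differ_iff.1 (diff_eq_succ_iff.1 ht).1
  have h0 : chop ν (critPt ν) y t 0 = y t := by rw [h.eq, shift_iterate, zero_add, hy]
  refine ⟨⟨h.node.left ht, h.le.trans (Nat.le_succ t), le_rfl, lt_diff_midpoint ht, ?_, ?_, ?_⟩,
    Or.inl h0⟩
  · rw [chop_succ_of_eq h0, h.eq, Function.iterate_succ_apply']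
  · rw [shift_midpoint ht, chop_succ_of_ne]
    rw [h.eq', shift_iterate, zero_add, hy]
    exact hd.2.2.symm
  · intro i hi
    rcases Nat.lt_succ_iff_lt_or_eq.1 hi with hi | rfl
    · rw [h.fits i hi, midpoint_of_lt ht hi]
      cases e i <;> simp
    · rw [midpoint_self ht, hy]
      simp

theorem Resid.step_right {y : StarSeq A} {t : ℕ} (h : Resid ν y n l l' e e' t)
    (ht : diff e e' = ((t + 1 : ℕ) : ℕ∞)) (hy : y t = e' t) :
    Resid ν y (n + 1) (t + 1) l' (midpoint ν e e') e' (t + 1) ∧ NotBoth ν y t := by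
  have hd := differ_iff.1 (diff_eq_succ_iff.1 ht).1
  have h0 : chop ν ν y t 0 = y t := by rw [h.eq', shift_iterate, zero_add, hy]
  refine ⟨⟨h.node.right ht, le_rfl, h.le'.trans (Nat.le_succ t), lt_diff_midpoint_right ht,
    ?_, ?_, ?_⟩, Or.inr h0⟩
  · rw [shift_midpoint ht, chop_succ_of_ne]
    rw [h.eq, shift_iterate, zero_add, hy]
    exact hd.2.2
  · rw [chop_succ_of_eq h0, h.eq', Function.iterate_succ_apply']
  · intro i hi
    rcases Nat.lt_succ_iff_lt_or_eq.1 hi with hi | rfl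
    · rw [h.fits i hi, midpoint_of_lt ht hi]
      have := (diff_eq_succ_iff.1 ht).2 i hi
      rw [not_differ_iff] at this
      rcases this with h1 | h1 | h1
      · rw [h1]; simp
      · rw [h1]; cases e i <;> simp
      · rw [h1]; cases e' i <;> simp
    · rw [midpoint_self ht, hy]
      simp

/-- A sequence that agrees with the common symbols of neighbours `e`, `e'` follows them. -/
theorem DNode.resid {y : StarSeq A} (hν : Knead ν) (h : DNode ν n l l' e e') {T : ℕ}
    (hT : (T : ℕ∞) < diff e e') (hy : ∀ i < T, y i = (e i).or (e' i)) :
    (∀ t, 1 ≤ t → l ≤ t → l' ≤ t → t ≤ T → Resid ν y n l l' e e' t) ∧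
      ∀ t < T, NotBoth ν y t := by
  have propagate : ∀ {n l l' e e'} {s T : ℕ}, (T : ℕ∞) < diff e e' →
      (∀ i < T, y i = (e i).or (e' i)) → Resid ν y n l l' e e' s →
      ∀ t, s ≤ t → t ≤ T → Resid ν y n l l' e e' t ∧ ∀ i, s ≤ i → i < t → NotBoth ν y i := by
    intro n l l' e e' s T hT hy h t hst htT
    induction t, hst using Nat.le_induction with
    | base => exact ⟨h, fun i hi hi' => by omega⟩
    | succ t hst ih =>
      obtain ⟨h1, h2⟩ := ih (by omega)
      have hlt : ((t + 1 : ℕ) : ℕ∞) < diff e e' := lt_of_le_of_lt (by exact_mod_cast htT) hT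
      obtain ⟨h3, h4⟩ := h1.step_same hν hlt (hy t (by omega))
      refine ⟨h3, fun i hi hi' => ?_⟩
      rcases Nat.lt_succ_iff_lt_or_eq.1 hi' with hi' | rfl
      exacts [h2 i hi hi', h4]
  induction h generalizing T with
  | root =>
    rcases Nat.eq_zero_or_pos T with rfl | hpos
    · exact ⟨fun t _ _ _ _ => by omega, fun t ht => by omega⟩
    · have hy0 : ν 0 = y 0 := by rw [hy 0 hpos]; rfl
      have h1 := resid_root hν hy0
      refine ⟨fun t ht _ _ htT => (propagate hT hy h1 t ht htT).1, fun t ht => ?_⟩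
      rcases Nat.eq_zero_or_pos t with rfl | htpos
      · exact Or.inr hy0
      · exact (propagate hT hy h1 T hpos le_rfl).2 t htpos ht
  | same _ hd ih =>
    obtain ⟨h1, h2⟩ := ih hT hy
    refine ⟨fun t ht hl hl' htT => ?_, h2⟩
    have := h1 t ht hl hl' htT
    exact ⟨this.node.same hd, this.le, this.le', this.lt, this.eq, this.eq', this.fits⟩
  | @left n l l' e e' K h hK ih =>
    have hg := h.good hν
    have hlK : l ≤ K := by have := hg.lt; rw [hK] at this; norm_cast at this; omega
    have hlK' : l' ≤ K := by have := hg.lt'; rw [hK] at this; norm_cast at this; omega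
    have hone := h.one_le
    have hKd : (K : ℕ∞) < diff e e' := by rw [hK]; exact_mod_cast Nat.lt_succ_self K
    have hyK : ∀ i < T, i < K → y i = (e i).or (e' i) := by
      intro i hi hiK
      rw [hy i hi, midpoint_of_lt hK hiK]
      cases e i <;> simp
    -- Before time `K` the parents describe the chopping; from `K + 1` on the midpoint has taken the
    -- place of `e'`.
    rcases Nat.lt_or_ge K T with hKT | hKT
    · obtain ⟨h1, h2⟩ := ih hKd fun i hi => hyK i (by omega) hi
      have hyK' : y K = e K := by rw [hy K hKT, midpoint_self hK]; simp
      obtain ⟨h3, h4⟩ := (h1 K (by omega) hlK hlK' le_rfl).step_left hK hyK'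
      refine ⟨fun t _ _ ht htT => (propagate hT hy h3 t ht htT).1, fun t ht => ?_⟩
      rcases lt_trichotomy t K with htK | rfl | htK
      · exact h2 t htK
      · exact h4
      · exact (propagate hT hy h3 T hKT le_rfl).2 t htK ht
    · obtain ⟨h1, h2⟩ := ih (T := T) (lt_of_le_of_lt (by exact_mod_cast hKT) hKd)
        fun i hi => hyK i hi (by omega)
      exact ⟨fun t _ _ ht htT => by omega, h2⟩
  | @right n l l' e e' K h hK ih =>
    have hg := h.good hν
    have hlK : l ≤ K := by have := hg.lt; rw [hK] at this; norm_cast at this; omega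
    have hlK' : l' ≤ K := by have := hg.lt'; rw [hK] at this; norm_cast at this; omega
    have hone := h.one_le
    have hKd : (K : ℕ∞) < diff e e' := by rw [hK]; exact_mod_cast Nat.lt_succ_self K
    have hyK : ∀ i < T, i < K → y i = (e i).or (e' i) := by
      intro i hi hiK
      rw [hy i hi, midpoint_of_lt hK hiK]
      have := (diff_eq_succ_iff.1 hK).2 i hiK
      rw [not_differ_iff] at this
      rcases this with h1 | h1 | h1
      · rw [h1]; simp
      · rw [h1]; cases e i <;> simp
      · rw [h1]; cases e' i <;> simp
    rcases Nat.lt_or_ge K T with hKT | hKT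
    · obtain ⟨h1, h2⟩ := ih hKd fun i hi => hyK i (by omega) hi
      have hyK' : y K = e' K := by rw [hy K hKT, midpoint_self hK]; simp
      obtain ⟨h3, h4⟩ := (h1 K (by omega) hlK hlK' le_rfl).step_right hK hyK'
      refine ⟨fun t _ ht _ htT => (propagate hT hy h3 t ht htT).1, fun t ht => ?_⟩
      rcases lt_trichotomy t K with htK | rfl | htK
      · exact h2 t htK
      · exact h4
      · exact (propagate hT hy h3 T hKT le_rfl).2 t htK ht
    · obtain ⟨h1, h2⟩ := ih (T := T) (lt_of_le_of_lt (by exact_mod_cast hKT) hKd)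
        fun i hi => hyK i hi (by omega)
      exact ⟨fun t _ ht _ htT => by omega, h2⟩

/-- The arms at an inserted point. -/
theorem DNode.arms_midpoint (hν : Knead ν) (h : DNode ν n l l' e e') {K : ℕ}
    (hK : diff e e' = ((K + 1 : ℕ) : ℕ∞)) :
    chop ν (critPt ν) (midpoint ν e e') K 0 = e K ∧ chop ν ν (midpoint ν e e') K 0 = e' K := by
  have hg := h.good hν
  have hlK : l ≤ K := by have := hg.lt; rw [hK] at this; norm_cast at this; omega
  have hlK' : l' ≤ K := by have := hg.lt'; rw [hK] at this; norm_cast at this; omega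
  have hone := h.one_le
  have hKd : (K : ℕ∞) < diff e e' := by rw [hK]; exact_mod_cast Nat.lt_succ_self K
  have := (h.resid (y := midpoint ν e e') hν hKd fun i hi => midpoint_of_lt hK hi).1 K (by omega) hlK hlK' le_rfl
  rw [this.eq, this.eq', shift_iterate, shift_iterate, zero_add]
  exact ⟨rfl, rfl⟩

theorem eq_or_of_notBoth {y : StarSeq A} {t : ℕ} (h : Resid ν y n l l' e e' t)
    (hb : NotBoth ν y t) (hy : y t ≠ none) (hd : ¬ Differ (e t) (e' t)) :
    y t = (e t).or (e' t) := by
  unfold NotBoth at hb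
  rw [h.eq, h.eq', shift_iterate, shift_iterate, zero_add] at hb
  rw [not_differ_iff] at hd
  rcases hb with hb | hb
  · rw [hb]
    cases h1 : y t
    · exact absurd h1 hy
    · simp
  · rw [← hb] at hy ⊢
    rcases hd with hd | hd | hd
    · rw [hd]; simp
    · exact absurd hd hy
    · rw [hd]; cases e' t <;> simp

theorem eq_succ_of_lt_of_not_lt {e e' : StarSeq A} {t : ℕ} (h : (t : ℕ∞) < diff e e')
    (h' : ¬ ((t + 1 : ℕ) : ℕ∞) < diff e e') : diff e e' = ((t + 1 : ℕ) : ℕ∞) := by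
  have h2 := Order.add_one_le_of_lt h
  push Not at h'
  exact le_antisymm h' (by exact_mod_cast h2)

/-- Conversely to `DNode.resid`, as long as there is no simultaneous cut, `y` fits an end at every
first difference and thereby selects a half of the refined pair. -/
theorem exists_resid {y : StarSeq A} (hν : Knead ν) {T : ℕ} (hT : 1 ≤ T)
    (hy : ∀ i < T, y i ≠ none) (hb : ∀ i < T, NotBoth ν y i) :
    ∃ n l l' e e', Resid ν y n l l' e e' T := by
  induction T, hT using Nat.le_induction with
  | base =>
    refine ⟨0, 1, 0, _, _, resid_root hν ?_⟩
    rcases hb 0 (by omega) with h | h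
    · exact absurd h.symm (hy 0 (by omega))
    · exact h
  | succ t ht ih =>
    obtain ⟨n, l, l', e, e', h⟩ := ih (fun i hi => hy i (by omega)) fun i hi => hb i (by omega)
    by_cases hlt : ((t + 1 : ℕ) : ℕ∞) < diff e e'
    · exact ⟨_, _, _, _, _, (h.step_same hν hlt (eq_or_of_notBoth h (hb t (by omega))
        (hy t (by omega)) (le_diff_iff.1 hlt t (by omega)))).1⟩
    · have hK := eq_succ_of_lt_of_not_lt h.lt hlt
      have := hb t (by omega)
      unfold NotBoth at this
      rw [h.eq, h.eq', shift_iterate, shift_iterate, zero_add] at this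
      rcases this with h1 | h1
      · exact ⟨_, _, _, _, _, (h.step_left hK h1.symm).1⟩
      · exact ⟨_, _, _, _, _, (h.step_right hK h1.symm).1⟩

/-- A precritical point that separates `⋆ν` and `ν` is in `P_∞`. -/
theorem exists_eq_midpoint {y : StarSeq A} (hν : Knead ν) {T : ℕ} (hy : IsWordStar ν T y)
    (h1 : chop ν (critPt ν) y T 0 ≠ none) (h2 : chop ν ν y T 0 ≠ none)
    (hne : chop ν (critPt ν) y T 0 ≠ chop ν ν y T 0) :
    ∃ n l l' e e', DNode ν n l l' e e' ∧ diff e e' = ((T + 1 : ℕ) : ℕ∞) ∧ y = midpoint ν e e' ∧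
      e T = chop ν (critPt ν) y T 0 ∧ e' T = chop ν ν y T 0 := by
  have hT : 1 ≤ T := by
    rcases Nat.eq_zero_or_pos T with rfl | h
    · exact absurd rfl h1
    · exact h
  obtain ⟨n, l, l', e, e', h⟩ := exists_resid hν hT hy.1 fun i hi => by
    by_contra hc
    unfold NotBoth at hc
    push Not at hc
    exact hne (by rw [chop_eq_of_cut hc.1 hc.2 hi])
  have he : e T = chop ν (critPt ν) y T 0 := by rw [h.eq, shift_iterate, zero_add]
  have he' : e' T = chop ν ν y T 0 := by rw [h.eq', shift_iterate, zero_add]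
  have hK : diff e e' = ((T + 1 : ℕ) : ℕ∞) := diff_eq_succ_iff.2
    ⟨differ_iff.2 ⟨by rwa [he], by rwa [he'], by rwa [he, he']⟩, le_diff_iff.1 h.lt⟩
  refine ⟨n, l, l', e, e', h.node, hK, ?_, he, he'⟩
  funext i
  rcases lt_trichotomy i T with hi | rfl | hi
  · rw [h.fits i hi, midpoint_of_lt hK hi]
  · rw [hy.2.1, midpoint_self hK]
  · obtain ⟨j, rfl⟩ := Nat.exists_eq_add_of_lt hi
    rw [show T + j + 1 = j + (T + 1) by ring, midpoint_of_gt hK, ← shift_iterate y (T + 1) j,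
      hy.2.2]

/-! ### Located sequences -/

/-- The sequence `a` has the symbols that the neighbours `e` and `e'` have in common. -/
def Cont (e e' a : StarSeq A) : Prop :=
  ∀ i : ℕ, ((i + 1 : ℕ) : ℕ∞) < diff e e' → a i = (e i).or (e' i)

theorem Cont.of_left {a : StarSeq A} {K : ℕ} (hK : diff e e' = ((K + 1 : ℕ) : ℕ∞))
    (h : Cont e (midpoint ν e e') a) : Cont e e' a ∧ a K = e K := by
  have hd := lt_diff_midpoint (ν := ν) hK
  refine ⟨fun i hi => ?_, ?_⟩
  · rw [hK] at hi
    rw [h i (hi.trans hd), midpoint_of_lt hK (by norm_cast at hi; omega)]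
    cases e i <;> simp
  · rw [h K hd, midpoint_self hK]; simp

theorem Cont.of_right {a : StarSeq A} {K : ℕ} (hK : diff e e' = ((K + 1 : ℕ) : ℕ∞))
    (h : Cont (midpoint ν e e') e' a) : Cont e e' a ∧ a K = e' K := by
  have hd := lt_diff_midpoint_right (ν := ν) hK
  refine ⟨fun i hi => ?_, ?_⟩
  · rw [hK] at hi
    rw [h i (hi.trans hd), midpoint_of_lt hK (by norm_cast at hi; omega)]
    have := (diff_eq_succ_iff.1 hK).2 i (by norm_cast at hi; omega)
    rw [not_differ_iff] at this
    rcases this with h1 | h1 | h1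
    · rw [h1]; simp
    · rw [h1]; cases e i <;> simp
    · rw [h1]; cases e' i <;> simp
  · rw [h K hd, midpoint_self hK]; simp

/-- The neighbours `f`, `f'` are obtained from `e`, `e'` in the next step. -/
def Step (ν e e' f f' : StarSeq A) : Prop :=
  (diff e e' = ⊤ ∧ f = e ∧ f' = e') ∨
    (diff e e' ≠ ⊤ ∧ ((f = e ∧ f' = midpoint ν e e') ∨ (f = midpoint ν e e' ∧ f' = e')))

theorem Cont.of_step {a f f' : StarSeq A} (hs : Step ν e e' f f') (h : Cont f f' a) :
    Cont e e' a := by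
  rcases hs with ⟨hd, rfl, rfl⟩ | ⟨hd, ⟨rfl, rfl⟩ | ⟨rfl, rfl⟩⟩
  · exact h
  · obtain ⟨K, hK⟩ := exists_diff_eq_succ hd
    exact (h.of_left hK).1
  · obtain ⟨K, hK⟩ := exists_diff_eq_succ hd
    exact (h.of_right hK).1

theorem Node.of_step {f f' : StarSeq A} (h : Node ν n e e') (hs : Step ν e e' f f') :
    Node ν (n + 1) f f' := by
  rcases hs with ⟨hd, rfl, rfl⟩ | ⟨hd, ⟨rfl, rfl⟩ | ⟨rfl, rfl⟩⟩
  exacts [h.same hd, h.left hd, h.right hd]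

/-- The two halves of a refined pair prescribe different symbols at the first difference of the
parents, so a sequence has at most one place at each level. -/
theorem Node.eq_of_cont {f f' a : StarSeq A} (h : Node ν n e e') (h' : Node ν n f f')
    (hc : Cont e e' a) (hc' : Cont f f' a) : e = f ∧ e' = f' := by
  induction n generalizing e e' f f' with
  | zero =>
    obtain ⟨rfl, rfl⟩ := node_zero h
    obtain ⟨rfl, rfl⟩ := node_zero h'
    exact ⟨rfl, rfl⟩
  | succ n ih =>
    obtain ⟨b, b', hb, hs⟩ := h.exists_parent
    obtain ⟨g, g', hg, hs'⟩ := h'.exists_parent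
    obtain ⟨rfl, rfl⟩ := ih hb hg (hc.of_step hs) (hc'.of_step hs')
    have excl : ∀ K : ℕ, diff b b' = ((K + 1 : ℕ) : ℕ∞) → a K = b K → a K = b' K → False := by
      intro K hK h1 h2
      exact (differ_iff.1 (diff_eq_succ_iff.1 hK).1).2.2 (h1.symm.trans h2)
    rcases hs with ⟨hd, rfl, rfl⟩ | ⟨hd, ⟨rfl, rfl⟩ | ⟨rfl, rfl⟩⟩ <;>
    rcases hs' with ⟨hd', rfl, rfl⟩ | ⟨hd', ⟨rfl, rfl⟩ | ⟨rfl, rfl⟩⟩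
    · exact ⟨rfl, rfl⟩
    · exact absurd hd hd'
    · exact absurd hd hd'
    · exact absurd hd' hd
    · exact ⟨rfl, rfl⟩
    · obtain ⟨K, hK⟩ := exists_diff_eq_succ hd
      exact (excl K hK (hc.of_left hK).2 (hc'.of_right hK).2).elim
    · exact absurd hd' hd
    · obtain ⟨K, hK⟩ := exists_diff_eq_succ hd
      exact (excl K hK (hc'.of_left hK).2 (hc.of_right hK).2).elim
    · exact ⟨rfl, rfl⟩

/-- Nested pairs of neighbours, starting in the `N`-th list. -/
structure IsPath (ν : StarSeq A) (N : ℕ) (lo hi : ℕ → StarSeq A) : Prop where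
  node : Node ν N (lo 0) (hi 0)
  step : ∀ n, Step ν (lo n) (hi n) (lo (n + 1)) (hi (n + 1))

variable {N : ℕ} {lo hi : ℕ → StarSeq A}

theorem IsPath.node_add (h : IsPath ν N lo hi) (n : ℕ) : Node ν (N + n) (lo n) (hi n) := by
  induction n with
  | zero => exact h.node
  | succ n ih => exact ih.of_step (h.step n)

/-- The sequence `a` has a position among the points of `P_n`, for every `n`. -/
def Loc (ν a : StarSeq A) : Prop := ∀ n, ∃ e e', Node ν n e e' ∧ Cont e e' a

/-- The limit of nested pairs of neighbours. -/
noncomputable def pathLimit (lo hi : ℕ → StarSeq A) : StarSeq A :=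
  fun i => (lo (i + 1) i).or (hi (i + 1) i)

theorem IsPath.cont_of_le (h : IsPath ν N lo hi) {a : StarSeq A} {n m : ℕ} (hnm : n ≤ m)
    (hc : Cont (lo m) (hi m) a) : Cont (lo n) (hi n) a := by
  induction m, hnm using Nat.le_induction with
  | base => exact hc
  | succ m _ ih => exact ih (hc.of_step (h.step m))

/-- The common symbol at index `i` is fixed as soon as the neighbours are compatible beyond `i`, and
`i + 1` steps suffice for this. -/
theorem IsPath.cont_pathLimit (hν : Knead ν) (h : IsPath ν N lo hi) (n : ℕ) :
    Cont (lo n) (hi n) (pathLimit lo hi) := by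
  have key : ∀ m k, Cont (lo m) (hi m) (fun i => (lo (m + k) i).or (hi (m + k) i)) :=
    fun m k => h.cont_of_le (Nat.le_add_right m k) fun i _ => rfl
  have hlt : ∀ m, ((m : ℕ) : ℕ∞) < diff (lo m) (hi m) := fun m =>
    lt_of_le_of_lt (by exact_mod_cast Nat.le_add_left m N) ((h.node_add m).lt_diff hν)
  intro i hi'
  rcases le_total n (i + 1) with hle | hle
  · obtain ⟨k, hk⟩ := Nat.exists_eq_add_of_le hle
    have := key n k i hi'
    rw [← hk] at this
    exact this
  · obtain ⟨k, hk⟩ := Nat.exists_eq_add_of_le hle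
    have := key (i + 1) k i (hlt (i + 1))
    rw [← hk] at this
    exact this.symm

theorem IsPath.noStar_pathLimit (hν : Knead ν) (h : IsPath ν N lo hi) :
    NoStar (pathLimit lo hi) := by
  intro i
  obtain ⟨l, l', hg⟩ := (h.node_add (i + 1)).good hν
  have := hg.star i
  unfold pathLimit
  rw [Ne, Option.or_eq_none_iff]
  tauto

theorem exists_cont_of_le {a : StarSeq A} {n m : ℕ} (hnm : n ≤ m) (h : Node ν m e e')
    (hc : Cont e e' a) : ∃ f f', Node ν n f f' ∧ Cont f f' a := by
  induction m, hnm using Nat.le_induction generalizing e e' with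
  | base => exact ⟨e, e', h, hc⟩
  | succ m _ ih =>
    obtain ⟨b, b', hb, hs⟩ := h.exists_parent
    exact ih hb (hc.of_step hs)

theorem IsPath.loc (h : IsPath ν N lo hi) {a : StarSeq A} (hc : ∀ n, Cont (lo n) (hi n) a) :
    Loc ν a := fun n =>
  exists_cont_of_le (Nat.le_add_left n N) (h.node_add n) (hc n)

theorem Loc.exists_path {a : StarSeq A} (h : Loc ν a) :
    ∃ lo hi, IsPath ν 0 lo hi ∧ ∀ n, Cont (lo n) (hi n) a := by
  choose lo hi h1 h2 using h
  refine ⟨lo, hi, ⟨h1 0, fun n => ?_⟩, h2⟩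
  obtain ⟨b, b', hb, hs⟩ := (h1 (n + 1)).exists_parent
  obtain ⟨rfl, rfl⟩ := hb.eq_of_cont (h1 n) ((h2 (n + 1)).of_step hs) (h2 n)
  exact hs

theorem Loc.notBoth {a : StarSeq A} (hν : Knead ν) (h : Loc ν a) (t : ℕ) : NotBoth ν a t := by
  obtain ⟨e, e', hn, hc⟩ := h (t + 1)
  obtain ⟨l, l', hd⟩ := hn.exists_dnode
  refine (hd.resid hν (T := t + 1) (hn.lt_diff hν) fun i hi => hc i ?_).2 t (by omega)
  exact lt_of_le_of_lt (by exact_mod_cast hi) (hn.lt_diff hν)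

/-- Together with `Loc.notBoth`, this identifies the sequences that have a place at each level with
those between `⋆ν` and `ν`. Each pair is followed up to its first difference, where `a` fits one of
the ends. -/
theorem loc_of_notBoth {a : StarSeq A} (hν : Knead ν) (ha : NoStar a) (h : ∀ t, NotBoth ν a t) :
    Loc ν a := by
  have propagate : ∀ {n l l' e e'} {s : ℕ}, Resid ν a n l l' e e' s →
      ∀ t, s ≤ t → (t : ℕ∞) < diff e e' → Resid ν a n l l' e e' t := by
    intro n l l' e e' s hs t hst
    induction t, hst using Nat.le_induction with
    | base => exact fun _ => hs
    | succ t hst ih =>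
      intro hlt
      have h1 := ih (lt_of_le_of_lt (by exact_mod_cast Nat.le_succ t) hlt)
      exact (h1.step_same hν hlt (eq_or_of_notBoth h1 (h t) (ha t)
        (le_diff_iff.1 hlt t (by omega)))).1
  have hcont : ∀ {n l l' e e'} {s : ℕ}, Resid ν a n l l' e e' s → Cont e e' a := by
    intro n l l' e e' s hs i hi
    rcases Nat.lt_or_ge i s with his | his
    · exact hs.fits i his
    · exact (propagate hs (i + 1) (by omega) hi).fits i (by omega)
  have key : ∀ n, ∃ l l' e e' s, Resid ν a n l l' e e' s := by
    intro n
    induction n with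
    | zero =>
      refine ⟨1, 0, _, _, 1, resid_root hν ?_⟩
      rcases h 0 with h | h
      · exact absurd h.symm (ha 0)
      · exact h
    | succ n ih =>
      obtain ⟨l, l', e, e', s, hs⟩ := ih
      by_cases hd : diff e e' = ⊤
      · exact ⟨l, l', e, e', s, hs.node.same hd, hs.le, hs.le', hs.lt, hs.eq, hs.eq', hs.fits⟩
      · obtain ⟨K, hK⟩ := exists_diff_eq_succ hd
        have hsK : s ≤ K := by have := hs.lt; rw [hK] at this; norm_cast at this; omega
        have h1 := propagate hs K hsK (by rw [hK]; exact_mod_cast Nat.lt_succ_self K)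
        have := h K
        unfold NotBoth at this
        rw [h1.eq, h1.eq', shift_iterate, shift_iterate, zero_add] at this
        rcases this with h2 | h2
        · exact ⟨_, _, _, _, _, (h1.step_left hK h2.symm).1⟩
        · exact ⟨_, _, _, _, _, (h1.step_right hK h2.symm).1⟩
  intro n
  obtain ⟨l, l', e, e', s, hs⟩ := key n
  exact ⟨e, e', hs.node.node, hcont hs⟩

end


/-! ### Paths and convergence in `P_∞` -/

section

variable {ν : StarSeq A} {n N : ℕ} {e e' a : StarSeq A} {lo hi : ℕ → StarSeq A}

theorem Cont.lt_diff_left (hc : Cont e e' a) {m : ℕ} (h : (m : ℕ∞) < diff e e') :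
    (m : ℕ∞) < diff e a := by
  refine le_diff_iff.2 fun i hi => ?_
  rw [hc i (lt_of_le_of_lt (by exact_mod_cast hi) h), not_differ_iff]
  cases e i <;> simp

theorem Cont.lt_diff_right (hc : Cont e e' a) {m : ℕ} (h : (m : ℕ∞) < diff e e') :
    (m : ℕ∞) < diff e' a := by
  refine le_diff_iff.2 fun i hi => ?_
  rw [hc i (lt_of_le_of_lt (by exact_mod_cast hi) h),
    or_comm_of_not_differ (le_diff_iff.1 h i hi), not_differ_iff]
  cases e' i <;> simp

/-- Dependent choice for a property that every pair of neighbours hands on to one of its successors.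
With `Q` saying that the ends are separated, this is the bisection used below. -/
theorem exists_path {Q : StarSeq A → StarSeq A → Prop} (h : Node ν N e e') (h0 : Q e e')
    (hstep : ∀ n f f', N ≤ n → Node ν n f f' → Q f f' → ∃ g g', Step ν f f' g g' ∧ Q g g') :
    ∃ lo hi, IsPath ν N lo hi ∧ lo 0 = e ∧ hi 0 = e' ∧ ∀ n, Q (lo n) (hi n) := by
  choose! F G hF using hstep
  let s : ℕ → StarSeq A × StarSeq A := fun n =>
    Nat.rec (e, e') (fun n p => (F (N + n) p.1 p.2, G (N + n) p.1 p.2)) n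
  have hs : ∀ n, Node ν (N + n) (s n).1 (s n).2 ∧ Q (s n).1 (s n).2 := by
    intro n
    induction n with
    | zero => exact ⟨h, h0⟩
    | succ n ih =>
      have := hF (N + n) _ _ (Nat.le_add_right N n) ih.1 ih.2
      exact ⟨ih.1.of_step this.1, this.2⟩
  refine ⟨fun n => (s n).1, fun n => (s n).2, ⟨h, fun n => ?_⟩, rfl, rfl, fun n => (hs n).2⟩
  exact (hF (N + n) _ _ (Nat.le_add_right N n) (hs n).1 (hs n).2).1

theorem IsPath.lo_succ (h : IsPath ν N lo hi) (n : ℕ) :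
    lo (n + 1) = lo n ∨ (PLT ν (lo n) (lo (n + 1)) ∧ hi (n + 1) = hi n ∧
      lo (n + 1) = midpoint ν (lo n) (hi n) ∧ diff (lo n) (hi n) ≠ ⊤) := by
  rcases h.step n with ⟨_, h1, _⟩ | ⟨hd, ⟨h1, _⟩ | ⟨h1, h2⟩⟩
  · exact Or.inl h1
  · exact Or.inl h1
  · right
    refine ⟨?_, h2, h1, hd⟩
    rw [h1]
    exact ((h.node_add n).left hd).plt

theorem IsPath.hi_succ (h : IsPath ν N lo hi) (n : ℕ) :
    hi (n + 1) = hi n ∨ (PLT ν (hi (n + 1)) (hi n) ∧ lo (n + 1) = lo n ∧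
      hi (n + 1) = midpoint ν (lo n) (hi n) ∧ diff (lo n) (hi n) ≠ ⊤) := by
  rcases h.step n with ⟨_, _, h1⟩ | ⟨hd, ⟨h1, h2⟩ | ⟨_, h2⟩⟩
  · exact Or.inl h1
  · right
    refine ⟨?_, h1, h2, hd⟩
    rw [h2]
    exact ((h.node_add n).right hd).plt
  · exact Or.inl h2

theorem IsPath.lo_le (hν : Knead ν) (h : IsPath ν N lo hi) {n m : ℕ} (hnm : n ≤ m) :
    lo m = lo n ∨ PLT ν (lo n) (lo m) := by
  induction m, hnm using Nat.le_induction with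
  | base => exact Or.inl rfl
  | succ m _ ih =>
    rcases h.lo_succ m with h1 | ⟨h1, _⟩
    · rwa [h1]
    · rcases ih with h2 | h2
      · exact Or.inr (h2 ▸ h1)
      · exact Or.inr (h2.trans hν h1)

theorem IsPath.hi_le (hν : Knead ν) (h : IsPath ν N lo hi) {n m : ℕ} (hnm : n ≤ m) :
    hi m = hi n ∨ PLT ν (hi m) (hi n) := by
  induction m, hnm using Nat.le_induction with
  | base => exact Or.inl rfl
  | succ m _ ih =>
    rcases h.hi_succ m with h1 | ⟨h1, _⟩
    · rwa [h1]
    · rcases ih with h2 | h2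
      · exact Or.inr (h2 ▸ h1)
      · exact Or.inr (h1.trans hν h2)

/-- The sequence is not eventually constant. -/
def Moving (u : ℕ → StarSeq A) : Prop := ∀ n, ∃ m ≥ n, u m ≠ u n

theorem Moving.exists_step {u : ℕ → StarSeq A} (h : Moving u) (k : ℕ) :
    ∃ n ≥ k, u (n + 1) ≠ u n := by
  obtain ⟨m, hm1, hm2⟩ := h k
  by_contra! hcon
  apply hm2
  clear hm2
  induction m, hm1 using Nat.le_induction with
  | base => rfl
  | succ m hm ih => rw [hcon m hm, ih]

theorem exists_const_of_not_moving {u : ℕ → StarSeq A} (h : ¬ Moving u) :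
    ∃ M, ∀ m ≥ M, u m = u M := by
  unfold Moving at h
  push Not at h
  exact h

theorem tendsto_top_of_forall {f : ℕ → ℕ∞} (h : ∀ k : ℕ, ∀ᶠ n in atTop, (k : ℕ∞) < f n) :
    Tendsto f atTop (𝓝 ⊤) := by
  rw [tendsto_order]
  refine ⟨fun b hb => ?_, fun b hb => absurd hb not_top_lt⟩
  lift b to ℕ using hb.ne
  exact h b

theorem eventually_lt_of_tendsto {f : ℕ → ℕ∞} (h : Tendsto f atTop (𝓝 ⊤)) (k : ℕ) :
    ∀ᶠ n in atTop, (k : ℕ∞) < f n :=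
  (tendsto_order.1 h).1 _ (ENat.natCast_lt_top k)

theorem IsPath.lt_diff (hν : Knead ν) (h : IsPath ν N lo hi) {n m : ℕ} (hnm : n ≤ N + m) :
    (n : ℕ∞) < diff (lo m) (hi m) :=
  lt_of_le_of_lt (by exact_mod_cast hnm) ((h.node_add m).lt_diff hν)

theorem exists_subseq_of_moving {R : StarSeq A → StarSeq A → Prop} {u : ℕ → StarSeq A}
    (h : ∀ n, ∃ m ≥ n, R (u n) (u m) ∧ u m ≠ u n) :
    ∃ φ : ℕ → ℕ, (∀ i, i ≤ φ i) ∧ ∀ i, R (u (φ i)) (u (φ (i + 1))) := by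
  choose F hF hF' using h
  refine ⟨fun i => F^[i] 0, fun i => ?_, fun i => ?_⟩
  · induction i with
    | zero => exact Nat.zero_le _
    | succ i ih =>
      simp only [Function.iterate_succ_apply']
      have ih' : i ≤ F^[i] 0 := ih
      have h1 := hF (F^[i] 0)
      have h2 : F (F^[i] 0) ≠ F^[i] 0 := fun h => (hF' (F^[i] 0)).2 (by rw [h])
      omega
  · simp only [Function.iterate_succ_apply']
    exact (hF' _).1

theorem IsPath.exists_convergesTo (hν : Knead ν) (h : IsPath ν N lo hi)
    (hc : ∀ n, Cont (lo n) (hi n) a) (hm : Moving lo ∨ Moving hi) : ∃ u, ConvergesTo ν u a := by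
  rcases hm with hm | hm
  · obtain ⟨φ, h1, h2⟩ := exists_subseq_of_moving (R := PLT ν) (u := lo) fun n => by
      obtain ⟨m, hm, hne⟩ := hm n
      exact ⟨m, hm, (h.lo_le hν hm).resolve_left hne, hne⟩
    refine ⟨fun i => lo (φ i), Or.inl h2, tendsto_top_of_forall fun k => ?_⟩
    filter_upwards [eventually_ge_atTop k] with i hi'
    exact (hc _).lt_diff_left (h.lt_diff hν (by have := h1 i; omega))
  · obtain ⟨φ, h1, h2⟩ := exists_subseq_of_moving (R := fun a b => PLT ν b a) (u := hi)
      fun n => by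
        obtain ⟨m, hm, hne⟩ := hm n
        exact ⟨m, hm, (h.hi_le hν hm).resolve_left hne, hne⟩
    refine ⟨fun i => hi (φ i), Or.inr h2, tendsto_top_of_forall fun k => ?_⟩
    filter_upwards [eventually_ge_atTop k] with i hi'
    exact (hc _).lt_diff_right (h.lt_diff hν (by have := h1 i; omega))

/-- Points that are not in `P_{n+1}` have no star among their first symbols. -/
theorem ne_none_of_notMem (hν : Knead ν) {q : StarSeq A} (hq : q ∈ PInf ν) (hn : q ∉ P ν n)
    {i : ℕ} (hi : i < n) : q i ≠ none := by
  obtain ⟨e, e', h, h1, h2⟩ := exists_node_of_notMem hν hq hn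
  obtain ⟨l, l', hg⟩ := h.good hν
  rw [(h.inside hν h1 h2).apply_eq i
    (lt_of_le_of_lt (by exact_mod_cast hi) (h.lt_diff hν)), Ne, Option.or_eq_none_iff]
  have := hg.star i
  tauto

theorem ConvergesTo.mem_PInf {u : ℕ → StarSeq A} (h : ConvergesTo ν u a) (n : ℕ) :
    u n ∈ PInf ν := by
  rcases h.1 with h | h
  exacts [(h n).mem_left, (h n).mem_right]

theorem ConvergesTo.strictMono (hν : Knead ν) {u : ℕ → StarSeq A} (h : ConvergesTo ν u a) :
    (∀ n m, n < m → PLT ν (u n) (u m)) ∨ (∀ n m, n < m → PLT ν (u m) (u n)) := by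
  rcases h.1 with h | h
  · left
    intro n m hnm
    induction m, hnm using Nat.le_induction with
    | base => exact h n
    | succ m _ ih => exact ih.trans hν (h m)
  · right
    intro n m hnm
    induction m, hnm using Nat.le_induction with
    | base => exact h n
    | succ m _ ih => exact (h m).trans hν ih

/-- Strict monotonicity makes `u` injective, and `P ν n` is finite. -/
theorem ConvergesTo.eventually_notMem (hν : Knead ν) {u : ℕ → StarSeq A}
    (h : ConvergesTo ν u a) (n : ℕ) : ∀ᶠ m in atTop, u m ∉ P ν n := by
  classical
  have hinj : Function.Injective u := by
    intro i j hij
    by_contra hne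
    rcases lt_or_gt_of_ne hne with hlt | hlt <;> rcases h.strictMono hν with h1 | h1
    all_goals
      have := h1 _ _ hlt
      rw [hij] at this
      exact PLT.irrefl hν _ this
  have hfin : (u ⁻¹' {q | q ∈ P ν n}).Finite := by
    refine Set.Finite.preimage hinj.injOn ?_
    exact (List.finite_toSet (P ν n))
  have := hfin.eventually_cofinite_notMem
  rw [Nat.cofinite_eq_atTop] at this
  exact this

end


/-! ### The non-periodic case -/

theorem le_diff_iff' {a b : StarSeq A} {k : ℕ} :
    (k : ℕ∞) ≤ diff a b ↔ ∀ i, i + 1 < k → ¬ Differ (a i) (b i) := by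
  cases k with
  | zero => simp
  | succ k =>
    have h1 : ((k + 1 : ℕ) : ℕ∞) ≤ diff a b ↔ (k : ℕ∞) < diff a b := by
      constructor
      · intro h
        exact lt_of_lt_of_le (by exact_mod_cast Nat.lt_succ_self k) h
      · intro h
        have := Order.add_one_le_of_lt h
        exact_mod_cast this
    rw [h1, le_diff_iff]
    exact forall_congr' fun i => by rw [Nat.add_lt_add_iff_right]

section

variable {ν : StarSeq A}

/-- This reduces convergence in the generated topology to long agreement and large depth. The point
is that agreement passes from `a` to `x` to `b`, even though `⋆` is a wild card. -/
theorem exists_nhd_subset (hs : NoStar ν) {x : StarSeq A} (hx : x ∈ X ν) {S : Set (X ν)}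
    (hS : IsOpen[topologyX ν] S) (hxS : ⟨x, hx⟩ ∈ S) : ∃ k : ℕ, ∀ b (hb : b ∈ X ν),
      (k : ℕ∞) ≤ diff x b → (∀ m, IsWordStar ν m b → k ≤ m + 1) → (⟨b, hb⟩ : X ν) ∈ S := by
  induction hS with
  | basic S h =>
    obtain ⟨a, ha, k, hk, rfl⟩ := h
    refine ⟨k, fun b hb h1 h2 => ?_⟩
    obtain ⟨⟨-, h3⟩, h4⟩ := hxS
    simp only at h3
    refine ⟨⟨hb, ?_⟩, ?_⟩
    · simp only
      by_cases hax : x = a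
      · rwa [← hax]
      · rw [le_diff_iff'] at *
        intro i hi hd
        have h5 := h1 i hi
        have h6 := h3 i hi
        rw [not_differ_iff] at h5 h6
        rw [differ_iff] at hd
        -- Only a `⋆` of `x` can spoil transitivity at index `i`. Then `x` would be precritical of
        -- depth less than `k` and different from `a` and `ν`, hence removed from the neighbourhood
        -- of `a`.
        have hxi : x i = none := by
          by_contra hxi
          have h7 : x i = b i := by tauto
          have h8 : a i = x i := by tauto
          exact hd.2.2 (h8.trans h7)
        apply h4
        refine ⟨⟨⟨hx, le_diff_iff'.2 h3⟩, hax⟩, ?_, ?_⟩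
        · intro hxν
          have hxν : x = ν := hxν
          exact hs i (by rw [← hxν]; exact hxi)
        · rcases hx with ⟨m, hm⟩ | ⟨m, rfl⟩ | ⟨hx, -⟩
          · refine ⟨m, ?_, hm⟩
            have : m ≤ i := by
              by_contra! hlt
              exact hm.1 i hlt hxi
            omega
          · rw [shift_iterate] at hxi
            exact (hs _ hxi).elim
          · exact (hx i hxi).elim
    · rintro ⟨-, -, m, hm, hw⟩
      have := h2 m hw
      omega
  | univ => exact ⟨0, fun _ _ _ _ => trivial⟩
  | inter S T _ _ ihS ihT =>
    obtain ⟨k, hk⟩ := ihS hxS.1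
    obtain ⟨m, hm⟩ := ihT hxS.2
    refine ⟨max k m, fun b hb h1 h2 => ⟨hk b hb ?_ ?_, hm b hb ?_ ?_⟩⟩
    · exact le_trans (by exact_mod_cast le_max_left k m) h1
    · exact fun i hi => (le_max_left k m).trans (h2 i hi)
    · exact le_trans (by exact_mod_cast le_max_right k m) h1
    · exact fun i hi => (le_max_right k m).trans (h2 i hi)
  | sUnion 𝒮 _ ih =>
    obtain ⟨S, hS, hxS⟩ := hxS
    obtain ⟨k, hk⟩ := ih S hS hxS
    exact ⟨k, fun b hb h1 h2 => ⟨S, hS, hk b hb h1 h2⟩⟩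

/-- Convergence in `X_ν` of precritical points whose depths go to infinity. -/
theorem eventually_mem_of_isOpen (hs : NoStar ν) {x : StarSeq A} (hx : x ∈ X ν) {U : Set (Pt A)}
    (hU : IsOpen[TopologicalSpace.coinduced (fun a : X ν => Pt.itin a.1) (topologyX ν)] U)
    (hxU : Pt.itin x ∈ U) {u : ℕ → StarSeq A} (hu : ∀ n, u n ∈ X ν)
    (h1 : ∀ k : ℕ, ∀ᶠ n in atTop, (k : ℕ∞) ≤ diff x (u n))
    (h2 : ∀ k : ℕ, ∀ᶠ n in atTop, ∀ m, IsWordStar ν m (u n) → k ≤ m + 1) :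
    ∀ᶠ n in atTop, Pt.itin (u n) ∈ U := by
  obtain ⟨k, hk⟩ := exists_nhd_subset hs hx (isOpen_coinduced.1 hU) hxU
  filter_upwards [h1 k, h2 k] with n hn hn'
  exact hk _ (hu n) hn hn'

theorem shift_iterate_itin (j : ℕ) (a : StarSeq A) :
    Pt.shift^[j] (Pt.itin a) = Pt.itin (shift^[j] a) := by
  induction j generalizing a with
  | zero => rfl
  | succ j ih => rw [Function.iterate_succ_apply, Function.iterate_succ_apply, ← ih]; rfl

theorem HasDepth.eq_of_eq_none (hs : NoStar ν) {l i : ℕ} {a : StarSeq A} (h : HasDepth ν l a)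
    (hi : a i = none) : l = i + 1 := by
  cases l with
  | zero =>
    have h' : a = ν := h
    rw [h'] at hi
    exact (hs i hi).elim
  | succ m =>
    rcases lt_trichotomy i m with hlt | rfl | hlt
    · exact (h.1 i hlt hi).elim
    · rfl
    · obtain ⟨j, rfl⟩ := Nat.exists_eq_add_of_lt hlt
      rw [show m + j + 1 = j + (m + 1) by ring, h.apply_add] at hi
      exact (hs _ hi).elim

theorem HasDepth.apply_self {l : ℕ} {a : StarSeq A} (h : HasDepth ν l a) (hl : 1 ≤ l) :
    a (l - 1) = none := by
  cases l with
  | zero => omega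
  | succ m => exact h.2.1

theorem HasDepth.shift_mem_X {l : ℕ} {a : StarSeq A} (h : HasDepth ν l a) (j : ℕ) :
    shift^[j] a ∈ X ν := by
  rcases Nat.lt_or_ge j l with hj | hj
  · left
    cases l with
    | zero => omega
    | succ m =>
      refine ⟨m - j, fun i hi => ?_, ?_, ?_⟩
      · rw [shift_iterate]; exact h.1 _ (by omega)
      · rw [shift_iterate, Nat.sub_add_cancel (by omega)]; exact h.2.1
      · rw [shift_iterate_add, show m - j + 1 + j = m + 1 by omega]; exact h.2.2
  · right; left
    exact ⟨j - l, by rw [← h.shift_eq, shift_iterate_add, Nat.sub_add_cancel hj]⟩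

/-- The depths of neighbours are different, so comparing the tails of two compatible neighbours
would give a period of `ν`. There are thus no gaps in the non-periodic case. -/
theorem Good.diff_ne_top (hs : NoStar ν) (hp : ν ∉ Function.periodicPts shift) {l l' : ℕ}
    {e e' : StarSeq A} (h : Good ν l l' e e') : diff e e' ≠ ⊤ := by
  have key : ∀ {l l' e e'}, Good ν l l' e e' → l < l' → diff e e' ≠ ⊤ := by
    intro l l' e e' h hlt hd
    rw [diff_eq_top_iff] at hd
    refine hp (isPeriodic_of_shift_eq (n := l' - l) (by omega) ?_)
    funext i
    have h1 := hd (i + l')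
    rw [not_differ_iff, h.depth'.apply_add, show i + l' = i + (l' - l) + l by omega,
      h.depth.apply_add] at h1
    rw [shift_iterate]
    have h2 := hs i
    have h3 := hs (i + (l' - l))
    tauto
  rcases lt_or_gt_of_ne h.ne with hlt | hlt
  · exact key h hlt
  · rw [diff_comm]
    exact key h.symm hlt

/-! #### The neighbours of a precritical point -/

theorem sync_critPt_self (hs : NoStar ν) : Sync ν ν (critPt ν) (critPt ν) :=
  ⟨0, fun h => hs 0 h.symm, fun h => hs 0 h.symm⟩

/-- As `σ^l e = ν`, this follows `e'` along `e`. While the two are compatible, a cut can only come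
from the single `⋆` of `e'`, after which `e'` continues with `ν` as the restart does. -/
theorem Good.chop_eq (hs : NoStar ν) {l l' : ℕ} {e e' : StarSeq A} (h : Good ν l l' e e')
    {t : ℕ} (ht : ((t + l : ℕ) : ℕ∞) < diff e e') :
    chop ν (shift^[l] e') ν t = shift^[t + l] e' := by
  induction t with
  | zero => rw [zero_add]; rfl
  | succ t ih =>
    have ht' : ((t + l : ℕ) : ℕ∞) < diff e e' :=
      lt_of_le_of_lt (by exact_mod_cast (by omega : t + l ≤ t + 1 + l)) ht
    have ih := ih ht'
    have h1 := le_diff_iff.1 ht (t + l) (by omega)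
    rw [not_differ_iff, h.depth.apply_add] at h1
    have h0 : chop ν (shift^[l] e') ν t 0 = e' (t + l) := by rw [ih, shift_iterate, zero_add]
    rcases h1 with h1 | h1 | h1
    · exact (hs t h1).elim
    · rw [chop_succ_of_ne (by rw [h0, h1]; exact fun h => hs t h.symm)]
      have := h.depth'.eq_of_eq_none hs h1
      rw [show t + 1 + l = l' by omega, h.depth'.shift_eq]
    · rw [chop_succ_of_eq (by rw [h0, h1]), ih, show t + 1 + l = (t + l) + 1 by ring,
        Function.iterate_succ_apply']

/-- At the first difference `K`, `e'` has the wrong symbol and the midpoint has `⋆`, so along `σ^l e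
= ν` both are cut. Replacing a neighbour of `e` by the midpoint does not change the side of `ν` on
which its image lies. -/
theorem Good.sync_midpoint (hs : NoStar ν) {l l' K : ℕ} {e e' : StarSeq A}
    (h : Good ν l l' e e') (hK : diff e e' = ((K + 1 : ℕ) : ℕ∞)) :
    chop ν (shift^[l] e') ν (K - l) 0 ≠ ν (K - l) ∧
      chop ν (shift^[l] (midpoint ν e e')) ν (K - l) 0 ≠ ν (K - l) := by
  have hg := h.left hs.knead hK
  have hlK : l ≤ K := by have := h.lt; rw [hK] at this; norm_cast at this; omega
  constructor
  · rw [h.chop_eq hs (by rw [hK]; exact_mod_cast (by omega : K - l + l < K + 1)), shift_iterate,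
      zero_add, ← h.depth.apply_add, Nat.sub_add_cancel hlK]
    exact (differ_iff.1 (diff_eq_succ_iff.1 hK).1).2.2.symm
  · have hd := lt_diff_midpoint (ν := ν) hK
    rw [hg.chop_eq hs (lt_trans (by exact_mod_cast (by omega : K - l + l < K + 1)) hd),
      shift_iterate, zero_add, Nat.sub_add_cancel hlK, midpoint_self hK]
    exact fun h => hs _ h.symm

/-- The iterate that maps a precritical point to `ν` maps its neighbours to the side of `⋆ν`. For a
new midpoint, `σ^(K+1)` sends its parents to orbit points `σ^r ν` with `r ≥ 1`, so `sync_critPt`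
applies; later insertions keep the side by `Good.sync_midpoint`. -/
theorem DNode.sync (hs : NoStar ν) (hp : ν ∉ Function.periodicPts shift) {n l l' : ℕ}
    {e e' : StarSeq A} (h : DNode ν n l l' e e') :
    Sync ν ν (critPt ν) (shift^[l] e') ∧ Sync ν ν (critPt ν) (shift^[l'] e) := by
  have hν := hs.knead
  induction h with
  | root => exact ⟨sync_critPt hs hp le_rfl, sync_critPt_self hs⟩
  | same _ hd ih => exact ih
  | @left n l l' e e' K h hK ih =>
    have hg := h.good hν
    have hlK : l ≤ K := by have := hg.lt; rw [hK] at this; norm_cast at this; omega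
    refine ⟨ih.1.trans ⟨_, hg.sync_midpoint hs hK⟩, ?_⟩
    rw [show K + 1 = K + 1 - l + l by omega, ← shift_iterate_add, hg.depth.shift_eq]
    exact sync_critPt hs hp (by omega)
  | @right n l l' e e' K h hK ih =>
    have hg := h.good hν
    have hlK : l' ≤ K := by have := hg.lt'; rw [hK] at this; norm_cast at this; omega
    refine ⟨?_, ih.2.trans ?_⟩
    · rw [show K + 1 = K + 1 - l' + l' by omega, ← shift_iterate_add, hg.depth'.shift_eq]
      exact sync_critPt hs hp (by omega)
    · rw [midpoint_comm ν (ne_top_of_eq_succ hK)]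
      exact ⟨_, hg.symm.sync_midpoint hs (by rwa [diff_comm])⟩

/-- The precritical point `w⋆ν`, where `w` consists of the first `T` symbols of `ν`. -/
def prefixPt (ν : StarSeq A) (T : ℕ) : StarSeq A := fun i =>
  if i < T then ν i else critPt ν (i - T)

theorem prefixPt_of_lt {T i : ℕ} (h : i < T) : prefixPt ν T i = ν i := by simp [prefixPt, h]

theorem isWordStar_prefixPt (hs : NoStar ν) (T : ℕ) : IsWordStar ν T (prefixPt ν T) := by
  refine ⟨fun i hi => by rw [prefixPt_of_lt hi]; exact hs i, by simp [prefixPt, critPt], ?_⟩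
  funext i
  rw [shift_iterate]
  simp only [prefixPt]
  rw [if_neg (by omega), show i + (T + 1) - T = i + 1 by omega]
  rfl

theorem eq_prefixPt {a : StarSeq A} {T : ℕ} (h1 : ∀ i < T, a i = ν i) (h2 : a T = none)
    (h3 : shift^[T + 1] a = ν) : a = prefixPt ν T := by
  funext i
  rcases lt_trichotomy i T with hi | rfl | hi
  · rw [h1 i hi, prefixPt_of_lt hi]
  · simp [h2, prefixPt, critPt]
  · obtain ⟨j, rfl⟩ := Nat.exists_eq_add_of_lt hi
    rw [show T + j + 1 = j + (T + 1) by ring, ← shift_iterate a (T + 1) j, h3]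
    simp only [prefixPt]
    rw [if_neg (by omega), show j + (T + 1) - T = j + 1 by omega]
    rfl

/-- At index `T` the chopped `⋆ν` and `ν` show different symbols, so this point separates `⋆ν` from
`ν`. -/
theorem prefixPt_mem_PInf (hs : NoStar ν) {T : ℕ} (h : chop ν (critPt ν) ν T 0 ≠ ν T) :
    prefixPt ν T ∈ PInf ν := by
  have hν := hs.knead
  have hns : ∀ x ∈ orb ν, NoStar x := by
    rintro _ ⟨i, rfl⟩ j
    rw [shift_iterate]
    exact hs _
  rcases Nat.eq_zero_or_pos T with rfl | hT
  · have : prefixPt ν 0 = critPt ν := by funext i; simp [prefixPt]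
    rw [this]
    exact ⟨0, critPt_mem_P ν 0⟩
  · have h1 : chop ν (critPt ν) (prefixPt ν T) T = chop ν (critPt ν) ν T :=
      chop_congr fun i hi => prefixPt_of_lt hi
    have h2 : chop ν ν (prefixPt ν T) T = shift^[T] ν := chop_of_agree fun i hi =>
      (prefixPt_of_lt hi).symm
    have h3 : chop ν (critPt ν) ν T ∈ orb ν := by
      obtain ⟨t, rfl⟩ := Nat.exists_eq_add_of_lt hT
      rw [show 0 + t + 1 = 1 + t by ring, chop_add, chop_succ_of_ne (n := 0)]
      · exact chop_mem_orb (self_mem_orb ν) _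
      · exact fun h => hs 0 h.symm
    obtain ⟨n, l, l', e, e', hd, hK, he, -, -⟩ := exists_eq_midpoint hν (isWordStar_prefixPt hs T)
      (by rw [h1]; exact hns _ h3 0) (by rw [h2]; exact hns _ (iterate_mem_orb ν T) 0)
      (by rw [h1, h2, shift_iterate, zero_add]; exact h)
    rw [he]
    exact ⟨n + 1, (hd.left hK).node.mem_right⟩

/-! #### Limits of paths -/

/-- Whenever the lower neighbour is replaced, `a` has sided with the upper one and the descendant of
`⋆ν` is cut. The time of the cut is at least the level. -/
theorem IsPath.frequently_cut_lo (hs : NoStar ν) {N : ℕ}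
    {lo hi : ℕ → StarSeq A} (h : IsPath ν N lo hi) {a : StarSeq A}
    (hc : ∀ n, Cont (lo n) (hi n) a) (hm : Moving lo) (t : ℕ) :
    ∃ K ≥ t, chop ν (critPt ν) a K 0 ≠ a K := by
  have hν := hs.knead
  obtain ⟨n, hn, hstep⟩ := hm.exists_step t
  rcases h.lo_succ n with h1 | ⟨-, h1, h2, hd⟩
  · exact absurd h1 hstep
  obtain ⟨l, l', hd'⟩ := (h.node_add n).exists_dnode
  obtain ⟨K, hK⟩ := exists_diff_eq_succ hd
  have hg := hd'.good hν
  have hlK : l ≤ K := by have := hg.lt; rw [hK] at this; norm_cast at this; omega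
  have hlK' : l' ≤ K := by have := hg.lt'; rw [hK] at this; norm_cast at this; omega
  have hnK : N + n ≤ K := by
    have := (h.node_add n).lt_diff hν
    rw [hK] at this
    norm_cast at this
    omega
  have hcn := hc (n + 1)
  rw [h1, h2] at hcn
  have := (hd'.resid (y := a) hν (T := K) (by rw [hK]; exact_mod_cast Nat.lt_succ_self K)
    fun i hi => hc n i (by rw [hK]; exact_mod_cast Nat.succ_lt_succ hi)).1 K
    (by have := hd'.one_le; omega) hlK hlK' le_rfl
  refine ⟨K, by omega, ?_⟩
  rw [this.eq, shift_iterate, zero_add, (hcn.of_right hK).2]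
  exact (differ_iff.1 (diff_eq_succ_iff.1 hK).1).2.2

theorem IsPath.frequently_cut_hi (hs : NoStar ν) {N : ℕ}
    {lo hi : ℕ → StarSeq A} (h : IsPath ν N lo hi) {a : StarSeq A}
    (hc : ∀ n, Cont (lo n) (hi n) a) (hm : Moving hi) (t : ℕ) :
    ∃ K ≥ t, chop ν ν a K 0 ≠ a K := by
  have hν := hs.knead
  obtain ⟨n, hn, hstep⟩ := hm.exists_step t
  rcases h.hi_succ n with h1 | ⟨-, h1, h2, hd⟩
  · exact absurd h1 hstep
  obtain ⟨l, l', hd'⟩ := (h.node_add n).exists_dnode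
  obtain ⟨K, hK⟩ := exists_diff_eq_succ hd
  have hg := hd'.good hν
  have hlK : l ≤ K := by have := hg.lt; rw [hK] at this; norm_cast at this; omega
  have hlK' : l' ≤ K := by have := hg.lt'; rw [hK] at this; norm_cast at this; omega
  have hnK : N + n ≤ K := by
    have := (h.node_add n).lt_diff hν
    rw [hK] at this
    norm_cast at this
    omega
  have hcn := hc (n + 1)
  rw [h1, h2] at hcn
  have := (hd'.resid (y := a) hν (T := K) (by rw [hK]; exact_mod_cast Nat.lt_succ_self K)
    fun i hi => hc n i (by rw [hK]; exact_mod_cast Nat.succ_lt_succ hi)).1 K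
    (by have := hd'.one_le; omega) hlK hlK' le_rfl
  refine ⟨K, by omega, ?_⟩
  rw [this.eq', shift_iterate, zero_add, (hcn.of_left hK).2]
  exact (differ_iff.1 (diff_eq_succ_iff.1 hK).1).2.2.symm

theorem chop_critPt_mem_orb (a : StarSeq A) (M : ℕ) : chop ν (critPt ν) a (M + 1) ∈ orb ν := by
  induction M with
  | zero =>
    by_cases h : chop ν (critPt ν) a 0 0 = a 0
    · rw [chop_succ_of_eq h]; exact ⟨0, rfl⟩
    · rw [chop_succ_of_ne h]; exact ⟨0, rfl⟩
  | succ M ih =>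
    by_cases h : chop ν (critPt ν) a (M + 1) 0 = a (M + 1)
    · rw [chop_succ_of_eq h]
      obtain ⟨i, hi⟩ := ih
      exact ⟨i + 1, by rw [hi, Function.iterate_succ_apply']⟩
    · rw [chop_succ_of_ne h]; exact ⟨0, rfl⟩

/-- The limit of nested pairs of neighbours is not a preimage of `ν`. -/
theorem IsPath.shift_ne (hs : NoStar ν) (hp : ν ∉ Function.periodicPts shift) {N : ℕ}
    {lo hi : ℕ → StarSeq A} (h : IsPath ν N lo hi) {a : StarSeq A}
    (hc : ∀ n, Cont (lo n) (hi n) a) (hm : Moving lo) (hm' : Moving hi) (M : ℕ) :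
    shift^[M] a ≠ ν := by
  intro hM
  have key : ∀ x, (x = critPt ν ∨ x ∈ orb ν) → (∀ t, ∃ K ≥ t, chop ν x a K 0 ≠ a K) →
      (chop ν x a M = critPt ν ∨ chop ν x a M ∈ orb ν) → Sync ν ν (critPt ν) (chop ν x a M) := by
    rintro x - hcut hx
    rcases hx with hx | ⟨i, hx⟩
    · rw [hx]; exact sync_critPt_self hs
    · rcases Nat.eq_zero_or_pos i with rfl | hi
      · obtain ⟨K, hK, hne⟩ := hcut M
        obtain ⟨t, rfl⟩ := Nat.exists_eq_add_of_le hK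
        rw [chop_add, hM, hx, Function.iterate_zero, id, chop_of_agree fun _ _ => rfl,
          shift_iterate, zero_add] at hne
        rw [← hM, shift_iterate, add_comm t M] at hne
        exact (hne rfl).elim
      · rw [hx]; exact sync_critPt hs hp hi
  have h0 : chop ν (critPt ν) a M = critPt ν ∨ chop ν (critPt ν) a M ∈ orb ν := by
    cases M with
    | zero => exact Or.inl rfl
    | succ M => exact Or.inr (chop_critPt_mem_orb a M)
  have s1 := key _ (Or.inl rfl) (h.frequently_cut_lo hs hc hm) h0
  have s2 := key _ (Or.inr (self_mem_orb ν)) (h.frequently_cut_hi hs hc hm')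
    (Or.inr (chop_mem_orb (self_mem_orb ν) _))
  -- Both descendants lie on the side of `⋆ν` at `ν`, so they are cut together, which a located
  -- sequence does not allow.
  obtain ⟨t, h1, h2⟩ := s1.symm.trans s2
  have h3 := (h.loc hc).notBoth hs.knead (M + t)
  unfold NotBoth at h3
  rw [chop_add, chop_add, hM] at h3
  have h4 : a (M + t) = ν t := by rw [← hM, shift_iterate, add_comm]
  rw [h4] at h3
  tauto

end


/-! ### Separations of the complement of the critical value -/

/-- `U` and `V` separate the complement of the critical value in the Hubbard tree. -/
structure Split (ν : StarSeq A) (U V : Set (Pt A)) : Prop where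
  cover : ∀ x ∈ hubbardSet ν, x ≠ Pt.itin ν → x ∈ U ∨ x ∈ V
  disj : ∀ x ∈ hubbardSet ν, x ≠ Pt.itin ν → ¬ (x ∈ U ∧ x ∈ V)

theorem Split.symm {ν : StarSeq A} {U V : Set (Pt A)} (h : Split ν U V) : Split ν V U :=
  ⟨fun x hx hne => (h.cover x hx hne).symm, fun x hx hne hc => h.disj x hx hne ⟨hc.2, hc.1⟩⟩

theorem iterate_mem_hubbardSet {ν : StarSeq A} {x : Pt A} (hx : x ∈ critPath ν) (j : ℕ) :
    Pt.shift^[j] x ∈ hubbardSet ν := mem_iUnion.2 ⟨j, mem_image_of_mem _ hx⟩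

theorem itin_mem_hubbardSet {ν a : StarSeq A} (h : a ∈ PInf ν ∪ L ν) (j : ℕ) :
    Pt.itin (shift^[j] a) ∈ hubbardSet ν := by
  rw [← shift_iterate_itin]
  exact iterate_mem_hubbardSet (Or.inl ⟨a, rfl, Or.inl h⟩) j

section

variable {ν : StarSeq A}

/-- A point inserted into a pair at step `k` or later has depth greater than `k`, and a moving end
is eventually such a point. -/
theorem eventually_lo_ne_none (hν : Knead ν) {N : ℕ} {lo hi : ℕ → StarSeq A}
    (h : IsPath ν N lo hi) (hm : Moving lo) (k : ℕ) : ∀ᶠ n in atTop, ∀ i < k, lo n i ≠ none := by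
  obtain ⟨n, hn, hstep⟩ := hm.exists_step k
  have key : ∀ m ≥ k, lo (m + 1) ≠ lo m → ∀ i < k, lo (m + 1) i ≠ none := by
    intro m hm hne i hi'
    obtain ⟨-, -, h1, hd⟩ := (h.lo_succ m).resolve_left hne
    obtain ⟨K, hK⟩ := exists_diff_eq_succ hd
    obtain ⟨l, l', hg⟩ := (h.node_add m).good hν
    have := h.lt_diff hν (n := m) (m := m) (by omega)
    rw [hK] at this
    norm_cast at this
    rw [h1]
    exact (hg.isWordStar_midpoint hK).1 i (by omega)
  filter_upwards [eventually_ge_atTop (n + 1)] with r hr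
  induction r, hr using Nat.le_induction with
  | base => exact key n hn hstep
  | succ r hr ih =>
    by_cases he : lo (r + 1) = lo r
    · rwa [he]
    · exact key r (by omega) he

theorem eventually_hi_ne_none (hν : Knead ν) {N : ℕ} {lo hi : ℕ → StarSeq A}
    (h : IsPath ν N lo hi) (hm : Moving hi) (k : ℕ) : ∀ᶠ n in atTop, ∀ i < k, hi n i ≠ none := by
  obtain ⟨n, hn, hstep⟩ := hm.exists_step k
  have key : ∀ m ≥ k, hi (m + 1) ≠ hi m → ∀ i < k, hi (m + 1) i ≠ none := by
    intro m hm hne i hi'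
    obtain ⟨-, -, h1, hd⟩ := (h.hi_succ m).resolve_left hne
    obtain ⟨K, hK⟩ := exists_diff_eq_succ hd
    obtain ⟨l, l', hg⟩ := (h.node_add m).good hν
    have := h.lt_diff hν (n := m) (m := m) (by omega)
    rw [hK] at this
    norm_cast at this
    rw [h1]
    exact (hg.isWordStar_midpoint hK).1 i (by omega)
  filter_upwards [eventually_ge_atTop (n + 1)] with r hr
  induction r, hr using Nat.le_induction with
  | base => exact key n hn hstep
  | succ r hr ih =>
    by_cases he : hi (r + 1) = hi r
    · rwa [he]
    · exact key r (by omega) he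

theorem NoStar.not_isStarPeriodic (hs : NoStar ν) : ¬ IsStarPeriodic ν := by
  intro h
  have hp := h.period_pos
  exact hs (period ν - 1) ((h.eq_none_iff _).2 (by rw [Nat.sub_add_cancel hp]))

theorem shift_mem_X_of_mem_X {a : StarSeq A} (h : a ∈ X ν) (j : ℕ) :
    shift^[j] a ∈ X ν := by
  rcases h with ⟨m, hm⟩ | ⟨k, rfl⟩ | ⟨h1, h2⟩
  · exact HasDepth.shift_mem_X (l := m + 1) hm j
  · exact Or.inr (Or.inl ⟨j + k, by rw [shift_iterate_add]⟩)
  · rcases Nat.eq_zero_or_pos j with rfl | hj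
    · exact Or.inr (Or.inr ⟨h1, h2⟩)
    · refine Or.inr (Or.inr ⟨fun i => by rw [shift_iterate]; exact h1 _, fun m hm => ?_⟩)
      rw [shift_iterate_add]
      exact h2 _ (by omega)

/-- Reaching `ν` again after the depth would make `ν` periodic; reaching it earlier would leave a
`⋆` in `ν`. -/
theorem HasDepth.eq_of_shift_eq (hs : NoStar ν) (hp : ν ∉ Function.periodicPts shift) {l j : ℕ}
    {a : StarSeq A} (h : HasDepth ν l a) (hj : shift^[j] a = ν) : l = j := by
  rcases lt_trichotomy l j with hlt | rfl | hlt
  · refine (hp (isPeriodic_of_shift_eq (n := j - l) (by omega) ?_)).elim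
    rw [← h.shift_eq, shift_iterate_add, Nat.sub_add_cancel hlt.le, hj]
    exact h.shift_eq.symm
  · rfl
  · have := h.apply_self (by omega)
    rw [show l - 1 = (l - 1 - j) + j by omega, ← shift_iterate a, hj] at this
    exact (hs _ this).elim

theorem exists_mem_of_mem_hubbardSet (hs : NoStar ν) (hp : ν ∉ Function.periodicPts shift)
    {x : Pt A} (hx : x ∈ hubbardSet ν) :
    ∃ j a, a ∈ PInf ν ∪ L ν ∧ x = Pt.itin (shift^[j] a) := by
  obtain ⟨j, y, hy, rfl⟩ := mem_iUnion.1 hx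
  rcases hy with ⟨a, rfl, ha⟩ | ⟨a, c, t, rfl, ha⟩
  · refine ⟨j, a, ?_, shift_iterate_itin j a⟩
    rcases ha with ha | ⟨c, c', ⟨⟨n, hn⟩, hd⟩, -⟩
    · exact ha
    · obtain ⟨l, l', hg⟩ := Node.good hs.knead (n := n) hn
      exact (hg.diff_ne_top hs hp hd).elim
  · exact (hs.not_isStarPeriodic ha.1).elim

end

/-- Open sets which separate the complement of the critical value, in the non-periodic case. -/
structure OpenSplit (ν : StarSeq A) (U V : Set (Pt A)) : Prop extends Split ν U V where
  noStar : NoStar ν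
  notPer : ν ∉ Function.periodicPts shift
  isOpen : IsOpen[TopologicalSpace.coinduced (fun a : X ν => Pt.itin a.1) (topologyX ν)] U
  isOpen' : IsOpen[TopologicalSpace.coinduced (fun a : X ν => Pt.itin a.1) (topologyX ν)] V

namespace OpenSplit

variable {ν : StarSeq A} {U V : Set (Pt A)}

/-- Away from `ν` the point `x` lies in one of the two open sets, which then contains the tail of
the sequence. The equivalence serves both possibilities at once. -/
theorem eventually_iff (h : OpenSplit ν U V) {x : StarSeq A} (hx : x ∈ X ν)
    (hxH : Pt.itin x ∈ hubbardSet ν) (hxν : x ≠ ν) {u : ℕ → StarSeq A} (hu : ∀ n, u n ∈ X ν)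
    (huH : ∀ n, Pt.itin (u n) ∈ hubbardSet ν) (huν : ∀ᶠ n in atTop, u n ≠ ν)
    (h1 : ∀ k : ℕ, ∀ᶠ n in atTop, (k : ℕ∞) ≤ diff x (u n))
    (h2 : ∀ k : ℕ, ∀ᶠ n in atTop, ∀ i < k, u n i ≠ none) :
    ∀ᶠ n in atTop, (Pt.itin (u n) ∈ U ↔ Pt.itin x ∈ U) := by
  have h2' : ∀ k : ℕ, ∀ᶠ n in atTop, ∀ m, IsWordStar ν m (u n) → k ≤ m + 1 := by
    intro k
    filter_upwards [h2 k] with n hn m hm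
    by_contra! hlt
    exact hn m (by omega) hm.2.1
  by_cases hxU : Pt.itin x ∈ U
  · filter_upwards [eventually_mem_of_isOpen h.noStar hx h.isOpen hxU hu h1 h2'] with n hn
    simp [hn, hxU]
  · have hxV := (h.cover _ hxH (by simpa using hxν)).resolve_left hxU
    filter_upwards [eventually_mem_of_isOpen h.noStar hx h.isOpen' hxV hu h1 h2', huν]
      with n hn hne
    simp only [hxU, iff_false]
    exact fun hc => h.disj _ (huH n) (by simpa using hne) ⟨hc, hn⟩

/-- If the ends were separated, the midpoint would be separated from one of them. Repeating this
gives nested separated pairs that close up at a limit itinerary or at a stationary end, where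
openness is violated. The bound `j ≤ N` keeps the images of inserted points away from `ν`. -/
theorem node_iff (h : OpenSplit ν U V) {j N : ℕ} (hjN : j ≤ N) {e e' : StarSeq A}
    (hn : Node ν N e e') (he : shift^[j] e ≠ ν) (he' : shift^[j] e' ≠ ν) :
    Pt.itin (shift^[j] e) ∈ U ↔ Pt.itin (shift^[j] e') ∈ U := by
  by_contra hcon
  have hν := h.noStar.knead
  obtain ⟨lo, hi, hpath, -, -, hQ⟩ := exists_path (Q := fun e e' => shift^[j] e ≠ ν ∧
    shift^[j] e' ≠ ν ∧ ¬ (Pt.itin (shift^[j] e) ∈ U ↔ Pt.itin (shift^[j] e') ∈ U)) hn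
    ⟨he, he', hcon⟩ (by
      rintro n f f' hNn hf ⟨h1, h2, h3⟩
      obtain ⟨l, l', hg⟩ := hf.good hν
      have hd := hg.diff_ne_top h.noStar h.notPer
      obtain ⟨K, hK⟩ := exists_diff_eq_succ hd
      have hnK := hf.lt_diff hν
      rw [hK] at hnK
      norm_cast at hnK
      have hm : shift^[j] (midpoint ν f f') ≠ ν := by
        intro hm
        apply h.noStar (K - j)
        rw [← hm, shift_iterate, Nat.sub_add_cancel (by omega), midpoint_self hK]
      by_cases hc : Pt.itin (shift^[j] f) ∈ U ↔ Pt.itin (shift^[j] (midpoint ν f f')) ∈ U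
      · exact ⟨_, _, Or.inr ⟨hd, Or.inr ⟨rfl, rfl⟩⟩, hm, h2, by rwa [← hc]⟩
      · exact ⟨_, _, Or.inr ⟨hd, Or.inl ⟨rfl, rfl⟩⟩, h1, hm, hc⟩)
  have hloP : ∀ n, lo n ∈ PInf ν := fun n => ⟨_, (hpath.node_add n).mem_left⟩
  have hhiP : ∀ n, hi n ∈ PInf ν := fun n => ⟨_, (hpath.node_add n).mem_right⟩
  have hPX : ∀ q ∈ PInf ν, shift^[j] q ∈ X ν := by
    rintro q ⟨n, hq⟩
    obtain ⟨l, hl⟩ := exists_hasDepth hν hq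
    exact hl.shift_mem_X j
  have hPH : ∀ q ∈ PInf ν, Pt.itin (shift^[j] q) ∈ hubbardSet ν := fun q hq =>
    itin_mem_hubbardSet (Or.inl hq) j
  have hdiff : ∀ {x y : StarSeq A} {k : ℕ}, ((k + j : ℕ) : ℕ∞) < diff x y →
      (k : ℕ∞) ≤ diff (shift^[j] x) (shift^[j] y) := by
    intro x y k hk
    rw [le_diff_iff] at hk
    refine le_diff_iff'.2 fun i hi => ?_
    rw [shift_iterate, shift_iterate]
    exact hk _ (by omega)
  have hstar : ∀ {u : ℕ → StarSeq A}, (∀ k, ∀ᶠ n in atTop, ∀ i < k, u n i ≠ none) →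
      ∀ k, ∀ᶠ n in atTop, ∀ i < k, shift^[j] (u n) i ≠ none := by
    intro u hu k
    filter_upwards [hu (k + j)] with n hn i hi
    rw [shift_iterate]
    exact hn _ (by omega)
  -- Two stationary ends would be neighbours of infinite difference, that is, a gap.
  have hnotboth : ∀ M, (∀ m ≥ M, lo m = lo M) → (∀ m ≥ M, hi m = hi M) → False := by
    intro M h1 h2
    obtain ⟨l, l', hg⟩ := (hpath.node_add M).good hν
    refine hg.diff_ne_top h.noStar h.notPer ?_
    refine WithTop.eq_top_iff_forall_gt.2 fun k => ?_
    have := hpath.lt_diff hν (n := k) (m := k + M) (by omega)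
    rwa [h1 _ (by omega), h2 _ (by omega)] at this
  by_cases hlo : Moving lo
  · have hlo' := eventually_lo_ne_none hν hpath hlo
    by_cases hhi : Moving hi
    · have hhi' := eventually_hi_ne_none hν hpath hhi
      have hc := hpath.cont_pathLimit hν
      set a := pathLimit lo hi
      have hne := hpath.shift_ne h.noStar h.notPer hc hlo hhi
      have ha : NoStar a := hpath.noStar_pathLimit hν
      have haX : a ∈ X ν := Or.inr (Or.inr ⟨ha, fun m _ => hne m⟩)
      have haL : a ∈ L ν := ⟨haX, ha, hpath.exists_convergesTo hν hc (Or.inl hlo)⟩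
      have e1 := h.eventually_iff (shift_mem_X_of_mem_X haX j)
        (itin_mem_hubbardSet (Or.inr haL) j) (hne j) (fun n => hPX _ (hloP n))
        (fun n => hPH _ (hloP n)) (Eventually.of_forall fun n => (hQ n).1) (fun k => by
          filter_upwards [eventually_ge_atTop (k + j)] with n hn
          refine hdiff ?_
          rw [diff_comm]
          exact (hc n).lt_diff_left (hpath.lt_diff hν (by omega))) (hstar hlo')
      have e2 := h.eventually_iff (shift_mem_X_of_mem_X haX j)
        (itin_mem_hubbardSet (Or.inr haL) j) (hne j) (fun n => hPX _ (hhiP n))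
        (fun n => hPH _ (hhiP n)) (Eventually.of_forall fun n => (hQ n).2.1) (fun k => by
          filter_upwards [eventually_ge_atTop (k + j)] with n hn
          refine hdiff ?_
          rw [diff_comm]
          exact (hc n).lt_diff_right (hpath.lt_diff hν (by omega))) (hstar hhi')
      obtain ⟨n, h1, h2⟩ := (e1.and e2).exists
      exact (hQ n).2.2 (h1.trans h2.symm)
    · obtain ⟨M, hM⟩ := exists_const_of_not_moving hhi
      have e1 := h.eventually_iff (hPX _ (hhiP M)) (hPH _ (hhiP M)) (hQ M).2.1
        (fun n => hPX _ (hloP n)) (fun n => hPH _ (hloP n))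
        (Eventually.of_forall fun n => (hQ n).1) (fun k => by
          filter_upwards [eventually_ge_atTop (k + j), eventually_ge_atTop M] with n hn hn'
          refine hdiff ?_
          rw [diff_comm, ← hM n hn']
          exact hpath.lt_diff hν (by omega)) (hstar hlo')
      obtain ⟨n, h1, h2⟩ := (e1.and (eventually_ge_atTop M)).exists
      refine (hQ n).2.2 ?_
      rw [h1, hM n h2]
  · obtain ⟨M, hM⟩ := exists_const_of_not_moving hlo
    have hhi : Moving hi := by
      by_contra hhi
      obtain ⟨M', hM'⟩ := exists_const_of_not_moving hhi
      refine hnotboth (max M M') (fun m hm => ?_) fun m hm => ?_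
      · rw [hM m ((le_max_left _ _).trans hm), hM _ (le_max_left _ _)]
      · rw [hM' m ((le_max_right _ _).trans hm), hM' _ (le_max_right _ _)]
    have hhi' := eventually_hi_ne_none hν hpath hhi
    have e1 := h.eventually_iff (hPX _ (hloP M)) (hPH _ (hloP M)) (hQ M).1
      (fun n => hPX _ (hhiP n)) (fun n => hPH _ (hhiP n))
      (Eventually.of_forall fun n => (hQ n).2.1) (fun k => by
        filter_upwards [eventually_ge_atTop (k + j), eventually_ge_atTop M] with n hn hn'
        refine hdiff ?_
        rw [← hM n hn']
        exact hpath.lt_diff hν (by omega)) (hstar hhi')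
    obtain ⟨n, h1, h2⟩ := (e1.and (eventually_ge_atTop M)).exists
    refine (hQ n).2.2 ?_
    rw [h1, hM n h2]

/-- Here `c` has depth `j`, so `σ^j c = ν`. By `DNode.sync` the image of `b` is on the side of `⋆ν`,
and the common cut at time `T` yields the point `prefixPt ν T` of `P_∞`, which is in `U`. Moving `b`
closer to `c` eventually makes an image equal to this point. -/
theorem mem_of_dnode (h : OpenSplit ν U V)
    (h0 : ∀ q ∈ PInf ν, q ≠ ν → Pt.itin q ∈ U) {n j l' : ℕ} {c b : StarSeq A}
    (hd : DNode ν n j l' c b) (hjn : j ≤ n) : Pt.itin (shift^[j] b) ∈ U := by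
  have hs := h.noStar
  have hν := hs.knead
  obtain ⟨T, hT1, hT2⟩ := (hd.sync hs h.notPer).1
  have hpre : Pt.itin (prefixPt ν T) ∈ U := by
    refine h0 _ (prefixPt_mem_PInf hs hT1) fun he => ?_
    apply hs T
    rw [← he]
    exact (isWordStar_prefixPt hs T).2.1
  have hne : ∀ {n l' c b}, DNode ν n j l' c b → shift^[j] b ≠ ν := by
    intro n l' c b hd he
    have hg := hd.good hν
    exact hg.ne (hg.depth'.eq_of_shift_eq hs h.notPer he).symm
  obtain ⟨r, hr⟩ : ∃ r, r = T + j + 1 - n := ⟨_, rfl⟩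
  induction r using Nat.strong_induction_on generalizing n l' b with
  | _ r ih =>
    have hg := hd.good hν
    obtain ⟨K, hK⟩ := exists_diff_eq_succ (hg.diff_ne_top hs h.notPer)
    have hnK := hd.node.lt_diff hν
    rw [hK] at hnK
    norm_cast at hnK
    have hKd : ((K : ℕ) : ℕ∞) < diff c b := by rw [hK]; exact_mod_cast Nat.lt_succ_self K
    have hagree : ∀ i, i + j ≤ K → ¬ Differ (ν i) (b (i + j)) ∨ i + j = K := by
      intro i hi
      rcases Nat.lt_or_ge (i + j) K with hlt | hge
      · left
        rw [← hg.depth.apply_add]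
        exact le_diff_iff.1 hKd _ hlt
      · right; omega
    -- The cut falls at index `T + j` of `b`. Before `K` it can only be the `⋆` of `b`, so `σ^j b`
    -- is the prefix point; at `K` the midpoint has this role; after `K` the midpoint is cut at the
    -- same `T` and replaces `b` at the next level.
    rcases lt_trichotomy (T + j) K with hlt | heq | hgt
    · have h1 : b (T + j) = none := by
        rw [hg.chop_eq hs (lt_trans (by exact_mod_cast hlt) hKd), shift_iterate, zero_add] at hT2
        have h2 := (hagree T hlt.le).resolve_right (by omega)
        rw [not_differ_iff] at h2
        rcases h2 with h2 | h2 | h2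
        · exact (hs T h2).elim
        · exact h2
        · exact (hT2 h2.symm).elim
      have hl' := hg.depth'.eq_of_eq_none hs h1
      rw [eq_prefixPt (a := shift^[j] b) (T := T)]
      · exact hpre
      · intro i hi
        rw [shift_iterate]
        have h2 := (hagree i (by omega)).resolve_right (by omega)
        rw [not_differ_iff] at h2
        rcases h2 with h2 | h2 | h2
        · exact (hs _ h2).elim
        · have := hg.depth'.eq_of_eq_none hs h2
          omega
        · exact h2.symm
      · rw [shift_iterate, h1]
      · rw [shift_iterate_add, show T + 1 + j = l' by omega, hg.depth'.shift_eq]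
    · have hm : shift^[j] (midpoint ν c b) = prefixPt ν T := by
        refine eq_prefixPt (fun i hi => ?_) ?_ ?_
        · rw [shift_iterate, midpoint_of_lt hK (by omega), hg.depth.apply_add]
          cases hνi : ν i with
          | none => exact (hs _ hνi).elim
          | some x => rfl
        · rw [shift_iterate, heq, midpoint_self hK]
        · rw [shift_iterate_add, show T + 1 + j = K + 1 by omega, shift_midpoint hK]
      refine (h.node_iff (N := n + 1) (by omega) (hd.right hK).node ?_ (hne hd)).1 (hm ▸ hpre)
      exact hne (hd.left hK)
    · have hs1 := hg.sync_midpoint hs hK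
      have hlK : j ≤ K := by omega
      have heq := chop_eq_of_cut hs1.1 hs1.2 (m := T) (by omega)
      rw [heq] at hT2
      have := ih (T + j + 1 - (n + 1)) (by omega) (hd.left hK) (by omega) hT2 rfl
      exact (h.node_iff (N := n + 1) (by omega) (hd.right hK).node (hne (hd.left hK))
        (hne hd)).1 this

/-- Along a list `P_n` with `n ≥ j`, a walk from the left end cannot pass from `U` to `V`: ordinary
neighbours are not separated, and after a point with image `ν` the walk resumes in `U`. -/
theorem mem_of_mem_PInf (h : OpenSplit ν U V) (h0 : Pt.itin (critPt ν) ∈ U) (j : ℕ) :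
    ∀ q ∈ PInf ν, shift^[j] q ≠ ν → Pt.itin (shift^[j] q) ∈ U := by
  have hs := h.noStar
  have hν := hs.knead
  induction j using Nat.strong_induction_on with
  | _ j ih =>
    rintro q ⟨n₀, hq⟩ hqν
    by_contra hcon
    have hq := mem_P_of_le (le_max_left n₀ j) hq
    set n := max n₀ j
    have hjn : j ≤ n := le_max_right _ _
    obtain ⟨x, y, hxy, hx, hy⟩ := exists_node_of_critPt
      (Q := fun y => shift^[j] y = ν ∨ Pt.itin (shift^[j] y) ∈ U) n (by
        cases j with
        | zero => exact Or.inr h0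
        | succ j =>
          by_cases he : shift^[j + 1] (critPt ν) = ν
          · exact Or.inl he
          · right
            -- The image of the left end under `σ^(j+1)` is that of the right end under `σ^j`, which
            -- the induction hypothesis covers.
            have h1 : shift^[j + 1] (critPt ν) = shift^[j] ν := by
              rw [Function.iterate_succ_apply, shift_critPt]
            rw [h1] at he ⊢
            exact ih j (Nat.lt_succ_self j) ν ⟨0, self_mem_P ν 0⟩ he)
      ⟨q, hq, by tauto⟩
    push Not at hy
    by_cases hxν : shift^[j] x = ν
    · obtain ⟨l, l', hd⟩ := hxy.exists_dnode
      have hl := (hd.good hν).depth.eq_of_shift_eq hs h.notPer hxν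
      subst hl
      refine hy.2 (h.mem_of_dnode (fun q hq hne => ?_) hd hjn)
      exact ih 0 hd.one_le q hq hne
    · exact hy.2 ((h.node_iff hjn hxy hxν hy.1).1 (hx.resolve_left hxν))

theorem mem_of_mem_hubbardSet (h : OpenSplit ν U V) (h0 : Pt.itin (critPt ν) ∈ U) {x : Pt A}
    (hx : x ∈ hubbardSet ν) (hxν : x ≠ Pt.itin ν) : x ∈ U := by
  have hs := h.noStar
  have hν := hs.knead
  obtain ⟨j, a, ha | ha, rfl⟩ := exists_mem_of_mem_hubbardSet hs h.notPer hx
  · exact h.mem_of_mem_PInf h0 j a ha (by simpa using hxν)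
  · obtain ⟨haX, haS, u, hu⟩ := ha
    have hn : ∀ n, shift^[j] (u n) ≠ ν ∨ u n ∈ P ν j := by
      intro n
      by_contra! hc
      obtain ⟨m, hm⟩ := hu.mem_PInf n
      obtain ⟨l, hl⟩ := exists_hasDepth hν hm
      have := hl.eq_of_shift_eq hs h.notPer hc.1
      subst this
      rcases Nat.eq_zero_or_pos l with rfl | hpos
      · exact hc.2 ((show u n = ν from hl) ▸ self_mem_P ν 0)
      · exact ne_none_of_notMem hν ⟨m, hm⟩ hc.2 (Nat.sub_lt hpos one_pos) (hl.apply_self hpos)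
    have hev : ∀ᶠ n in atTop, shift^[j] (u n) ≠ ν := by
      filter_upwards [hu.eventually_notMem hν j] with n h1
      exact (hn n).resolve_right h1
    have e1 := h.eventually_iff (shift_mem_X_of_mem_X haX j) hx (by simpa using hxν)
      (u := fun n => shift^[j] (u n)) (fun n => by
        obtain ⟨m, hm⟩ := hu.mem_PInf n
        obtain ⟨l, hl⟩ := exists_hasDepth hν hm
        exact hl.shift_mem_X j)
      (fun n => itin_mem_hubbardSet (Or.inl (hu.mem_PInf n)) j) hev
      (fun k => by
        filter_upwards [eventually_lt_of_tendsto hu.2 (k + j)] with n hn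
        rw [diff_comm, le_diff_iff] at hn
        refine le_diff_iff'.2 fun i hi => ?_
        rw [shift_iterate, shift_iterate]
        exact hn _ (by omega))
      (fun k => by
        filter_upwards [hu.eventually_notMem hν (k + j)] with n hn i hi
        rw [shift_iterate]
        exact ne_none_of_notMem hν (hu.mem_PInf n) hn (by omega))
    obtain ⟨n, h1, h2⟩ := (e1.and hev).exists
    exact h1.1 (h.mem_of_mem_PInf h0 j _ (hu.mem_PInf n) h2)

end OpenSplit


/-! ### The order on the critical path -/

/-- The weak order on `P_∞`. -/
def PLE (ν a b : StarSeq A) : Prop := a = b ∨ PLT ν a b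

section

variable {ν : StarSeq A}

theorem PLE.trans (hν : Knead ν) {a b c : StarSeq A} (h : PLE ν a b) (h' : PLE ν b c) :
    PLE ν a c := by
  rcases h with rfl | h
  · exact h'
  · rcases h' with rfl | h'
    · exact Or.inr h
    · exact Or.inr (h.trans hν h')

theorem PLE.trans_plt (hν : Knead ν) {a b c : StarSeq A} (h : PLE ν a b) (h' : PLT ν b c) :
    PLT ν a c := by
  rcases h with rfl | h
  · exact h'
  · exact h.trans hν h'

theorem PLT.trans_ple (hν : Knead ν) {a b c : StarSeq A} (h : PLT ν a b) (h' : PLE ν b c) :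
    PLT ν a c := by
  rcases h' with rfl | h'
  · exact h
  · exact h.trans hν h'

theorem PLE.not_plt (hν : Knead ν) {a b : StarSeq A} (h : PLE ν a b) : ¬ PLT ν b a := fun h' =>
  PLT.irrefl hν _ (h.trans_plt hν h')

theorem PLE.antisymm (hν : Knead ν) {a b : StarSeq A} (h : PLE ν a b) (h' : PLE ν b a) :
    a = b := by
  rcases h' with rfl | h'
  · rfl
  · exact (h.not_plt hν h').elim

theorem ple_or_plt (hν : Knead ν) {a b : StarSeq A} (ha : a ∈ PInf ν) (hb : b ∈ PInf ν) :
    PLE ν a b ∨ PLT ν b a := by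
  rcases PLT.trichotomy hν ha hb with h | h | h
  exacts [Or.inl (Or.inr h), Or.inl (Or.inl h), Or.inr h]

theorem Node.ple_or_ple (hν : Knead ν) {n : ℕ} {e e' : StarSeq A} (h : Node ν n e e')
    {q : StarSeq A} (hq : q ∈ P ν n) : PLE ν q e ∨ PLE ν e' q := by
  rcases h.cases hν hq with (h | h) | h | h
  exacts [Or.inl (Or.inl h), Or.inl (Or.inr h), Or.inr (Or.inl h.symm), Or.inr (Or.inr h)]

theorem IsPath.lo_ple (hν : Knead ν) {N : ℕ} {lo hi : ℕ → StarSeq A} (h : IsPath ν N lo hi)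
    {n m : ℕ} (hnm : n ≤ m) : PLE ν (lo n) (lo m) := (h.lo_le hν hnm).imp_left Eq.symm

theorem IsPath.hi_ple (hν : Knead ν) {N : ℕ} {lo hi : ℕ → StarSeq A} (h : IsPath ν N lo hi)
    {n m : ℕ} (hnm : n ≤ m) : PLE ν (hi m) (hi n) := h.hi_le hν hnm

/-! ### Cuts of `P_∞` defined by itineraries -/

/-- The points of `P_∞` to the left of a point `a` that is not in `P_∞`. -/
def Below (ν a : StarSeq A) : Set (StarSeq A) :=
  {p | ∃ n e e', Node ν n e e' ∧ Cont e e' a ∧ p ∈ P ν n ∧ PLE ν p e}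

theorem below_subset {a : StarSeq A} : Below ν a ⊆ PInf ν := fun _ ⟨n, _, _, _, _, h, _⟩ => ⟨n, h⟩

theorem IsPath.node_zero_add {lo hi : ℕ → StarSeq A} (h : IsPath ν 0 lo hi) (n : ℕ) :
    Node ν n (lo n) (hi n) := by simpa using h.node_add n

theorem IsPath.mem_below_iff (hν : Knead ν) {lo hi : ℕ → StarSeq A} (h : IsPath ν 0 lo hi)
    {a p : StarSeq A} (hc : ∀ n, Cont (lo n) (hi n) a) (hp : p ∈ PInf ν) :
    p ∈ Below ν a ↔ ∃ n, PLE ν p (lo n) := by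
  constructor
  · rintro ⟨n, e, e', hn, hc', -, hle⟩
    obtain ⟨rfl, rfl⟩ := hn.eq_of_cont (h.node_zero_add n) hc' (hc n)
    exact ⟨n, hle⟩
  · rintro ⟨n, hle⟩
    obtain ⟨m, hm⟩ := hp
    exact ⟨max n m, _, _, h.node_zero_add _, hc _, mem_P_of_le (le_max_right n m) hm,
      hle.trans hν (h.lo_ple hν (le_max_left n m))⟩

theorem IsPath.notMem_below_iff (hν : Knead ν) {lo hi : ℕ → StarSeq A} (h : IsPath ν 0 lo hi)
    {a p : StarSeq A} (hc : ∀ n, Cont (lo n) (hi n) a) (hp : p ∈ PInf ν) :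
    p ∉ Below ν a ↔ ∃ n, PLE ν (hi n) p := by
  rw [h.mem_below_iff hν hc hp]
  constructor
  · intro hcon
    obtain ⟨m, hm⟩ := hp
    rcases (h.node_zero_add m).ple_or_ple hν hm with h1 | h1
    · exact (hcon ⟨m, h1⟩).elim
    · exact ⟨m, h1⟩
  · rintro ⟨n, hn⟩ ⟨m, hm⟩
    have h1 := ((h.hi_ple hν (le_max_left n m)).trans hν hn).trans hν
      (hm.trans hν (h.lo_ple hν (le_max_right n m)))
    exact h1.not_plt hν (h.node_zero_add _).plt

theorem mem_below_of_ple (hν : Knead ν) {a p q : StarSeq A} (ha : Loc ν a) (hp : p ∈ PInf ν)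
    (hpq : PLE ν p q) (hq : q ∈ Below ν a) : p ∈ Below ν a := by
  obtain ⟨lo, hi, h, hc⟩ := ha.exists_path
  rw [h.mem_below_iff hν hc (below_subset hq)] at hq
  rw [h.mem_below_iff hν hc hp]
  exact hq.imp fun n hn => hpq.trans hν hn

/-- Equal cuts single out the same pair of neighbours at every level, and these pairs determine all
the symbols. -/
theorem Loc.eq_of_below_eq (hν : Knead ν) {a a' : StarSeq A} (ha : Loc ν a) (ha' : Loc ν a')
    (hb : Below ν a = Below ν a') : a = a' := by
  obtain ⟨lo, hi, h, hc⟩ := ha.exists_path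
  obtain ⟨lo', hi', h', hc'⟩ := ha'.exists_path
  have key : ∀ {a a' : StarSeq A} {lo hi lo' hi' : ℕ → StarSeq A}, IsPath ν 0 lo hi →
      IsPath ν 0 lo' hi' → (∀ n, Cont (lo n) (hi n) a) → (∀ n, Cont (lo' n) (hi' n) a') →
      Below ν a = Below ν a' → ∀ n, PLE ν (lo n) (lo' n) ∧ PLE ν (hi' n) (hi n) := by
    intro a a' lo hi lo' hi' h h' hc hc' hb n
    have hl : lo n ∈ Below ν a := (h.mem_below_iff hν hc ⟨n, (h.node_zero_add n).mem_left⟩).2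
      ⟨n, Or.inl rfl⟩
    have hr : hi n ∉ Below ν a := (h.notMem_below_iff hν hc ⟨n, (h.node_zero_add n).mem_right⟩).2
      ⟨n, Or.inl rfl⟩
    rw [hb] at hl hr
    constructor
    · refine ((h'.node_zero_add n).ple_or_ple hν (h.node_zero_add n).mem_left).resolve_right ?_
      intro h1
      exact (h'.notMem_below_iff hν hc' (below_subset hl)).2 ⟨n, h1⟩ hl
    · refine ((h'.node_zero_add n).ple_or_ple hν (h.node_zero_add n).mem_right).resolve_left ?_
      intro h1
      exact hr ((h'.mem_below_iff hν hc' ⟨n, (h.node_zero_add n).mem_right⟩).2 ⟨n, h1⟩)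
  funext i
  have k1 := key h h' hc hc' hb (i + 1)
  have k2 := key h' h hc' hc hb.symm (i + 1)
  have e1 := k1.1.antisymm hν k2.1
  have e2 := k1.2.antisymm hν k2.2
  have hlt := h.lt_diff hν (n := i + 1) (m := i + 1) (by omega)
  rw [hc (i + 1) i hlt, hc' (i + 1) i (by rw [← e1, e2]; exact hlt), e1, e2]

/-- A point of `P_∞` whose itinerary is compatible with that of `a` is not separated from `a`. -/
theorem IsPath.ple_and_ple (hν : Knead ν) {lo hi : ℕ → StarSeq A} (h : IsPath ν 0 lo hi)
    {a c : StarSeq A} (hc : ∀ n, Cont (lo n) (hi n) a) (hcP : c ∈ PInf ν) (hd : diff a c = ⊤)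
    (n : ℕ) : PLE ν (lo n) c ∧ PLE ν c (hi n) := by
  induction n with
  | zero =>
    obtain ⟨h1, h2⟩ := node_zero h.node
    rw [h1, h2]
    have := plt_ends hcP
    exact ⟨this.1.imp_left Eq.symm, this.2⟩
  | succ n ih =>
    rcases h.step n with ⟨_, h1, h2⟩ | ⟨hd', h12⟩
    · rwa [h1, h2]
    obtain ⟨K, hK⟩ := exists_diff_eq_succ hd'
    have hdK := differ_iff.1 (diff_eq_succ_iff.1 hK).1
    have hn := h.node_zero_add n
    have hmid : midpoint ν (lo n) (hi n) ∈ PInf ν := ⟨_, (hn.left hd').mem_right⟩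
    have hcomp : ¬ Differ (a K) (c K) := diff_eq_top_iff.1 hd K
    have hl : PLT ν c (midpoint ν (lo n) (hi n)) → c K = lo n K := by
      intro hlt
      rcases ih.1 with h3 | h3
      · rw [h3]
      · exact (((hn.left hd').inside hν h3 hlt).of_left hd').2 K hK
    have hr : PLT ν (midpoint ν (lo n) (hi n)) c → c K = hi n K := by
      intro hlt
      rcases ih.2 with h3 | h3
      · rw [h3]
      · exact (((hn.right hd').inside hν hlt h3).of_right hd').2 K hK
    have hcn := hc (n + 1)
    rcases h12 with ⟨h1, h2⟩ | ⟨h1, h2⟩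
    · rw [h1, h2] at hcn ⊢
      refine ⟨ih.1, (ple_or_plt hν hcP hmid).resolve_right fun hlt => ?_⟩
      apply hcomp
      rw [differ_iff, (hcn.of_left hK).2, hr hlt]
      exact hdK
    · rw [h1, h2] at hcn ⊢
      refine ⟨(ple_or_plt hν hmid hcP).resolve_right fun hlt => ?_, ih.2⟩
      apply hcomp
      rw [differ_iff, (hcn.of_right hK).2, hl hlt]
      exact ⟨hdK.2.1, hdK.1, hdK.2.2.symm⟩

theorem mem_below_iff_of_diff_eq_top (hν : Knead ν) {a c : StarSeq A} (hl : Loc ν a)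
    (hcP : c ∈ PInf ν) (hd : diff a c = ⊤) {p : StarSeq A} (hp : p ∈ PInf ν) :
    (c ∈ Below ν a → (p ∈ Below ν a ↔ PLE ν p c)) ∧
      (c ∉ Below ν a → (p ∈ Below ν a ↔ PLT ν p c)) := by
  obtain ⟨lo, hi, h, hc⟩ := hl.exists_path
  have hadj := h.ple_and_ple hν hc hcP hd
  refine ⟨fun hcb => ⟨fun hpb => ?_, fun hle => mem_below_of_ple hν hl hp hle hcb⟩,
    fun hcb => ⟨fun hpb => ?_, fun hlt => ?_⟩⟩
  · rw [h.mem_below_iff hν hc hp] at hpb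
    obtain ⟨n, hn⟩ := hpb
    exact hn.trans hν (hadj n).1
  · rcases ple_or_plt hν hcP hp with h1 | h1
    · exact (hcb (mem_below_of_ple hν hl hcP h1 hpb)).elim
    · exact h1
  · by_contra hpb
    rw [h.notMem_below_iff hν hc hp] at hpb
    obtain ⟨n, hn⟩ := hpb
    exact ((hadj n).2.trans hν hn).not_plt hν hlt

/-- Since `P_N` is finite, a uniform number of symbols decides in which of its pairs of neighbours a
sequence lies. -/
theorem exists_diff_bound (ν : StarSeq A) (N : ℕ) : ∃ B : ℕ, ∀ e ∈ P ν N, ∀ e' ∈ P ν N, ∀ K : ℕ,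
    diff e e' = ((K + 1 : ℕ) : ℕ∞) → K ≤ B := by
  classical
  let S : Finset (StarSeq A × StarSeq A) := (P ν N).toFinset ×ˢ (P ν N).toFinset
  refine ⟨S.sup fun x => (diff x.1 x.2).toNat, fun e he e' he' K hK => ?_⟩
  have := Finset.le_sup (f := fun x : StarSeq A × StarSeq A => (diff x.1 x.2).toNat)
    (b := (e, e')) (s := S) (by simp [S, he, he'])
  simp only [hK, ENat.toNat_natCast] at this
  omega

theorem ConvergesTo.eventually_node (hν : Knead ν) {u : ℕ → StarSeq A} {a : StarSeq A}
    (h : ConvergesTo ν u a) (ha : NoStar a) (N : ℕ) :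
    ∀ᶠ m in atTop, ∃ e e', Node ν N e e' ∧ Cont e e' a ∧ PLT ν e (u m) ∧ PLT ν (u m) e' := by
  obtain ⟨B, hB⟩ := exists_diff_bound ν N
  filter_upwards [h.eventually_notMem hν N, eventually_lt_of_tendsto h.2 B] with m hm hd
  obtain ⟨e, e', hn, h1, h2⟩ := exists_node_of_notMem hν (h.mem_PInf m) hm
  refine ⟨e, e', hn, fun i hi => ?_, h1, h2⟩
  obtain ⟨l, l', hg⟩ := hn.good hν
  have hin := hn.inside hν h1 h2
  -- A point strictly inside a gap would have no `⋆`. The only candidate in `P_∞` is `ν`, but it is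
  -- the right end of the path.
  have htop : diff e e' ≠ ⊤ := by
    intro htop
    obtain ⟨j, hj⟩ := h.mem_PInf m
    obtain ⟨l, hl⟩ := exists_hasDepth hν hj
    have hne : ∀ i, u m i ≠ none := by
      intro i
      rw [hin.apply_eq i (by rw [htop]; exact ENat.natCast_lt_top _), Ne, Option.or_eq_none_iff]
      have := hg.star i
      tauto
    rcases Nat.eq_zero_or_pos l with rfl | hpos
    · have hum : u m = ν := hl
      rw [hum] at h2
      exact PLE.not_plt hν (plt_ends h2.mem_right).2 h2
    · exact hne _ (hl.apply_self hpos)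
  obtain ⟨K, hK⟩ := exists_diff_eq_succ htop
  have hiB : i < B := by
    have := hB e hn.mem_left e' hn.mem_right K hK
    rw [hK] at hi
    norm_cast at hi
    omega
  have h3 := le_diff_iff.1 hd i hiB
  rw [hin.apply_eq i hi, not_differ_iff, Option.or_eq_none_iff] at h3
  have := hg.star i
  have := ha i
  tauto

theorem mem_L_loc (hν : Knead ν) {a : StarSeq A} (h : a ∈ L ν) : Loc ν a := by
  obtain ⟨-, ha, u, hu⟩ := h
  intro n
  obtain ⟨m, e, e', h1, h2, -⟩ := (hu.eventually_node hν ha n).exists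
  exact ⟨e, e', h1, h2⟩

theorem IsCentral.cont (hν : Knead ν) {c c' a : StarSeq A} (h : IsCentral ν c c' a) :
    Cont c c' a := by
  obtain ⟨⟨⟨n, hn⟩, hd⟩, -, ha, h1, h2⟩ := h
  obtain ⟨l, l', hg⟩ := Node.good (n := n) hν hn
  intro i _
  have := hg.star i
  have h3 := diff_eq_top_iff.1 h1 i
  have h4 := diff_eq_top_iff.1 h2 i
  have := ha i
  rw [not_differ_iff] at h3 h4
  cases hci : c i with
  | none => simp only [Option.none_or]; tauto
  | some x =>
    rw [hci] at h3
    simp only [Option.some_or]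
    tauto

theorem IsCentral.loc (hν : Knead ν) {c c' a : StarSeq A} (h : IsCentral ν c c' a) : Loc ν a := by
  have hc := h.cont hν
  obtain ⟨⟨⟨n, hn⟩, hd⟩, -⟩ := h
  have hn : Node ν n c c' := hn
  have key : ∀ m, Node ν (n + m) c c' := by
    intro m
    induction m with
    | zero => exact hn
    | succ m ih => exact ih.same hd
  intro m
  exact exists_cont_of_le (Nat.le_add_left m n) (key m) hc

/-- The itineraries without `⋆` on the critical path. -/
def Soft (ν a : StarSeq A) : Prop := a ∈ L ν ∨ ∃ c c', IsCentral ν c c' a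

theorem Soft.noStar {a : StarSeq A} (h : Soft ν a) : NoStar a := by
  rcases h with h | ⟨c, c', h⟩
  exacts [h.2.1, h.2.2.1]

theorem Soft.loc (hν : Knead ν) {a : StarSeq A} (h : Soft ν a) : Loc ν a := by
  rcases h with h | ⟨c, c', h⟩
  exacts [mem_L_loc hν h, h.loc hν]

theorem IsFatou.soft {a c : StarSeq A} (h : IsFatou ν a c) : Soft ν a := by
  rcases h.2.2.2 with h | ⟨c', h | h⟩
  exacts [Or.inl h, Or.inr ⟨_, _, h⟩, Or.inr ⟨_, _, h⟩]

theorem IsStarPeriodic.not_noStar (h : IsStarPeriodic ν) : ¬ NoStar ν := fun h' =>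
  h'.not_isStarPeriodic h

theorem not_noStar_of_mem_PInf (h : IsStarPeriodic ν) (h2 : 2 ≤ period ν) {q : StarSeq A}
    (hq : q ∈ PInf ν) : ¬ NoStar q := by
  obtain ⟨n, hq⟩ := hq
  obtain ⟨l, hl⟩ := exists_hasDepth (h.knead h2) hq
  intro hs
  refine h.not_noStar fun i => ?_
  rw [← hl.apply_add]
  exact hs _

theorem NoStar.shift_ne (h : IsStarPeriodic ν) {a : StarSeq A} (ha : NoStar a) (m : ℕ) :
    shift^[m] a ≠ ν := by
  intro he
  refine h.not_noStar fun i => ?_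
  rw [← he, shift_iterate]
  exact ha _

theorem NoStar.mem_X (h : IsStarPeriodic ν) {a : StarSeq A} (ha : NoStar a) : a ∈ X ν :=
  Or.inr (Or.inr ⟨ha, fun m _ => ha.shift_ne h m⟩)

end


/-! ### Coordinates for the order -/

section

variable {ν : StarSeq A}

open Classical in
/-- The points of `P_∞` to the left of a point of the critical path. -/
def pos (ν : StarSeq A) : Pt A → Set (StarSeq A)
  | .itin a => if a ∈ PInf ν then {p | p ∈ PInf ν ∧ PLE ν p a} else Below ν a
  | .fatou a _ _ => Below ν a

open Classical in
/-- A coordinate that distinguishes between points with the same `pos`. -/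
noncomputable def rk (ν : StarSeq A) : Pt A → ℝ
  | .itin a => if a ∈ PInf ν then 0 else 1
  -- On a Fatou interval the rank is `1` at `a`. It falls to `0` at an end `c` to the left, and
  -- rises towards `2` at an end `c` to the right, where `c` itself has a larger `pos`.
  | .fatou a c t => if c ∈ Below ν a then 1 - t.1 else 1 + t.1

/-- The order on the critical path in terms of `pos` and `rk`. -/
def KLT (ν : StarSeq A) (x y : Pt A) : Prop :=
  pos ν x ⊂ pos ν y ∨ (pos ν x = pos ν y ∧ rk ν x < rk ν y)

theorem KLT.trans {x y z : Pt A} (h : KLT ν x y) (h' : KLT ν y z) : KLT ν x z := by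
  rcases h with h | ⟨h1, h2⟩ <;> rcases h' with h' | ⟨h1', h2'⟩
  · exact Or.inl (h.trans h')
  · exact Or.inl (h1' ▸ h)
  · exact Or.inl (h1 ▸ h')
  · exact Or.inr ⟨h1.trans h1', h2.trans h2'⟩

theorem KLT.irrefl (x : Pt A) : ¬ KLT ν x x := by
  rintro (h | ⟨-, h⟩)
  · exact h.ne rfl
  · exact lt_irrefl _ h

theorem pos_itin {q : StarSeq A} (hq : q ∈ PInf ν) :
    pos ν (.itin q) = {p | p ∈ PInf ν ∧ PLE ν p q} := by simp [pos, hq]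

theorem rk_itin {q : StarSeq A} (hq : q ∈ PInf ν) : rk ν (.itin q) = 0 := by simp [rk, hq]

theorem Soft.notMem_PInf (h : IsStarPeriodic ν) (h2 : 2 ≤ period ν) {a : StarSeq A}
    (ha : Soft ν a) : a ∉ PInf ν := fun hq => not_noStar_of_mem_PInf h h2 hq ha.noStar

theorem Soft.pos_itin (h : IsStarPeriodic ν) (h2 : 2 ≤ period ν) {a : StarSeq A}
    (ha : Soft ν a) : pos ν (.itin a) = Below ν a := by simp [pos, ha.notMem_PInf h h2]

theorem Soft.rk_itin (h : IsStarPeriodic ν) (h2 : 2 ≤ period ν) {a : StarSeq A}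
    (ha : Soft ν a) : rk ν (.itin a) = 1 := by simp [rk, ha.notMem_PInf h h2]

theorem pos_subset (x : Pt A) : pos ν x ⊆ PInf ν := by
  cases x with
  | itin a =>
    by_cases h : a ∈ PInf ν
    · rw [HubbardTrees.pos_itin h]; exact fun p hp => hp.1
    · simp only [pos, if_neg h]; exact below_subset
  | fatou a c t => exact below_subset

theorem rk_nonneg (x : Pt A) : 0 ≤ rk ν x := by
  cases x with
  | itin a => simp only [rk]; split_ifs <;> norm_num
  | fatou a c t =>
    have := t.2.1
    have := t.2.2
    simp only [rk]
    split_ifs <;> linarith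

theorem rk_lt_two (x : Pt A) : rk ν x < 2 := by
  cases x with
  | itin a => simp only [rk]; split_ifs <;> norm_num
  | fatou a c t =>
    have := t.2.1
    have := t.2.2
    simp only [rk]
    split_ifs <;> linarith

theorem notMem_below_of_node (hν : Knead ν) {a p e e' : StarSeq A} {n : ℕ} (ha : Loc ν a)
    (hn : Node ν n e e') (hc : Cont e e' a) (hp : p ∈ PInf ν) (hle : PLE ν e' p) :
    p ∉ Below ν a := by
  obtain ⟨lo, hi, h, hc'⟩ := ha.exists_path
  rw [h.notMem_below_iff hν hc' hp]
  obtain ⟨rfl, rfl⟩ := hn.eq_of_cont (h.node_zero_add n) hc (hc' n)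
  exact ⟨n, hle⟩

/-- No point of `P_∞` lies between `a` and a compatible `c`, so the cut of `a` is the initial
segment of `c`, with or without `c`. -/
theorem below_eq_or (hν : Knead ν) {a c : StarSeq A} (hl : Loc ν a) (hcP : c ∈ PInf ν)
    (hd : diff a c = ⊤) : (c ∈ Below ν a ∧ Below ν a = {p | p ∈ PInf ν ∧ PLE ν p c}) ∨
      (c ∉ Below ν a ∧ Below ν a = {p | p ∈ PInf ν ∧ PLT ν p c}) := by
  by_cases hc : c ∈ Below ν a
  · refine Or.inl ⟨hc, Set.ext fun p => ⟨fun hp => ?_, fun hp => ?_⟩⟩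
    · exact ⟨below_subset hp,
        ((mem_below_iff_of_diff_eq_top hν hl hcP hd (below_subset hp)).1 hc).1 hp⟩
    · exact ((mem_below_iff_of_diff_eq_top hν hl hcP hd hp.1).1 hc).2 hp.2
  · refine Or.inr ⟨hc, Set.ext fun p => ⟨fun hp => ?_, fun hp => ?_⟩⟩
    · exact ⟨below_subset hp,
        ((mem_below_iff_of_diff_eq_top hν hl hcP hd (below_subset hp)).2 hc).1 hp⟩
    · exact ((mem_below_iff_of_diff_eq_top hν hl hcP hd hp.1).2 hc).2 hp.2

theorem IsCentral.mem_below {c c' a : StarSeq A} (hν : Knead ν) (h : IsCentral ν c c' a) :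
    c ∈ Below ν a ∧ c' ∉ Below ν a := by
  have hc := h.cont hν
  have hl := h.loc hν
  obtain ⟨⟨⟨n, hn⟩, hd⟩, -⟩ := h
  have hn : Node ν n c c' := hn
  exact ⟨⟨n, c, c', hn, hc, hn.mem_left, Or.inl rfl⟩,
    notMem_below_of_node hν hl hn hc ⟨n, hn.mem_right⟩ (Or.inl rfl)⟩

theorem mem_below_of_eventually (hν : Knead ν) {p a : StarSeq A} {u : ℕ → StarSeq A}
    (ha : a ∈ L ν) (hu : ConvergesTo ν u a) (h : ∀ᶠ n in atTop, PLT ν p (u n)) :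
    p ∈ Below ν a := by
  obtain ⟨m, hm⟩ := h.exists
  obtain ⟨N, hN⟩ := hm.mem_left
  obtain ⟨m, h1, e, e', hn, hc, h2, h3⟩ := (h.and (hu.eventually_node hν ha.2.1 N)).exists
  refine ⟨N, e, e', hn, hc, hN, (hn.ple_or_ple hν hN).resolve_right fun h4 => ?_⟩
  exact PLE.not_plt hν h4 (h1.trans hν h3)

theorem notMem_below_of_eventually (hν : Knead ν) {p a : StarSeq A} {u : ℕ → StarSeq A}
    (ha : a ∈ L ν) (hu : ConvergesTo ν u a) (h : ∀ᶠ n in atTop, PLT ν (u n) p) :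
    p ∈ PInf ν ∧ p ∉ Below ν a := by
  obtain ⟨m, hm⟩ := h.exists
  obtain ⟨N, hN⟩ := hm.mem_right
  obtain ⟨m, h1, e, e', hn, hc, h2, h3⟩ := (h.and (hu.eventually_node hν ha.2.1 N)).exists
  refine ⟨⟨N, hN⟩, notMem_below_of_node hν (mem_L_loc hν ha) hn hc ⟨N, hN⟩
    ((hn.ple_or_ple hν hN).resolve_left fun h4 => ?_)⟩
  exact PLE.not_plt hν h4 (h2.trans hν h1)

theorem ple_of_mem_below_of_node (hν : Knead ν) {p a e e' : StarSeq A} {N : ℕ} (ha : Loc ν a)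
    (hn : Node ν N e e') (hc : Cont e e' a) (hp : p ∈ Below ν a) (hN : p ∈ P ν N) : PLE ν p e :=
  (hn.ple_or_ple hν hN).resolve_right fun h1 =>
    notMem_below_of_node hν ha hn hc (below_subset hp) h1 hp

theorem ple_of_notMem_below_of_node (hν : Knead ν) {p a e e' : StarSeq A} {N : ℕ}
    (hn : Node ν N e e') (hc : Cont e e' a) (hp : p ∉ Below ν a) (hN : p ∈ P ν N) :
    PLE ν e' p :=
  (hn.ple_or_ple hν hN).resolve_left fun h1 => hp ⟨N, e, e', hn, hc, hN, h1⟩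

section

variable (h : IsStarPeriodic ν) (h2 : 2 ≤ period ν)
include h h2

theorem klt_of_mem_below {a p : StarSeq A} (ha : Soft ν a) (hp : p ∈ Below ν a) :
    KLT ν (.itin p) (.itin a) := by
  have hν := h.knead h2
  have hpP := below_subset hp
  unfold KLT
  rw [pos_itin hpP, ha.pos_itin h h2, rk_itin hpP, ha.rk_itin h h2]
  have : {q | q ∈ PInf ν ∧ PLE ν q p} ⊆ Below ν a := fun q hq =>
    mem_below_of_ple hν (ha.loc hν) hq.1 hq.2 hp
  rcases this.eq_or_ssubset with h1 | h1
  · exact Or.inr ⟨h1, one_pos⟩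
  · exact Or.inl h1

theorem below_ssubset {a p : StarSeq A} (ha : Soft ν a) (hpP : p ∈ PInf ν) (hp : p ∉ Below ν a) :
    Below ν a ⊂ pos ν (.itin p) := by
  have hν := h.knead h2
  rw [pos_itin hpP]
  have hsub : Below ν a ⊆ {q | q ∈ PInf ν ∧ PLE ν q p} := by
    refine fun q hq => ⟨below_subset hq, (ple_or_plt hν (below_subset hq) hpP).resolve_right ?_⟩
    exact fun h1 => hp (mem_below_of_ple hν (ha.loc hν) hpP (Or.inr h1) hq)
  exact (ssubset_iff_of_subset hsub).2 ⟨p, ⟨hpP, Or.inl rfl⟩, hp⟩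

theorem klt_of_notMem_below {a p : StarSeq A} (ha : Soft ν a) (hpP : p ∈ PInf ν)
    (hp : p ∉ Below ν a) : KLT ν (.itin a) (.itin p) := by
  left
  rw [ha.pos_itin h h2]
  exact below_ssubset h h2 ha hpP hp

theorem IsFatou.notMem_below {a c : StarSeq A} (hF : IsFatou ν a c)
    (hlt : KLT ν (.itin a) (.itin c)) : c ∉ Below ν a := fun hc =>
  KLT.irrefl _ (hlt.trans (klt_of_mem_below h h2 hF.soft hc))

theorem IsFatou.mem_below {a c : StarSeq A} (hF : IsFatou ν a c)
    (hlt : KLT ν (.itin c) (.itin a)) : c ∈ Below ν a := by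
  by_contra hc
  exact KLT.irrefl _ (hlt.trans (klt_of_notMem_below h h2 hF.soft hF.2.1 hc))

/-- Every generator increases the lexicographic coordinates, so the generated relation is a strict
order. For a Fatou interval the induction hypothesis tells on which side of `a` its end `c` lies. -/
theorem CLT.klt {x y : Pt A} (hxy : CLT ν x y) : KLT ν x y := by
  have hν := h.knead h2
  induction hxy with
  | @prec a b hab =>
    left
    rw [pos_itin hab.mem_left, pos_itin hab.mem_right]
    have hsub : {p | p ∈ PInf ν ∧ PLE ν p a} ⊆ {p | p ∈ PInf ν ∧ PLE ν p b} :=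
      fun q hq => ⟨hq.1, Or.inr (hq.2.trans_plt hν hab)⟩
    refine (ssubset_iff_of_subset hsub).2 ⟨b, ⟨hab.mem_right, Or.inl rfl⟩, fun hb => hb.2.not_plt hν hab⟩
  | below_limit ha hu hev =>
    exact klt_of_mem_below h h2 (Or.inl ha) (mem_below_of_eventually hν ha hu hev)
  | above_limit ha hu hev =>
    have := notMem_below_of_eventually hν ha hu hev
    exact klt_of_notMem_below h h2 (Or.inl ha) this.1 this.2
  | below_central hc =>
    exact klt_of_mem_below h h2 (Or.inr ⟨_, _, hc⟩) (hc.mem_below hν).1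
  | above_central hc =>
    have hm : _ ∈ PInf ν := hc.1.1.imp fun n hn => Node.mem_right (n := n) hn
    exact klt_of_notMem_below h h2 (Or.inr ⟨_, _, hc⟩) hm (hc.mem_below hν).2
  | fatou_inc_left hF _ t ih =>
    have hc := hF.notMem_below h h2 ih
    refine Or.inr ⟨hF.soft.pos_itin h h2, ?_⟩
    rw [hF.soft.rk_itin h h2]
    simp only [rk, if_neg hc]
    linarith [t.2.1]
  | fatou_inc_right hF _ t ih =>
    exact Or.inl (below_ssubset h h2 hF.soft hF.2.1 (hF.notMem_below h h2 ih))
  | fatou_inc hF _ hst ih =>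
    have hc := hF.notMem_below h h2 ih
    refine Or.inr ⟨rfl, ?_⟩
    simp only [rk, if_neg hc]
    linarith [Subtype.coe_lt_coe.2 hst]
  | fatou_dec_left hF _ t ih =>
    have hc := hF.mem_below h h2 ih
    refine Or.inr ⟨?_, ?_⟩
    · rw [pos_itin hF.2.1]
      have := below_eq_or hν (hF.soft.loc hν) hF.2.1 hF.2.2.1
      simp only [pos]
      tauto
    · rw [rk_itin hF.2.1]
      simp only [rk, if_pos hc]
      linarith [t.2.2]
  | fatou_dec_right hF _ t ih =>
    have hc := hF.mem_below h h2 ih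
    refine Or.inr ⟨(hF.soft.pos_itin h h2).symm, ?_⟩
    rw [hF.soft.rk_itin h h2]
    simp only [rk, if_pos hc]
    linarith [t.2.1]
  | fatou_dec hF _ hst ih =>
    have hc := hF.mem_below h h2 ih
    refine Or.inr ⟨rfl, ?_⟩
    simp only [rk, if_pos hc]
    linarith [Subtype.coe_lt_coe.2 hst]
  | trans _ _ ih1 ih2 => exact ih1.trans ih2

theorem clt_of_mem_below {a p : StarSeq A} (ha : Soft ν a) (hp : p ∈ Below ν a) :
    CLT ν (.itin p) (.itin a) := by
  have hν := h.knead h2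
  have hl := ha.loc hν
  rcases ha with ha | ⟨c, c', hc⟩
  · obtain ⟨-, hs, u, hu⟩ := id ha
    obtain ⟨N, hN⟩ := below_subset hp
    refine CLT.below_limit ha hu ?_
    filter_upwards [hu.eventually_node hν hs N] with m ⟨e, e', hn, hc, h1, h2⟩
    exact (ple_of_mem_below_of_node hν hl hn hc hp hN).trans_plt hν h1
  · have hcP : c ∈ PInf ν := hc.1.1.imp fun n hn => Node.mem_left (n := n) hn
    have h1 := (mem_below_iff_of_diff_eq_top hν hl hcP (by rw [diff_comm]; exact hc.2.2.2.1)
      (below_subset hp)).1 (hc.mem_below hν).1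
    rcases h1.1 hp with rfl | h3
    · exact .below_central hc
    · exact (CLT.prec h3).trans (.below_central hc)

theorem clt_of_notMem_below {a p : StarSeq A} (ha : Soft ν a) (hpP : p ∈ PInf ν)
    (hp : p ∉ Below ν a) : CLT ν (.itin a) (.itin p) := by
  have hν := h.knead h2
  have hl := ha.loc hν
  rcases ha with ha | ⟨c, c', hc⟩
  · obtain ⟨-, hs, u, hu⟩ := id ha
    obtain ⟨N, hN⟩ := hpP
    refine CLT.above_limit ha hu ?_
    filter_upwards [hu.eventually_node hν hs N] with m ⟨e, e', hn, hc, h1, h2⟩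
    exact h2.trans_ple hν (ple_of_notMem_below_of_node hν hn hc hp hN)
  · have hcP : c' ∈ PInf ν := hc.1.1.imp fun n hn => Node.mem_right (n := n) hn
    have h1 := (mem_below_iff_of_diff_eq_top hν hl hcP hc.2.2.2.2 hpP).2 (hc.mem_below hν).2
    rcases ple_or_plt hν hcP hpP with h3 | h3
    · rcases h3 with rfl | h3
      · exact .above_central hc
      · exact (CLT.above_central hc).trans (.prec h3)
    · exact (hp (h1.2 h3)).elim

theorem clt_of_mem_pos {y : Pt A} (hy : y ∈ critPath ν) {p : StarSeq A} (hp : p ∈ pos ν y) :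
    .itin p = y ∨ CLT ν (.itin p) y := by
  have hν := h.knead h2
  rcases hy with ⟨a, rfl, ha⟩ | ⟨a, c, t, rfl, hF⟩
  · by_cases haP : a ∈ PInf ν
    · rw [pos_itin haP] at hp
      rcases hp.2 with rfl | h3
      · exact Or.inl rfl
      · exact Or.inr (.prec h3)
    · have ha : Soft ν a := by
        rcases ha with (ha | ha) | ha
        exacts [(haP ha).elim, Or.inl ha, Or.inr ha]
      rw [ha.pos_itin h h2] at hp
      exact Or.inr (clt_of_mem_below h h2 ha hp)
  · right
    have hp : p ∈ Below ν a := hp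
    have hs := hF.soft
    rcases below_eq_or hν (hs.loc hν) hF.2.1 hF.2.2.1 with ⟨h3, h4⟩ | ⟨h3, h4⟩
    · have h5 := CLT.fatou_dec_left hF (clt_of_mem_below h h2 hs h3) t
      rw [h4] at hp
      rcases hp.2 with rfl | h6
      · exact h5
      · exact (CLT.prec h6).trans h5
    · exact (clt_of_mem_below h h2 hs hp).trans
        (CLT.fatou_inc_left hF (clt_of_notMem_below h h2 hs hF.2.1 h3) t)

theorem clt_of_notMem_pos {x : Pt A} (hx : x ∈ critPath ν) {p : StarSeq A} (hpP : p ∈ PInf ν)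
    (hp : p ∉ pos ν x) : CLT ν x (.itin p) := by
  have hν := h.knead h2
  rcases hx with ⟨a, rfl, ha⟩ | ⟨a, c, t, rfl, hF⟩
  · by_cases haP : a ∈ PInf ν
    · rw [pos_itin haP] at hp
      exact .prec ((ple_or_plt hν hpP haP).resolve_left fun h3 => hp ⟨hpP, h3⟩)
    · have ha : Soft ν a := by
        rcases ha with (ha | ha) | ha
        exacts [(haP ha).elim, Or.inl ha, Or.inr ha]
      rw [ha.pos_itin h h2] at hp
      exact clt_of_notMem_below h h2 ha hpP hp
  · have hp : p ∉ Below ν a := hp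
    have hs := hF.soft
    rcases below_eq_or hν (hs.loc hν) hF.2.1 hF.2.2.1 with ⟨h3, h4⟩ | ⟨h3, h4⟩
    · exact (CLT.fatou_dec_right hF (clt_of_mem_below h h2 hs h3) t).trans
        (clt_of_notMem_below h h2 hs hpP hp)
    · have h5 := CLT.fatou_inc_right hF (clt_of_notMem_below h h2 hs hF.2.1 h3) t
      rw [h4] at hp
      rcases ple_or_plt hν hF.2.1 hpP with h6 | h6
      · rcases h6 with rfl | h6
        · exact h5
        · exact h5.trans (.prec h6)
      · exact (hp ⟨hpP, h6⟩).elim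

/-- On each side of `a` the end `c` is the extreme point of the cut, so there is at most one Fatou
interval per side. -/
theorem IsFatou.eq_of_iff {a c c' : StarSeq A} (hF : IsFatou ν a c) (hF' : IsFatou ν a c')
    (hc : c ∈ Below ν a ↔ c' ∈ Below ν a) : c = c' := by
  have hν := h.knead h2
  have key : ∀ {c c'}, IsFatou ν a c → IsFatou ν a c' → (c ∈ Below ν a ↔ c' ∈ Below ν a) →
      ¬ PLT ν c c' := by
    intro c c' hF hF' hc hlt
    rcases below_eq_or hν (hF.soft.loc hν) hF.2.1 hF.2.2.1 with ⟨h3, h4⟩ | ⟨h3, h4⟩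
    · have := hc.1 h3
      rw [h4] at this
      exact this.2.not_plt hν hlt
    · rcases below_eq_or hν (hF.soft.loc hν) hF'.2.1 hF'.2.2.1 with ⟨h5, h6⟩ | ⟨h5, h6⟩
      · exact h3 (hc.2 h5)
      · exact h3 (h6 ▸ ⟨hF.2.1, hlt⟩)
  rcases PLT.trichotomy hν hF.2.1 hF'.2.1 with h3 | h3 | h3
  · exact (key hF hF' hc h3).elim
  · exact h3
  · exact (key hF' hF hc.symm h3).elim

theorem mem_PInf_or_exists_soft {x : Pt A} (hx : x ∈ critPath ν) :
    (∃ q ∈ PInf ν, x = .itin q) ∨ ∃ a, Soft ν a ∧ pos ν x = Below ν a ∧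
      (x = .itin a ∨ ∃ c t, IsFatou ν a c ∧ x = .fatou a c t) := by
  rcases hx with ⟨a, rfl, ha⟩ | ⟨a, c, t, rfl, hF⟩
  · by_cases haP : a ∈ PInf ν
    · exact Or.inl ⟨a, haP, rfl⟩
    · have ha : Soft ν a := by
        rcases ha with (ha | ha) | ha
        exacts [(haP ha).elim, Or.inl ha, Or.inr ha]
      exact Or.inr ⟨a, ha, ha.pos_itin h h2, Or.inl rfl⟩
  · exact Or.inr ⟨a, hF.soft, rfl, Or.inr ⟨c, t, hF, rfl⟩⟩

/-- Different cuts are separated by a point of `P_∞`. If the cuts are equal and `x` is not in `P_∞`,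
both points belong to the same itinerary `a` or to its Fatou intervals, where the rank decides. -/
theorem clt_of_klt {x y : Pt A} (hx : x ∈ critPath ν) (hy : y ∈ critPath ν) (hxy : KLT ν x y) :
    CLT ν x y := by
  have hν := h.knead h2
  rcases hxy with hxy | ⟨hpos, hrk⟩
  · obtain ⟨p, hp, hp'⟩ := exists_of_ssubset hxy
    have h3 := clt_of_notMem_pos h h2 hx (pos_subset _ hp) hp'
    rcases clt_of_mem_pos h h2 hy hp with rfl | h4
    · exact h3
    · exact h3.trans h4
  · rcases mem_PInf_or_exists_soft h h2 hx with ⟨q, hq, rfl⟩ | ⟨a, ha, hax, hx'⟩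
    · have hqy : q ∈ pos ν y := by
        rw [← hpos, pos_itin hq]
        exact ⟨hq, Or.inl rfl⟩
      rcases clt_of_mem_pos h h2 hy hqy with rfl | h4
      · exact (lt_irrefl _ hrk).elim
      · exact h4
    · rcases mem_PInf_or_exists_soft h h2 hy with ⟨q, hq, rfl⟩ | ⟨a', ha', hay, hy'⟩
      · rw [rk_itin hq] at hrk
        exact (not_le.2 hrk (rk_nonneg _)).elim
      · obtain rfl : a = a' := (ha.loc hν).eq_of_below_eq hν (ha'.loc hν) (by
          rw [← hax, ← hay, hpos])
        rcases hx' with rfl | ⟨c, s, hF, rfl⟩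
        · rcases hy' with rfl | ⟨c', t, hF', rfl⟩
          · exact (lt_irrefl _ hrk).elim
          · rw [ha.rk_itin h h2] at hrk
            by_cases hc : c' ∈ Below ν a
            · simp only [rk, if_pos hc] at hrk
              linarith [t.2.1]
            · exact .fatou_inc_left hF' (clt_of_notMem_below h h2 ha hF'.2.1 hc) t
        · have hdec : c ∈ Below ν a → CLT ν (.fatou a c s) (.itin a) := fun hc =>
            .fatou_dec_right hF (clt_of_mem_below h h2 ha hc) s
          rcases hy' with rfl | ⟨c', t, hF', rfl⟩
          · rw [ha.rk_itin h h2] at hrk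
            by_cases hc : c ∈ Below ν a
            · exact hdec hc
            · simp only [rk, if_neg hc] at hrk
              linarith [s.2.1]
          · by_cases hc : c ∈ Below ν a <;> by_cases hc' : c' ∈ Below ν a
            · obtain rfl := hF.eq_of_iff h h2 hF' (iff_of_true hc hc')
              simp only [rk, if_pos hc] at hrk
              exact .fatou_dec hF (clt_of_mem_below h h2 ha hc) (Subtype.coe_lt_coe.1 (by linarith))
            · exact (hdec hc).trans
                (.fatou_inc_left hF' (clt_of_notMem_below h h2 ha hF'.2.1 hc') t)
            · simp only [rk, if_pos hc', if_neg hc] at hrk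
              linarith [s.2.1, t.2.1]
            · obtain rfl := hF.eq_of_iff h h2 hF' (iff_of_false hc hc')
              simp only [rk, if_neg hc] at hrk
              exact .fatou_inc hF (clt_of_notMem_below h h2 ha hF.2.1 hc)
                (Subtype.coe_lt_coe.1 (by linarith))

theorem clt_iff_klt {x y : Pt A} (hx : x ∈ critPath ν) (hy : y ∈ critPath ν) :
    CLT ν x y ↔ KLT ν x y := ⟨CLT.klt h h2, clt_of_klt h h2 hx hy⟩

end

end


/-! ### Continuity in the order topology -/

/-- The Fatou interval `[a, c]`, with constant continuations. -/
noncomputable def curve (a c : StarSeq A) (t : ℝ) : Pt A :=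
  if h : 0 < t ∧ t < 1 then .fatou a c ⟨t, h⟩ else if t ≤ 0 then .itin a else .itin c

theorem curve_coe (a c : StarSeq A) (t : Ioo (0 : ℝ) 1) : curve a c t = .fatou a c t := by
  have : (0 : ℝ) < t ∧ (t : ℝ) < 1 := t.2
  simp [curve, this]

theorem curve_of_nonpos (a c : StarSeq A) {t : ℝ} (ht : t ≤ 0) : curve a c t = .itin a := by
  rw [curve, dif_neg (fun h => by linarith [h.1]), if_pos ht]

theorem curve_of_one_le (a c : StarSeq A) {t : ℝ} (ht : 1 ≤ t) : curve a c t = .itin c := by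
  rw [curve, dif_neg (fun h => by linarith [h.2]), if_neg (by linarith)]

theorem curve_cases (a c : StarSeq A) (t : ℝ) :
    (t ≤ 0 ∧ curve a c t = .itin a) ∨ (1 ≤ t ∧ curve a c t = .itin c) ∨
      ∃ s : Ioo (0 : ℝ) 1, t = s ∧ curve a c t = .fatou a c s := by
  by_cases h0 : t ≤ 0
  · exact Or.inl ⟨h0, curve_of_nonpos a c h0⟩
  · by_cases h1 : 1 ≤ t
    · exact Or.inr (Or.inl ⟨h1, curve_of_one_le a c h1⟩)
    · exact Or.inr (Or.inr ⟨⟨t, not_le.1 h0, not_le.1 h1⟩, rfl, curve_coe a c ⟨t, _⟩⟩)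

section

variable {ν : StarSeq A}

theorem Soft.mem_critPath {a : StarSeq A} (h : Soft ν a) : Pt.itin a ∈ critPath ν :=
  Or.inl ⟨a, rfl, h.imp_left Or.inr⟩

theorem itin_mem_critPath {q : StarSeq A} (h : q ∈ PInf ν) : Pt.itin q ∈ critPath ν :=
  Or.inl ⟨q, rfl, Or.inl (Or.inl h)⟩

theorem IsFatou.curve_mem {a c : StarSeq A} (h : IsFatou ν a c) (t : ℝ) :
    curve a c t ∈ critPath ν := by
  rcases curve_cases a c t with ⟨-, h1⟩ | ⟨-, h1⟩ | ⟨s, -, h1⟩ <;> rw [h1]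
  · exact h.soft.mem_critPath
  · exact itin_mem_critPath h.2.1
  · exact Or.inr ⟨a, c, s, rfl, h⟩

theorem IsPath.mem_below_lo {N : ℕ} {lo hi : ℕ → StarSeq A} {a : StarSeq A} (hp : IsPath ν N lo hi)
    (hc : ∀ n, Cont (lo n) (hi n) a) (n : ℕ) : lo n ∈ Below ν a :=
  ⟨N + n, _, _, hp.node_add n, hc n, (hp.node_add n).mem_left, Or.inl rfl⟩

theorem not_moving_of_eventually_eq {u : ℕ → StarSeq A} {c : StarSeq A}
    (hu : ∀ᶠ n in atTop, u n = c) : ¬ Moving u := by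
  intro hm
  obtain ⟨n, hn⟩ := eventually_atTop.1 hu
  obtain ⟨m, h3, h4⟩ := hm n
  exact h4 ((hn m h3).trans (hn n le_rfl).symm)

/-- The retraction of the line to the unit interval. -/
noncomputable def clamp (t : ℝ) : ℝ := max 0 (min t 1)

theorem continuous_clamp : Continuous clamp := by unfold clamp; fun_prop

theorem clamp_of_nonpos {t : ℝ} (h : t ≤ 0) : clamp t = 0 :=
  max_eq_left ((min_le_left _ _).trans h)

theorem clamp_of_one_le {t : ℝ} (h : 1 ≤ t) : clamp t = 1 := by
  rw [clamp, min_eq_right h]; norm_num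

theorem clamp_coe (t : Ioo (0 : ℝ) 1) : clamp t = t := by
  rw [clamp, min_eq_left t.2.2.le, max_eq_right t.2.1.le]

section

variable (h : IsStarPeriodic ν) (h2 : 2 ≤ period ν)
include h h2

theorem pos_rk_curve_of_mem {a c : StarSeq A} (hF : IsFatou ν a c) (hc : c ∈ Below ν a) (t : ℝ) :
    pos ν (curve a c t) = Below ν a ∧ rk ν (curve a c t) = 1 - clamp t := by
  rcases curve_cases a c t with ⟨ht, h1⟩ | ⟨ht, h1⟩ | ⟨s, rfl, h1⟩ <;> rw [h1]
  · rw [hF.soft.pos_itin h h2, hF.soft.rk_itin h h2, clamp_of_nonpos ht]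
    simp
  · rw [pos_itin hF.2.1, rk_itin hF.2.1, clamp_of_one_le ht]
    have := below_eq_or (h.knead h2) (hF.soft.loc (h.knead h2)) hF.2.1 hF.2.2.1
    refine ⟨?_, by simp⟩
    tauto
  · rw [clamp_coe]
    exact ⟨rfl, by simp [rk, hc]⟩

theorem pos_rk_curve_of_notMem {a c : StarSeq A} (hF : IsFatou ν a c) (hc : c ∉ Below ν a)
    {t : ℝ} (ht : t < 1) :
    pos ν (curve a c t) = Below ν a ∧ rk ν (curve a c t) = 1 + clamp t := by
  rcases curve_cases a c t with ⟨ht, h1⟩ | ⟨ht', h1⟩ | ⟨s, rfl, h1⟩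
  · rw [h1, hF.soft.pos_itin h h2, hF.soft.rk_itin h h2, clamp_of_nonpos ht]
    simp
  · linarith
  · rw [h1, clamp_coe]
    exact ⟨rfl, by simp [rk, hc]⟩

/-- In coordinates, `pos` is constant along the interval and `rk` is a continuous function of the
parameter. The exception is an end `c` to the right, where `pos` jumps at `t = 1`. -/
theorem isOpen_curve_lt {a c : StarSeq A} (hF : IsFatou ν a c) {y : Pt A} (hy : y ∈ critPath ν) :
    IsOpen {t : ℝ | CLT ν (curve a c t) y} := by
  have hν := h.knead h2
  have he : {t : ℝ | CLT ν (curve a c t) y} = {t : ℝ | KLT ν (curve a c t) y} := by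
    ext t
    exact clt_iff_klt h h2 (hF.curve_mem t) hy
  rw [he]
  by_cases hc : c ∈ Below ν a
  · have he : {t : ℝ | KLT ν (curve a c t) y} =
        {t | Below ν a ⊂ pos ν y ∨ (Below ν a = pos ν y ∧ 1 - clamp t < rk ν y)} := by
      ext t
      obtain ⟨h3, h4⟩ := pos_rk_curve_of_mem h h2 hF hc t
      simp only [KLT, h3, h4, mem_ofPred_eq]
    rw [he]
    by_cases h3 : Below ν a ⊂ pos ν y
    · simp [h3]
    by_cases h4 : Below ν a = pos ν y
    · have := continuous_clamp
      simp only [← h4, ssubset_irrefl, true_and, false_or]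
      exact isOpen_lt (by fun_prop) continuous_const
    · simp [h3, h4]
  · by_cases h3 : Below ν a ⊂ pos ν y
    · have hcy : c ∈ pos ν y := by
        obtain ⟨p, hp, hp'⟩ := exists_of_ssubset h3
        have hpP := pos_subset _ hp
        rcases clt_of_mem_pos h h2 hy hp with rfl | h5
        · rw [pos_itin hpP]
          refine ⟨hF.2.1, (ple_or_plt hν hF.2.1 hpP).resolve_right fun h6 => hp' ?_⟩
          rcases below_eq_or hν (hF.soft.loc hν) hF.2.1 hF.2.2.1 with h7 | h7
          · exact (hc h7.1).elim
          · rw [h7.2]; exact ⟨hpP, h6⟩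
        · by_contra hcy
          have h6 := (clt_of_notMem_pos h h2 hy hF.2.1 hcy).klt h h2
          have h7 := (CLT.klt h h2 h5).trans h6
          have h8 : PLT ν p c := by
            rcases PLT.trichotomy hν hpP hF.2.1 with h8 | rfl | h8
            · exact h8
            · exact (KLT.irrefl _ h7).elim
            · exact (KLT.irrefl _ (h7.trans ((CLT.prec h8).klt h h2))).elim
          rcases below_eq_or hν (hF.soft.loc hν) hF.2.1 hF.2.2.1 with h7 | h7
          · exact hc h7.1
          · exact hp' (by rw [h7.2]; exact ⟨hpP, h8⟩)
      rcases clt_of_mem_pos h h2 hy hcy with rfl | h5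
      · have he : {t : ℝ | KLT ν (curve a c t) (.itin c)} = Iio 1 := by
          ext t
          simp only [mem_ofPred_eq, mem_Iio]
          constructor
          · intro h6
            by_contra! h7
            rw [curve_of_one_le a c h7] at h6
            exact KLT.irrefl _ h6
          · intro h6
            left
            rwa [(pos_rk_curve_of_notMem h h2 hF hc h6).1]
        rw [he]
        exact isOpen_Iio
      · have he : {t : ℝ | KLT ν (curve a c t) y} = univ := by
          ext t
          simp only [mem_ofPred_eq, mem_univ, iff_true]
          rcases lt_or_ge t 1 with h6 | h6
          · left
            rwa [(pos_rk_curve_of_notMem h h2 hF hc h6).1]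
          · rw [curve_of_one_le a c h6]
            exact CLT.klt h h2 h5
        rw [he]
        exact isOpen_univ
    · have he : {t : ℝ | KLT ν (curve a c t) y} =
          {t | Below ν a = pos ν y ∧ 1 + clamp t < rk ν y} := by
        ext t
        simp only [mem_ofPred_eq]
        rcases lt_or_ge t 1 with h6 | h6
        · obtain ⟨h7, h8⟩ := pos_rk_curve_of_notMem h h2 hF hc h6
          simp only [KLT, h7, h8, h3, false_or]
        · rw [curve_of_one_le a c h6, clamp_of_one_le h6]
          have := rk_lt_two (ν := ν) y
          refine iff_of_false (fun h7 => h3 ?_) fun h7 => by linarith [h7.2]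
          have h8 := below_ssubset h h2 hF.soft hF.2.1 hc
          rcases h7 with h7 | h7
          · exact h8.trans h7
          · rwa [← h7.1]
      rw [he]
      by_cases h4 : Below ν a = pos ν y
      · have := continuous_clamp
        simp only [h4, true_and]
        exact isOpen_lt (by fun_prop) continuous_const
      · simp [h4]

theorem isOpen_lt_curve {a c : StarSeq A} (hF : IsFatou ν a c) {y : Pt A} (hy : y ∈ critPath ν) :
    IsOpen {t : ℝ | CLT ν y (curve a c t)} := by
  have hν := h.knead h2
  have he : {t : ℝ | CLT ν y (curve a c t)} = {t : ℝ | KLT ν y (curve a c t)} := by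
    ext t
    exact clt_iff_klt h h2 hy (hF.curve_mem t)
  rw [he]
  have hcl := continuous_clamp
  by_cases hc : c ∈ Below ν a
  · have he : {t : ℝ | KLT ν y (curve a c t)} =
        {t | pos ν y ⊂ Below ν a ∨ (pos ν y = Below ν a ∧ rk ν y < 1 - clamp t)} := by
      ext t
      obtain ⟨h3, h4⟩ := pos_rk_curve_of_mem h h2 hF hc t
      simp only [KLT, h3, h4, mem_ofPred_eq]
    rw [he]
    by_cases h3 : pos ν y ⊂ Below ν a
    · simp [h3]
    by_cases h4 : pos ν y = Below ν a
    · simp only [h4, ssubset_irrefl, true_and, false_or]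
      exact isOpen_lt continuous_const (by fun_prop)
    · simp [h3, h4]
  · have hss := below_ssubset h h2 hF.soft hF.2.1 hc
    -- The formula extends to `t ≥ 1` although `c` has rank `0`: there `1 + clamp t = 2` exceeds
    -- every rank, as it should for points below `c`.
    have he : {t : ℝ | KLT ν y (curve a c t)} =
        {t | pos ν y ⊂ Below ν a ∨ (pos ν y = Below ν a ∧ rk ν y < 1 + clamp t)} := by
      ext t
      simp only [mem_ofPred_eq]
      rcases lt_or_ge t 1 with h6 | h6
      · obtain ⟨h7, h8⟩ := pos_rk_curve_of_notMem h h2 hF hc h6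
        simp only [KLT, h7, h8]
      · rw [curve_of_one_le a c h6, clamp_of_one_le h6]
        have h9 := rk_lt_two (ν := ν) y
        constructor
        · rintro (h7 | ⟨-, h7⟩)
          · have hcy : c ∉ pos ν y := by
              intro hcy
              rcases clt_of_mem_pos h h2 hy hcy with rfl | h5
              · exact h7.ne rfl
              · exact KLT.irrefl _ ((CLT.klt h h2 h5).trans (Or.inl h7))
            have hsub : pos ν y ⊆ Below ν a := by
              intro p hp
              have h10 := h7.subset hp
              rw [pos_itin hF.2.1] at h10
              rcases below_eq_or hν (hF.soft.loc hν) hF.2.1 hF.2.2.1 with h11 | h11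
              · exact (hc h11.1).elim
              · rw [h11.2]
                refine ⟨h10.1, h10.2.resolve_left ?_⟩
                rintro rfl
                exact hcy hp
            rcases hsub.eq_or_ssubset with h8 | h8
            · exact Or.inr ⟨h8, by linarith⟩
            · exact Or.inl h8
          · rw [rk_itin hF.2.1] at h7
            exact (not_le.2 h7 (rk_nonneg _)).elim
        · rintro (h7 | ⟨h7, -⟩)
          · exact Or.inl (h7.trans hss)
          · exact Or.inl (h7 ▸ hss)
    rw [he]
    by_cases h3 : pos ν y ⊂ Below ν a
    · simp [h3]
    by_cases h4 : pos ν y = Below ν a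
    · simp only [h4, ssubset_irrefl, true_and, false_or]
      exact isOpen_lt continuous_const (by fun_prop)
    · simp [h3, h4]

theorem continuous_curve {a c : StarSeq A} (hF : IsFatou ν a c) :
    @Continuous ℝ (critPath ν) _ (topologyC ν) fun t => ⟨curve a c t, hF.curve_mem t⟩ := by
  refine continuous_generateFrom_iff.2 ?_
  rintro _ ⟨y, rfl | rfl⟩
  · exact isOpen_curve_lt h h2 hF y.2
  · exact isOpen_lt_curve h h2 hF y.2

theorem IsPath.notMem_below_hi {N : ℕ} {lo hi : ℕ → StarSeq A} {a : StarSeq A}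
    (hp : IsPath ν N lo hi) (hc : ∀ n, Cont (lo n) (hi n) a) (n : ℕ) : hi n ∉ Below ν a :=
  notMem_below_of_node (h.knead h2) (hp.loc hc) (hp.node_add n) (hc n)
    ⟨_, (hp.node_add n).mem_right⟩ (Or.inl rfl)

theorem IsPath.eventually_ple_lo {N : ℕ} {lo hi : ℕ → StarSeq A} {a p : StarSeq A}
    (hp : IsPath ν N lo hi) (hc : ∀ n, Cont (lo n) (hi n) a) (hpb : p ∈ Below ν a) :
    ∀ᶠ n in atTop, PLE ν p (lo n) := by
  have hν := h.knead h2
  obtain ⟨m, hm⟩ := below_subset hpb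
  filter_upwards [eventually_ge_atTop m] with n hn
  exact ple_of_mem_below_of_node hν (hp.loc hc) (hp.node_add n) (hc n) hpb
    (mem_P_of_le (by omega) hm)

theorem IsPath.eventually_hi_ple {N : ℕ} {lo hi : ℕ → StarSeq A} {a p : StarSeq A}
    (hp : IsPath ν N lo hi) (hc : ∀ n, Cont (lo n) (hi n) a) (hpP : p ∈ PInf ν)
    (hpb : p ∉ Below ν a) : ∀ᶠ n in atTop, PLE ν (hi n) p := by
  have hν := h.knead h2
  obtain ⟨m, hm⟩ := hpP
  filter_upwards [eventually_ge_atTop m] with n hn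
  exact ple_of_notMem_below_of_node hν (hp.node_add n) (hc n) hpb (mem_P_of_le (by omega) hm)

/-- A lower end that keeps moving is cofinal below `a`, so it enters every open ray around `a`. -/
theorem IsPath.eventually_lo_mem {N : ℕ} {lo hi : ℕ → StarSeq A} {a : StarSeq A}
    (hp : IsPath ν N lo hi) (hc : ∀ n, Cont (lo n) (hi n) a) (ha : Soft ν a) (hm : Moving lo)
    {S : Set (critPath ν)} (hS : IsOpen[topologyC ν] S) (haS : ⟨_, ha.mem_critPath⟩ ∈ S) :
    ∀ᶠ n in atTop, (⟨.itin (lo n), itin_mem_critPath ⟨_, (hp.node_add n).mem_left⟩⟩ :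
      critPath ν) ∈ S := by
  have hν := h.knead h2
  let _ := topologyC ν
  have ht : Tendsto (fun n => (⟨.itin (lo n), itin_mem_critPath ⟨_, (hp.node_add n).mem_left⟩⟩ :
      critPath ν)) atTop (𝓝 ⟨_, ha.mem_critPath⟩) := by
    refine TopologicalSpace.tendsto_nhds_generateFrom_iff.2 ?_
    rintro _ ⟨⟨y, hy⟩, rfl | rfl⟩ hay
    · have hay : CLT ν (.itin a) y := hay
      refine Eventually.of_forall fun n => ?_
      exact (clt_of_mem_below h h2 ha (hp.mem_below_lo hc n)).trans hay
    · have hay : CLT ν y (.itin a) := hay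
      show ∀ᶠ n in atTop, CLT ν y (.itin (lo n))
      -- If the cut had a greatest point, `lo` would stop there. A `y` below `a` with the cut of `a`
      -- would produce such a point.
      have hno : ∀ {c}, c ∈ Below ν a → (∀ p ∈ Below ν a, PLE ν p c) → False := by
        intro c hcb hle
        refine not_moving_of_eventually_eq ?_ hm (c := c)
        filter_upwards [IsPath.eventually_ple_lo h h2 hp hc hcb] with n hn
        exact (hle _ (hp.mem_below_lo hc n)).antisymm hν hn
      rcases hay.klt h h2 with h3 | ⟨h3, h4⟩
      · rw [ha.pos_itin h h2] at h3
        obtain ⟨p, hp1, hp2⟩ := exists_of_ssubset h3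
        have h5 := clt_of_notMem_pos h h2 hy (below_subset hp1) hp2
        filter_upwards [IsPath.eventually_ple_lo h h2 hp hc hp1] with n hn
        rcases hn with rfl | hn
        · exact h5
        · exact h5.trans (.prec hn)
      · exfalso
        rw [ha.rk_itin h h2] at h4
        rw [ha.pos_itin h h2] at h3
        rcases mem_PInf_or_exists_soft h h2 hy with ⟨q, hq, rfl⟩ | ⟨b, hb, hby, hy'⟩
        · rw [pos_itin hq] at h3
          exact hno (c := q) (h3 ▸ ⟨hq, Or.inl rfl⟩) fun p hp => (h3 ▸ hp : p ∈ {p | _ ∧ _}).2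
        · obtain rfl := (hb.loc hν).eq_of_below_eq hν (ha.loc hν) (hby ▸ h3)
          rcases hy' with rfl | ⟨c, t, hF, rfl⟩
          · rw [hb.rk_itin h h2] at h4
            exact lt_irrefl _ h4
          · by_cases hcb : c ∈ Below ν b
            · refine hno hcb fun p hpb => ?_
              rcases below_eq_or hν (hF.soft.loc hν) hF.2.1 hF.2.2.1 with h7 | h7
              · rw [h7.2] at hpb; exact hpb.2
              · exact (h7.1 hcb).elim
            · simp only [rk, if_neg hcb] at h4
              linarith [t.2.1]
  exact ht.eventually (hS.mem_nhds haS)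

theorem IsPath.eventually_hi_mem {N : ℕ} {lo hi : ℕ → StarSeq A} {a : StarSeq A}
    (hp : IsPath ν N lo hi) (hc : ∀ n, Cont (lo n) (hi n) a) (ha : Soft ν a) (hm : Moving hi)
    {S : Set (critPath ν)} (hS : IsOpen[topologyC ν] S) (haS : ⟨_, ha.mem_critPath⟩ ∈ S) :
    ∀ᶠ n in atTop, (⟨.itin (hi n), itin_mem_critPath ⟨_, (hp.node_add n).mem_right⟩⟩ :
      critPath ν) ∈ S := by
  have hν := h.knead h2
  let _ := topologyC ν
  have hhiP : ∀ n, hi n ∈ PInf ν := fun n => ⟨_, (hp.node_add n).mem_right⟩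
  have ht : Tendsto (fun n => (⟨.itin (hi n), itin_mem_critPath ⟨_, (hp.node_add n).mem_right⟩⟩ :
      critPath ν)) atTop (𝓝 ⟨_, ha.mem_critPath⟩) := by
    refine TopologicalSpace.tendsto_nhds_generateFrom_iff.2 ?_
    rintro _ ⟨⟨y, hy⟩, rfl | rfl⟩ hay
    · have hay : CLT ν (.itin a) y := hay
      show ∀ᶠ n in atTop, CLT ν (.itin (hi n)) y
      rcases hay.klt h h2 with h3 | ⟨h3, h4⟩
      · rw [ha.pos_itin h h2] at h3
        obtain ⟨p, hp1, hp2⟩ := exists_of_ssubset h3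
        have hpP := pos_subset _ hp1
        have h5 := clt_of_mem_pos h h2 hy hp1
        have h6 : ∀ᶠ n in atTop, PLT ν (hi n) p := by
          obtain ⟨n, hn⟩ := (IsPath.eventually_hi_ple h h2 hp hc hpP hp2).exists
          obtain ⟨m, hm1, hm2⟩ := hm n
          filter_upwards [eventually_ge_atTop m] with r hr
          exact ((hp.hi_ple hν hr).trans_plt hν ((hp.hi_le hν hm1).resolve_left hm2)).trans_ple
            hν hn
        filter_upwards [h6] with n hn
        rcases h5 with rfl | h5
        · exact .prec hn
        · exact (CLT.prec hn).trans h5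
      · exfalso
        rw [ha.rk_itin h h2] at h4
        rw [ha.pos_itin h h2] at h3
        rcases mem_PInf_or_exists_soft h h2 hy with ⟨q, hq, rfl⟩ | ⟨b, hb, hby, hy'⟩
        · rw [rk_itin hq] at h4
          linarith
        · obtain rfl := (ha.loc hν).eq_of_below_eq hν (hb.loc hν) (hby ▸ h3)
          rcases hy' with rfl | ⟨c, t, hF, rfl⟩
          · rw [hb.rk_itin h h2] at h4
            exact lt_irrefl _ h4
          · by_cases hcb : c ∈ Below ν a
            · simp only [rk, if_pos hcb] at h4
              linarith [t.2.1]
            · refine not_moving_of_eventually_eq ?_ hm (c := c)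
              filter_upwards [IsPath.eventually_hi_ple h h2 hp hc hF.2.1 hcb] with n hn
              refine hn.antisymm hν ((ple_or_plt hν hF.2.1 (hhiP n)).resolve_right fun h5 => ?_)
              refine IsPath.notMem_below_hi h h2 hp hc n ?_
              rcases below_eq_or hν (hF.soft.loc hν) hF.2.1 hF.2.2.1 with h7 | h7
              · exact (hcb h7.1).elim
              · rw [h7.2]; exact ⟨hhiP n, h5⟩
    · have hay : CLT ν y (.itin a) := hay
      refine Eventually.of_forall fun n => ?_
      exact hay.trans (clt_of_notMem_below h h2 ha (hhiP n) (IsPath.notMem_below_hi h h2 hp hc n))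
  exact ht.eventually (hS.mem_nhds haS)

end

end


/-! ### Itineraries next to precritical points -/

/-- The itinerary next to `ν`, for `⋆`-periodic `ν`: each `⋆` is replaced by the same symbol. -/
noncomputable def tau (ν : StarSeq A) : StarSeq A := fun i =>
  if period ν ∣ i + 1 then arm ν 0 (critPt ν) else ν i

section

variable {ν : StarSeq A}

theorem apply_add_period (ν : StarSeq A) (i : ℕ) : ν (i + period ν) = ν i := by
  rw [← shift_iterate ν, shift_period]

theorem tau_add_period (ν : StarSeq A) (i : ℕ) : tau ν (i + period ν) = tau ν i := by
  unfold tau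
  rw [apply_add_period ν, show i + period ν + 1 = i + 1 + period ν by ring]
  simp only [Nat.dvd_add_self_right]

theorem eq_zero_of_shift_eq {k : ℕ} (hk : k < period ν) (he : shift^[k] ν = ν) : k = 0 :=
  Function.IsPeriodicPt.eq_zero_of_lt_minimalPeriod (f := shift) he hk

section

variable (h : IsStarPeriodic ν) (h2 : 2 ≤ period ν)
include h h2

theorem arm_zero_of_mem_orb {x : StarSeq A} (hx : x ∈ orb ν) :
    arm ν 0 x = none ∨ arm ν 0 x = arm ν 0 (critPt ν) := by
  obtain ⟨r, rfl⟩ := hx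
  by_cases hr : period ν ∣ r
  · left
    have : shift^[r] ν = ν := by
      obtain ⟨m, rfl⟩ := hr
      rw [← shift_mod_period, Nat.mul_mod_right]
      rfl
    rw [this]
    unfold arm
    rw [Function.iterate_zero, id, chop_of_agree fun _ _ => rfl, shift_iterate, h.eq_none_iff]
    exact ⟨1, by omega⟩
  · exact Or.inr (arm_zero_eq h h2 hr)

/-- Along `y` the sequence `ν` is cut at its first `⋆`, so the other orbit point must fit there, and
by `arm_zero_eq` its symbol is always that of the arm of `⋆ν`. After one period the situation
repeats. -/
theorem eq_tau {y z : StarSeq A} (hy : NoStar y) (hc : ∀ i, ¬ Differ (ν i) (y i)) (hz : z ∈ orb ν)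
    (hb : ∀ t, chop ν ν y t 0 = y t ∨ chop ν z y t 0 = y t) : y = tau ν := by
  funext i
  induction i using Nat.strong_induction_on generalizing y z with
  | _ i ih =>
    have hag : ∀ j, ¬ period ν ∣ j + 1 → ν j = y j := by
      intro j hj
      have := hc j
      rw [not_differ_iff, h.eq_none_iff] at this
      have := hy j
      tauto
    have hag' : ∀ j < period ν - 1, ν j = y j := fun j hj =>
      hag j fun hd => by have := Nat.le_of_dvd (by omega) hd; omega
    have hcut : chop ν ν y (period ν - 1) 0 ≠ y (period ν - 1) := by
      rw [chop_of_agree hag', shift_iterate, zero_add,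
        (h.eq_none_iff _).2 ⟨1, by omega⟩]
      exact (hy _).symm
    rcases Nat.lt_or_ge i (period ν) with hi | hi
    · unfold tau
      split_ifs with hd
      · have hi' : i = period ν - 1 := by
          have := Nat.le_of_dvd (by omega) hd; omega
        subst hi'
        have h3 := (hb (period ν - 1)).resolve_left hcut
        have h4 : chop ν z y (period ν - 1) 0 = arm ν 0 z :=
          congrFun (chop_congr fun j hj => (hag' j hj).symm) 0
        rw [h4] at h3
        rcases arm_zero_of_mem_orb h h2 hz with h5 | h5
        · exact (hy _ (h3.symm.trans h5)).elim
        · rw [← h3, h5]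
      · exact (hag i hd).symm
    · have h3 := ih (i - period ν) (by omega) (y := shift^[period ν] y)
        (z := chop ν z y (period ν)) (fun j => by rw [shift_iterate]; exact hy _)
        (fun j => by rw [shift_iterate, ← apply_add_period ν j]; exact hc _)
        (chop_mem_orb hz _) (fun t => by
          have := hb (period ν + t)
          rw [chop_add, chop_add] at this
          have h4 : chop ν ν y (period ν) = ν := by
            have := chop_succ_of_ne hcut
            rwa [Nat.sub_add_cancel (by omega)] at this
          rw [h4] at this
          rwa [shift_iterate, add_comm t])
      rw [shift_iterate, Nat.sub_add_cancel hi] at h3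
      rw [h3, ← tau_add_period, Nat.sub_add_cancel hi]

end

theorem mem_PInf_cases (hν : Knead ν) {c : StarSeq A} (hc : c ∈ PInf ν) :
    c = ν ∨ c = critPt ν ∨ ∃ n l l' e e' K, DNode ν n l l' e e' ∧
      diff e e' = ((K + 1 : ℕ) : ℕ∞) ∧ c = midpoint ν e e' := by
  obtain ⟨n, hn⟩ := hc
  induction n with
  | zero =>
    simp only [P, List.mem_cons, List.not_mem_nil, or_false] at hn
    tauto
  | succ n ih =>
    by_cases hcn : c ∈ P ν n
    · exact ih hcn
    · obtain ⟨e, e', hnode, h1, h2⟩ := exists_node_of_notMem hν ⟨_, hn⟩ hcn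
      obtain ⟨l, l', hd⟩ := hnode.exists_dnode
      right; right
      have htop : diff e e' ≠ ⊤ := by
        intro htop
        rcases (hnode.same htop).ple_or_ple hν hn with h3 | h3
        · exact h3.not_plt hν h1
        · exact h3.not_plt hν h2
      obtain ⟨K, hK⟩ := exists_diff_eq_succ htop
      refine ⟨n, l, l', e, e', K, hd, hK, ?_⟩
      rcases (hnode.left htop).ple_or_ple hν hn with h3 | h3
      · exact (h3.not_plt hν h1).elim
      · rcases (hnode.right htop).ple_or_ple hν hn with h4 | h4
        · exact h4.antisymm hν h3
        · exact (h4.not_plt hν h2).elim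

section

variable (h : IsStarPeriodic ν) (h2 : 2 ≤ period ν)
include h h2

/-- Precritical points on the critical path do not return to `ν` before their last symbol. -/
theorem DNode.shift_midpoint_ne {n l l' K : ℕ} {e e' : StarSeq A} (hd : DNode ν n l l' e e')
    (hK : diff e e' = ((K + 1 : ℕ) : ℕ∞)) {t : ℕ} (htK : t ≤ K) :
    shift^[t] (midpoint ν e e') ≠ ν := by
  intro he
  have hν := h.knead h2
  have hw := (hd.good hν).isWordStar_midpoint hK
  have hm : ∀ i, midpoint ν e e' (i + t) = ν i := fun i => by rw [← he, shift_iterate, he]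
  have hKt : K = t + (period ν - 1) := by
    have h3 : ν (K - t) = none := by rw [← hm, Nat.sub_add_cancel htK]; exact hw.2.1
    have h4 : period ν - 1 ≤ K - t := by
      rw [h.eq_none_iff] at h3
      have := Nat.le_of_dvd (by omega) h3
      omega
    by_contra hne
    apply hw.1 (period ν - 1 + t) (by omega)
    rw [hm, h.eq_none_iff]
    exact ⟨1, by omega⟩
  have harms := hd.arms_midpoint hν hK
  have hdiff := differ_iff.1 (diff_eq_succ_iff.1 hK).1
  have h3 : ∀ x, chop ν x (midpoint ν e e') K 0 = arm ν 0 (chop ν x (midpoint ν e e') t) := by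
    intro x
    rw [hKt, chop_add, he]
    rfl
  rw [h3, h3] at harms
  -- At the midpoint the two ends show different symbols. Read at `σ^t` of it, which is `ν`, these
  -- are arms of orbit points at `ν`, and they would all be equal.
  have h4 := arm_zero_of_mem_orb h h2 (chop_mem_orb (y := midpoint ν e e') h.critPt_mem_orb t)
  have h5 := arm_zero_of_mem_orb h h2
    (chop_mem_orb (y := midpoint ν e e') (self_mem_orb ν) t)
  rw [harms.1] at h4
  rw [harms.2] at h5
  exact hdiff.2.2 ((h4.resolve_left hdiff.1).trans (h5.resolve_left hdiff.2.1).symm)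

/-- Past its `⋆` the midpoint is `ν`, and one end of the path has just been restarted at `ν`. So
`σ^(K+1) a` is adjacent to `ν` in the direction of an orbit point, and `eq_tau` applies. -/
theorem DNode.eq_of_adjacent {n l l' K : ℕ} {e e' : StarSeq A} (hd : DNode ν n l l' e e')
    (hK : diff e e' = ((K + 1 : ℕ) : ℕ∞)) {a : StarSeq A} (ha : NoStar a) (hb : ∀ t, NotBoth ν a t)
    (hda : diff a (midpoint ν e e') = ⊤) :
    (a K = e K ∨ a K = e' K) ∧ shift^[K + 1] a = tau ν := by
  have hν := h.knead h2
  have hw := (hd.good hν).isWordStar_midpoint hK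
  have hcomp := diff_eq_top_iff.1 hda
  have hag : ∀ i < K, a i = midpoint ν e e' i := by
    intro i hi
    have := hcomp i
    rw [not_differ_iff] at this
    have := ha i
    have := hw.1 i hi
    tauto
  have harms := hd.arms_midpoint hν hK
  have hdiff := differ_iff.1 (diff_eq_succ_iff.1 hK).1
  rw [← chop_congr hag, ← chop_congr hag] at harms
  have hbK := hb K
  unfold NotBoth at hbK
  rw [harms.1, harms.2] at hbK
  refine ⟨hbK.imp Eq.symm Eq.symm, ?_⟩
  have hbt : ∀ t, chop ν (chop ν ν a (K + 1)) (shift^[K + 1] a) t 0 = shift^[K + 1] a t ∨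
      chop ν (chop ν (critPt ν) a (K + 1)) (shift^[K + 1] a) t 0 = shift^[K + 1] a t := by
    intro t
    rw [← chop_add, ← chop_add, shift_iterate, add_comm t]
    exact (hb _).symm
  have hns : NoStar (shift^[K + 1] a) := fun i => by rw [shift_iterate]; exact ha _
  have hcd : ∀ i, ¬ Differ (ν i) (shift^[K + 1] a i) := by
    intro i hdi
    apply hcomp (i + (K + 1))
    rw [shift_iterate] at hdi
    rw [← shift_iterate (midpoint ν e e'), shift_midpoint hK]
    exact hdi.symm
  rcases hbK with h3 | h3
  · have h4 : chop ν ν a (K + 1) = ν := chop_succ_of_ne (by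
      rw [harms.2, ← h3]; exact hdiff.2.2.symm)
    rw [h4] at hbt
    exact eq_tau h h2 hns hcd (chop_mem_orb (y := a) h.critPt_mem_orb _) hbt
  · have h4 : chop ν (critPt ν) a (K + 1) = ν := chop_succ_of_ne (by
      rw [harms.1, ← h3]; exact hdiff.2.2)
    rw [h4] at hbt
    exact eq_tau h h2 hns hcd (chop_mem_orb (y := a) (self_mem_orb ν) _) fun t => (hbt t).symm

theorem eq_of_adjacent_critPt {a : StarSeq A} (ha : NoStar a) (hb : ∀ t, NotBoth ν a t)
    (hda : diff a (critPt ν) = ⊤) : a 0 = ν 0 ∧ shift^[1] a = tau ν := by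
  have h0 : chop ν (critPt ν) a 0 0 ≠ a 0 := fun he => ha 0 he.symm
  have hb0 := (hb 0).resolve_left h0
  refine ⟨hb0.symm, ?_⟩
  have h4 : chop ν (critPt ν) a 1 = ν := chop_succ_of_ne h0
  refine eq_tau h h2 (fun i => by rw [shift_iterate]; exact ha _) (fun i hd => ?_)
    (chop_mem_orb (y := a) (self_mem_orb ν) 1) fun t => ?_
  · apply diff_eq_top_iff.1 hda (i + 1)
    rw [shift_iterate] at hd
    exact hd.symm
  · have := hb (1 + t)
    unfold NotBoth at this
    rw [chop_add, chop_add, h4] at this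
    rwa [shift_iterate, add_comm t]

theorem eq_of_adjacent_self {a : StarSeq A} (ha : NoStar a) (hb : ∀ t, NotBoth ν a t)
    (hda : diff a ν = ⊤) : a = tau ν :=
  eq_tau h h2 ha (fun i hd => diff_eq_top_iff.1 hda i hd.symm) h.critPt_mem_orb
    fun t => (hb t).symm

/-- Among the iterates below the period only the depth can map `c` to `ν`, and it maps the Fatou
intervals at `c` to the one interval `[tau ν, ν]`. -/
theorem exists_depth {c : StarSeq A} (hc : c ∈ PInf ν) : ∃ l, HasDepth ν l c ∧
    (∀ k < period ν, shift^[k] c = ν → k = l) ∧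
    ∀ a, NoStar a → (∀ t, NotBoth ν a t) → diff a c = ⊤ → shift^[l] a = tau ν := by
  have hν := h.knead h2
  rcases mem_PInf_cases hν hc with rfl | rfl | ⟨n, l, l', e, e', K, hd, hK, rfl⟩
  · exact ⟨0, rfl, fun k hk he => eq_zero_of_shift_eq hk he,
      fun a ha hb hda => eq_of_adjacent_self h h2 ha hb hda⟩
  · refine ⟨1, (good_root hν).depth, fun k hk he => ?_,
      fun a ha hb hda => (eq_of_adjacent_critPt h h2 ha hb hda).2⟩
    cases k with
    | zero => exact (critPt_ne hν he).elim
    | succ k =>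
      rw [Function.iterate_succ_apply, shift_critPt] at he
      rw [eq_zero_of_shift_eq (by omega) he]
  · refine ⟨K + 1, (hd.good hν).isWordStar_midpoint hK, fun k hk he => ?_,
      fun a ha hb hda => (hd.eq_of_adjacent h h2 hK ha hb hda).2⟩
    rcases Nat.lt_or_ge K k with hlt | hge
    · rw [show k = k - (K + 1) + (K + 1) by omega, ← shift_iterate_add, shift_midpoint hK] at he
      have := eq_zero_of_shift_eq (by omega) he
      omega
    · exact (hd.shift_midpoint_ne h h2 hK hge he).elim

end

/-! ### Limits of paths -/

theorem diff_lo_eq_top (hν : Knead ν) {N M : ℕ} {lo hi : ℕ → StarSeq A} {a : StarSeq A}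
    (hp : IsPath ν N lo hi) (hc : ∀ n, Cont (lo n) (hi n) a) (hM : ∀ m ≥ M, lo m = lo M) :
    diff a (lo M) = ⊤ := by
  refine WithTop.eq_top_iff_forall_gt.2 fun k => ?_
  rw [← hM (k + M) (by omega), diff_comm]
  exact (hc _).lt_diff_left (hp.lt_diff hν (by omega))

theorem diff_hi_eq_top (hν : Knead ν) {N M : ℕ} {lo hi : ℕ → StarSeq A} {a : StarSeq A}
    (hp : IsPath ν N lo hi) (hc : ∀ n, Cont (lo n) (hi n) a) (hM : ∀ m ≥ M, hi m = hi M) :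
    diff a (hi M) = ⊤ := by
  refine WithTop.eq_top_iff_forall_gt.2 fun k => ?_
  rw [← hM (k + M) (by omega), diff_comm]
  exact (hc _).lt_diff_right (hp.lt_diff hν (by omega))

/-- If an end keeps moving, `a` is a limit point; if both ends stop, they bound a gap with `a` as
its central itinerary. -/
theorem IsPath.soft_or (h : IsStarPeriodic ν) (h2 : 2 ≤ period ν) {N : ℕ}
    {lo hi : ℕ → StarSeq A} {a : StarSeq A} (hp : IsPath ν N lo hi)
    (hc : ∀ n, Cont (lo n) (hi n) a) (ha : NoStar a) :
    a ∈ L ν ∨ ∃ M, (∀ m ≥ M, lo m = lo M) ∧ (∀ m ≥ M, hi m = hi M) ∧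
      IsCentral ν (lo M) (hi M) a := by
  have hν := h.knead h2
  by_cases hm : Moving lo ∨ Moving hi
  · exact Or.inl ⟨ha.mem_X h, ha, hp.exists_convergesTo hν hc hm⟩
  · right
    push Not at hm
    obtain ⟨M₁, h3⟩ := exists_const_of_not_moving hm.1
    obtain ⟨M₂, h4⟩ := exists_const_of_not_moving hm.2
    have h3' : ∀ m ≥ max M₁ M₂, lo m = lo (max M₁ M₂) := fun m hm => by
      rw [h3 m ((le_max_left _ _).trans hm), h3 _ (le_max_left M₁ M₂)]
    have h4' : ∀ m ≥ max M₁ M₂, hi m = hi (max M₁ M₂) := fun m hm => by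
      rw [h4 m ((le_max_right _ _).trans hm), h4 _ (le_max_right M₁ M₂)]
    refine ⟨max M₁ M₂, h3', h4', ⟨⟨_, hp.node_add _⟩, ?_⟩, ha.mem_X h, ha, ?_, ?_⟩
    · refine WithTop.eq_top_iff_forall_gt.2 fun k => ?_
      rw [← h3' (k + max M₁ M₂) (by omega), ← h4' (k + max M₁ M₂) (by omega)]
      exact hp.lt_diff hν (by omega)
    · rw [diff_comm]
      exact diff_lo_eq_top hν hp hc h3'
    · exact diff_hi_eq_top hν hp hc h4'

theorem IsPath.soft (h : IsStarPeriodic ν) (h2 : 2 ≤ period ν) {N : ℕ} {lo hi : ℕ → StarSeq A}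
    {a : StarSeq A} (hp : IsPath ν N lo hi) (hc : ∀ n, Cont (lo n) (hi n) a) (ha : NoStar a) :
    Soft ν a := by
  rcases hp.soft_or h h2 hc ha with h3 | ⟨M, -, -, h3⟩
  exacts [Or.inl h3, Or.inr ⟨_, _, h3⟩]

theorem Loc.soft (h : IsStarPeriodic ν) (h2 : 2 ≤ period ν) {a : StarSeq A} (hl : Loc ν a)
    (ha : NoStar a) : Soft ν a := by
  obtain ⟨lo, hi, hp, hc⟩ := hl.exists_path
  exact hp.soft h h2 hc ha

theorem IsPath.isFatou_lo (h : IsStarPeriodic ν) (h2 : 2 ≤ period ν) {N M : ℕ}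
    {lo hi : ℕ → StarSeq A} {a : StarSeq A} (hp : IsPath ν N lo hi)
    (hc : ∀ n, Cont (lo n) (hi n) a) (ha : NoStar a) (hM : ∀ m ≥ M, lo m = lo M) :
    IsFatou ν a (lo M) := by
  refine ⟨h, ⟨_, (hp.node_add M).mem_left⟩, diff_lo_eq_top (h.knead h2) hp hc hM, ?_⟩
  rcases hp.soft_or h h2 hc ha with h3 | ⟨M', h3, -, h4⟩
  · exact Or.inl h3
  · right
    rw [← h3 (max M M') (le_max_right _ _), hM _ (le_max_left _ _)] at h4
    exact ⟨_, Or.inl h4⟩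

theorem IsPath.isFatou_hi (h : IsStarPeriodic ν) (h2 : 2 ≤ period ν) {N M : ℕ}
    {lo hi : ℕ → StarSeq A} {a : StarSeq A} (hp : IsPath ν N lo hi)
    (hc : ∀ n, Cont (lo n) (hi n) a) (ha : NoStar a) (hM : ∀ m ≥ M, hi m = hi M) :
    IsFatou ν a (hi M) := by
  refine ⟨h, ⟨_, (hp.node_add M).mem_right⟩, diff_hi_eq_top (h.knead h2) hp hc hM, ?_⟩
  rcases hp.soft_or h h2 hc ha with h3 | ⟨M', -, h3, h4⟩
  · exact Or.inl h3
  · right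
    rw [← h3 (max M M') (le_max_right _ _), hM _ (le_max_left _ _)] at h4
    exact ⟨_, Or.inr h4⟩

/-- There is a Fatou interval on the left of every right neighbour. -/
theorem Node.exists_isFatou_right (h : IsStarPeriodic ν) (h2 : 2 ≤ period ν) {N : ℕ}
    {e c : StarSeq A} (hn : Node ν N e c) : ∃ a, IsFatou ν a c ∧ Cont e c a := by
  have hν := h.knead h2
  obtain ⟨lo, hi, hp, h0, h0', hQ⟩ := exists_path (Q := fun _ e' => e' = c) hn rfl (by
    rintro n f f' - hf rfl
    by_cases hd : diff f f' = ⊤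
    · exact ⟨f, f', Or.inl ⟨hd, rfl, rfl⟩, rfl⟩
    · exact ⟨_, f', Or.inr ⟨hd, Or.inr ⟨rfl, rfl⟩⟩, rfl⟩)
  refine ⟨pathLimit lo hi, ?_, h0 ▸ h0' ▸ hp.cont_pathLimit hν 0⟩
  have := hp.isFatou_hi h h2 (M := 0) (hp.cont_pathLimit hν) (hp.noStar_pathLimit hν)
    fun m _ => by rw [hQ, hQ]
  rwa [hQ] at this

/-- There is a Fatou interval on the right of every left neighbour. -/
theorem Node.exists_isFatou_left (h : IsStarPeriodic ν) (h2 : 2 ≤ period ν) {N : ℕ}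
    {e c : StarSeq A} (hn : Node ν N c e) : ∃ a, IsFatou ν a c ∧ Cont c e a := by
  have hν := h.knead h2
  obtain ⟨lo, hi, hp, h0, h0', hQ⟩ := exists_path (Q := fun e' _ => e' = c) hn rfl (by
    rintro n f f' - hf rfl
    by_cases hd : diff f f' = ⊤
    · exact ⟨f, f', Or.inl ⟨hd, rfl, rfl⟩, rfl⟩
    · exact ⟨f, _, Or.inr ⟨hd, Or.inl ⟨rfl, rfl⟩⟩, rfl⟩)
  refine ⟨pathLimit lo hi, ?_, h0 ▸ h0' ▸ hp.cont_pathLimit hν 0⟩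
  have := hp.isFatou_lo h h2 (M := 0) (hp.cont_pathLimit hν) (hp.noStar_pathLimit hν)
    fun m _ => by rw [hQ, hQ]
  rwa [hQ] at this

theorem IsFatou.notBoth (h : IsStarPeriodic ν) (h2 : 2 ≤ period ν) {a c : StarSeq A}
    (hF : IsFatou ν a c) (t : ℕ) : NotBoth ν a t :=
  (hF.soft.loc (h.knead h2)).notBoth (h.knead h2) t

end


/-! ### The `⋆`-periodic case -/

theorem shift_iterate_fatou (k : ℕ) (a c : StarSeq A) (t : Ioo (0 : ℝ) 1) :
    Pt.shift^[k] (Pt.fatou a c t) = Pt.fatou (shift^[k] a) (shift^[k] c) t := by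
  induction k generalizing a c with
  | zero => rfl
  | succ k ih =>
    rw [Function.iterate_succ_apply, Function.iterate_succ_apply, Function.iterate_succ_apply,
      ← ih]
    rfl

/-- Open sets which separate the complement of the critical value, in the `⋆`-periodic case. -/
structure StarSplit (ν : StarSeq A) (U V : Set (Pt A)) : Prop extends Split ν U V where
  star : IsStarPeriodic ν
  two_le : 2 ≤ period ν
  isOpen : ∀ k < period ν, IsOpen[topologyC ν] {x : critPath ν | Pt.shift^[k] x.1 ∈ U}
  isOpen' : ∀ k < period ν, IsOpen[topologyC ν] {x : critPath ν | Pt.shift^[k] x.1 ∈ V}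

namespace StarSplit

variable {ν : StarSeq A} {U V : Set (Pt A)}

theorem itin_ne (h : StarSplit ν U V) {a : StarSeq A} (ha : NoStar a) (k : ℕ) :
    Pt.itin (shift^[k] a) ≠ Pt.itin ν := fun he =>
  ha.shift_ne h.star k (Pt.itin.inj he)

/-- Fatou intervals are continuous images of real intervals, so a connected part whose image avoids
`ν` cannot be separated. -/
theorem curve_iff (h : StarSplit ν U V) {k : ℕ} (hk : k < period ν) {a c : StarSeq A}
    (hF : IsFatou ν a c) {J : Set ℝ} (hJ : IsPreconnected J)
    (hne : ∀ t ∈ J, Pt.shift^[k] (curve a c t) ≠ .itin ν) {s t : ℝ} (hs : s ∈ J) (ht : t ∈ J) :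
    Pt.shift^[k] (curve a c s) ∈ U ↔ Pt.shift^[k] (curve a c t) ∈ U := by
  have key : ∀ {s t : ℝ}, s ∈ J → t ∈ J → Pt.shift^[k] (curve a c s) ∈ U →
      Pt.shift^[k] (curve a c t) ∈ U := by
    intro s t hs ht hsU
    by_contra htU
    have hH : ∀ t, Pt.shift^[k] (curve a c t) ∈ hubbardSet ν := fun t =>
      iterate_mem_hubbardSet (hF.curve_mem t) k
    have htV := (h.cover _ (hH t) (hne t ht)).resolve_left htU
    let _ := topologyC ν
    have hcont := continuous_curve h.star h.two_le hF
    obtain ⟨r, hr, hrU, hrV⟩ := hJ _ _ ((h.isOpen k hk).preimage hcont)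
      ((h.isOpen' k hk).preimage hcont) (fun r hr => h.cover _ (hH r) (hne r hr))
      ⟨s, hs, hsU⟩ ⟨t, ht, htV⟩
    exact h.disj _ (hH r) (hne r hr) ⟨hrU, hrV⟩
  exact ⟨key hs ht, key ht hs⟩

/-- Fatou intervals are not separated. -/
theorem fatou_iff (h : StarSplit ν U V) {k : ℕ} (hk : k < period ν) {a c : StarSeq A}
    (hF : IsFatou ν a c) : (∀ t, Pt.fatou (shift^[k] a) (shift^[k] c) t ∈ U ↔
      Pt.itin (shift^[k] a) ∈ U) ∧
    (shift^[k] c ≠ ν → (Pt.itin (shift^[k] c) ∈ U ↔ Pt.itin (shift^[k] a) ∈ U)) := by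
  have h0 : Pt.shift^[k] (curve a c 0) = .itin (shift^[k] a) := by
    rw [curve_of_nonpos a c le_rfl, shift_iterate_itin]
  have h1 : Pt.shift^[k] (curve a c 1) = .itin (shift^[k] c) := by
    rw [curve_of_one_le a c le_rfl, shift_iterate_itin]
  have ht : ∀ t : Ioo (0 : ℝ) 1, Pt.shift^[k] (curve a c t) =
      .fatou (shift^[k] a) (shift^[k] c) t := fun t => by
    rw [curve_coe, shift_iterate_fatou]
  have hne : ∀ t < (1 : ℝ), Pt.shift^[k] (curve a c t) ≠ .itin ν := by
    intro t ht'
    rcases curve_cases a c t with ⟨-, h3⟩ | ⟨h3, -⟩ | ⟨s, rfl, -⟩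
    · rw [h3, shift_iterate_itin]
      exact h.itin_ne hF.soft.noStar k
    · linarith
    · rw [ht]
      simp
  constructor
  · intro t
    rw [← h0, ← ht]
    exact h.curve_iff hk hF isPreconnected_Iio (fun t ht => hne t ht) t.2.2 (by simp)
  · intro hc
    rw [← h0, ← h1]
    refine h.curve_iff hk hF isPreconnected_univ (fun t _ => ?_) (mem_univ _) (mem_univ _)
    rcases lt_or_ge t 1 with h3 | h3
    · exact hne t h3
    · rw [curve_of_one_le a c h3, shift_iterate_itin]
      simpa using hc

/-- Either the lower ends converge to `a`, or they stop at a point joined to `a` by a Fatou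
interval. In both cases they are eventually on the side of `a`, unless the image is `ν`. -/
theorem eventually_lo_iff (h : StarSplit ν U V) {k N : ℕ} (hk : k < period ν)
    {lo hi : ℕ → StarSeq A} {a : StarSeq A} (hp : IsPath ν N lo hi)
    (hc : ∀ n, Cont (lo n) (hi n) a) (ha : NoStar a) : ∀ᶠ n in atTop, shift^[k] (lo n) ≠ ν →
      (Pt.itin (shift^[k] (lo n)) ∈ U ↔ Pt.itin (shift^[k] a) ∈ U) := by
  have hs := hp.soft h.star h.two_le hc ha
  by_cases hm : Moving lo
  · by_cases haU : Pt.itin (shift^[k] a) ∈ U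
    · filter_upwards [hp.eventually_lo_mem h.star h.two_le hc hs hm (h.isOpen k hk)
        (by simpa [shift_iterate_itin] using haU)] with n hn _
      simp only [haU, iff_true]
      simpa [shift_iterate_itin] using hn
    · have hH := iterate_mem_hubbardSet hs.mem_critPath k
      rw [shift_iterate_itin] at hH
      have haV := (h.cover _ hH (h.itin_ne ha k)).resolve_left haU
      filter_upwards [hp.eventually_lo_mem h.star h.two_le hc hs hm (h.isOpen' k hk)
        (by simpa [shift_iterate_itin] using haV)] with n hn hne
      have hn' : Pt.itin (shift^[k] (lo n)) ∈ V := by simpa [shift_iterate_itin] using hn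
      simp only [haU, iff_false]
      exact fun hU => h.disj _ (itin_mem_hubbardSet (Or.inl ⟨_, (hp.node_add n).mem_left⟩) k)
        (by simpa using hne) ⟨hU, hn'⟩
  · obtain ⟨M, hM⟩ := exists_const_of_not_moving hm
    have hF := hp.isFatou_lo h.star h.two_le hc ha hM
    filter_upwards [eventually_ge_atTop M] with n hn
    rw [hM n hn]
    exact (h.fatou_iff hk hF).2

theorem eventually_hi_iff (h : StarSplit ν U V) {k N : ℕ} (hk : k < period ν)
    {lo hi : ℕ → StarSeq A} {a : StarSeq A} (hp : IsPath ν N lo hi)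
    (hc : ∀ n, Cont (lo n) (hi n) a) (ha : NoStar a) : ∀ᶠ n in atTop, shift^[k] (hi n) ≠ ν →
      (Pt.itin (shift^[k] (hi n)) ∈ U ↔ Pt.itin (shift^[k] a) ∈ U) := by
  have hs := hp.soft h.star h.two_le hc ha
  by_cases hm : Moving hi
  · by_cases haU : Pt.itin (shift^[k] a) ∈ U
    · filter_upwards [hp.eventually_hi_mem h.star h.two_le hc hs hm (h.isOpen k hk)
        (by simpa [shift_iterate_itin] using haU)] with n hn _
      simp only [haU, iff_true]
      simpa [shift_iterate_itin] using hn
    · have hH := iterate_mem_hubbardSet hs.mem_critPath k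
      rw [shift_iterate_itin] at hH
      have haV := (h.cover _ hH (h.itin_ne ha k)).resolve_left haU
      filter_upwards [hp.eventually_hi_mem h.star h.two_le hc hs hm (h.isOpen' k hk)
        (by simpa [shift_iterate_itin] using haV)] with n hn hne
      have hn' : Pt.itin (shift^[k] (hi n)) ∈ V := by simpa [shift_iterate_itin] using hn
      simp only [haU, iff_false]
      exact fun hU => h.disj _ (itin_mem_hubbardSet (Or.inl ⟨_, (hp.node_add n).mem_right⟩) k)
        (by simpa using hne) ⟨hU, hn'⟩
  · obtain ⟨M, hM⟩ := exists_const_of_not_moving hm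
    have hF := hp.isFatou_hi h.star h.two_le hc ha hM
    filter_upwards [eventually_ge_atTop M] with n hn
    rw [hM n hn]
    exact (h.fatou_iff hk hF).2

theorem midpoint_ne (h : StarSplit ν U V) {k n : ℕ} (hkn : k ≤ n) {f f' : StarSeq A}
    (hf : Node ν n f f') (hd : diff f f' ≠ ⊤) : shift^[k] (midpoint ν f f') ≠ ν := by
  obtain ⟨l, l', hdn⟩ := hf.exists_dnode
  obtain ⟨K, hK⟩ := exists_diff_eq_succ hd
  have hnK := hf.lt_diff (h.star.knead h.two_le)
  rw [hK] at hnK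
  norm_cast at hnK
  exact hdn.shift_midpoint_ne h.star h.two_le hK (by omega)

/-- Bisection as in the non-periodic case. Gaps are now allowed and are bridged by the two Fatou
intervals at the central itinerary. -/
theorem node_iff (h : StarSplit ν U V) {k N : ℕ} (hk : k < period ν) (hkN : k ≤ N)
    {e e' : StarSeq A} (hn : Node ν N e e') (he : shift^[k] e ≠ ν) (he' : shift^[k] e' ≠ ν) :
    Pt.itin (shift^[k] e) ∈ U ↔ Pt.itin (shift^[k] e') ∈ U := by
  by_contra hcon
  have hν := h.star.knead h.two_le
  obtain ⟨lo, hi, hp, -, -, hQ⟩ := exists_path (Q := fun e e' => shift^[k] e ≠ ν ∧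
    shift^[k] e' ≠ ν ∧ ¬ (Pt.itin (shift^[k] e) ∈ U ↔ Pt.itin (shift^[k] e') ∈ U)) hn
    ⟨he, he', hcon⟩ (by
      rintro n f f' hNn hf ⟨h1, h2, h3⟩
      by_cases hd : diff f f' = ⊤
      · exact ⟨f, f', Or.inl ⟨hd, rfl, rfl⟩, h1, h2, h3⟩
      have hm := h.midpoint_ne (hkN.trans hNn) hf hd
      by_cases hc : Pt.itin (shift^[k] f) ∈ U ↔ Pt.itin (shift^[k] (midpoint ν f f')) ∈ U
      · exact ⟨_, _, Or.inr ⟨hd, Or.inr ⟨rfl, rfl⟩⟩, hm, h2, by rwa [← hc]⟩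
      · exact ⟨_, _, Or.inr ⟨hd, Or.inl ⟨rfl, rfl⟩⟩, h1, hm, hc⟩)
  have hc := hp.cont_pathLimit hν
  have ha := hp.noStar_pathLimit hν
  obtain ⟨n, h1, h2⟩ := ((h.eventually_lo_iff hk hp hc ha).and
    (h.eventually_hi_iff hk hp hc ha)).exists
  exact (hQ n).2.2 ((h1 (hQ n).1).trans (h2 (hQ n).2.1).symm)

/-- Refining on the right of `c` ends with a Fatou interval at `c`, and `σ^k` maps it to `[tau ν,
ν]`. So the image leaves `ν` along the last piece of the critical path. -/
theorem mem_of_node (h : StarSplit ν U V) (hU : ∀ t, Pt.fatou (tau ν) ν t ∈ U) {k N : ℕ}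
    (hk : k < period ν) (hkN : k ≤ N) {c b : StarSeq A} (hn : Node ν N c b)
    (hc : shift^[k] c = ν) (hb : shift^[k] b ≠ ν) : Pt.itin (shift^[k] b) ∈ U := by
  have hν := h.star.knead h.two_le
  obtain ⟨lo, hi, hp, -, -, hQ⟩ := exists_path (Q := fun e e' => e = c ∧ shift^[k] e' ≠ ν ∧
    (Pt.itin (shift^[k] e') ∈ U ↔ Pt.itin (shift^[k] b) ∈ U)) hn ⟨rfl, hb, Iff.rfl⟩ (by
      rintro n f f' hNn hf ⟨rfl, h1, h2⟩
      by_cases hd : diff f f' = ⊤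
      · exact ⟨f, f', Or.inl ⟨hd, rfl, rfl⟩, rfl, h1, h2⟩
      have hm := h.midpoint_ne (hkN.trans hNn) hf hd
      refine ⟨_, _, Or.inr ⟨hd, Or.inl ⟨rfl, rfl⟩⟩, rfl, hm, ?_⟩
      rw [← h2]
      exact h.node_iff hk (by omega) (hf.right hd) hm h1)
  have hcont := hp.cont_pathLimit hν
  have ha := hp.noStar_pathLimit hν
  set a := pathLimit lo hi
  have hF := hp.isFatou_lo h.star h.two_le hcont ha (M := 0) fun m _ => by
    rw [(hQ m).1, (hQ 0).1]
  rw [(hQ 0).1] at hF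
  obtain ⟨l, -, h3, h4⟩ := exists_depth h.star h.two_le hF.2.1
  obtain rfl := h3 k hk hc
  have h5 := h4 a ha (hF.notBoth h.star h.two_le) hF.2.2.1
  have h6 := (h.fatou_iff hk hF).1 ⟨1 / 2, by norm_num, by norm_num⟩
  obtain ⟨n, hn⟩ := (h.eventually_hi_iff hk hp hcont ha).exists
  rw [← (hQ n).2.2, hn (hQ n).2.1, ← h6, h5, hc]
  exact hU _

/-- The interval `[tau ν, ν]` ends the critical path at `ν`. Its other end is reached from the lower
neighbours, which are points of `P_∞` different from `ν`. -/
theorem fatou_tau_mem (h : StarSplit ν U V) (h0 : ∀ q ∈ PInf ν, q ≠ ν → Pt.itin q ∈ U)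
    (t : Ioo (0 : ℝ) 1) : Pt.fatou (tau ν) ν t ∈ U := by
  have hν := h.star.knead h.two_le
  have hpos : 0 < period ν := h.star.period_pos
  obtain ⟨a, hF, -⟩ := (node_root ν).exists_isFatou_right h.star h.two_le
  have ha := hF.soft.noStar
  obtain ⟨lo, hi, hp, hc⟩ := (hF.soft.loc hν).exists_path
  obtain ⟨n, hn⟩ := (h.eventually_lo_iff hpos hp hc ha).exists
  have hne : lo n ≠ ν := by
    intro he
    have h1 := (hp.node_zero_add n).plt
    rw [he] at h1
    exact PLE.not_plt hν (plt_ends h1.mem_right).2 h1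
  rw [← eq_of_adjacent_self h.star h.two_le ha (hF.notBoth h.star h.two_le) hF.2.2.1]
  exact ((h.fatou_iff hpos hF).1 t).2
    ((hn hne).1 (h0 _ ⟨n, (hp.node_zero_add n).mem_left⟩ hne))

theorem mem_of_mem_PInf (h : StarSplit ν U V) (h0 : Pt.itin (critPt ν) ∈ U) {k : ℕ}
    (hk : k < period ν) : ∀ q ∈ PInf ν, shift^[k] q ≠ ν → Pt.itin (shift^[k] q) ∈ U := by
  have hν := h.star.knead h.two_le
  induction k using Nat.strong_induction_on with
  | _ k ih =>
    rintro q ⟨n₀, hq⟩ hqν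
    by_contra hcon
    have hq := mem_P_of_le (le_max_left n₀ k) hq
    set n := max n₀ k
    have hkn : k ≤ n := le_max_right _ _
    obtain ⟨x, y, hxy, hx, hy⟩ := exists_node_of_critPt
      (Q := fun y => shift^[k] y = ν ∨ Pt.itin (shift^[k] y) ∈ U) n (by
        cases k with
        | zero => exact Or.inr h0
        | succ k =>
          by_cases he : shift^[k + 1] (critPt ν) = ν
          · exact Or.inl he
          · right
            have h1 : shift^[k + 1] (critPt ν) = shift^[k] ν := by
              rw [Function.iterate_succ_apply, shift_critPt]
            rw [h1] at he ⊢
            exact ih k (Nat.lt_succ_self k) (by omega) ν ⟨0, self_mem_P ν 0⟩ he)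
      ⟨q, hq, by tauto⟩
    push Not at hy
    by_cases hxν : shift^[k] x = ν
    · rcases Nat.eq_zero_or_pos k with rfl | hpos
      · have hxν : x = ν := hxν
        have h1 := hxy.plt
        rw [hxν] at h1
        exact PLE.not_plt hν (plt_ends h1.mem_right).2 h1
      · refine hy.2 (h.mem_of_node (h.fatou_tau_mem fun q hq hne => ?_) hk hkn hxy hxν hy.1)
        exact ih 0 hpos h.star.period_pos q hq hne
    · exact hy.2 ((h.node_iff hk hkn hxy hxν hy.1).1 (hx.resolve_left hxν))

theorem mem_of_soft (h : StarSplit ν U V) (h0 : Pt.itin (critPt ν) ∈ U) {k : ℕ}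
    (hk : k < period ν) {a : StarSeq A} (ha : Soft ν a) : Pt.itin (shift^[k] a) ∈ U := by
  have hν := h.star.knead h.two_le
  obtain ⟨lo, hi, hp, hc⟩ := (ha.loc hν).exists_path
  obtain ⟨n, h1, h2⟩ := ((h.eventually_lo_iff hk hp hc ha.noStar).and
    (h.eventually_hi_iff hk hp hc ha.noStar)).exists
  have hl : lo n ∈ PInf ν := ⟨n, (hp.node_zero_add n).mem_left⟩
  have hr : hi n ∈ PInf ν := ⟨n, (hp.node_zero_add n).mem_right⟩
  by_cases h3 : shift^[k] (lo n) = ν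
  · by_cases h4 : shift^[k] (hi n) = ν
    -- Both neighbours cannot map to `ν`: they would have the same depth `k`, hence a `⋆` at the
    -- same index, or would both be `ν`.
    · obtain ⟨m, h5, h6, -⟩ := exists_depth h.star h.two_le hl
      obtain ⟨m', h5', h6', -⟩ := exists_depth h.star h.two_le hr
      obtain rfl := h6 k hk h3
      obtain rfl := h6' k hk h4
      obtain ⟨l, l', hg⟩ := (hp.node_zero_add n).good hν
      exfalso
      rcases Nat.eq_zero_or_pos k with rfl | hpos
      · have h7 : lo n = hi n := (show lo n = ν from h5).trans (show hi n = ν from h5').symm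
        have h8 := (hp.node_zero_add n).plt
        rw [h7] at h8
        exact PLT.irrefl hν _ h8
      · rcases hg.star (k - 1) with h7 | h7
        · exact h7 (h5.apply_self hpos)
        · exact h7 (h5'.apply_self hpos)
    · exact (h2 h4).1 (h.mem_of_mem_PInf h0 hk _ hr h4)
  · exact (h1 h3).1 (h.mem_of_mem_PInf h0 hk _ hl h3)

theorem mem_of_mem_critPath (h : StarSplit ν U V) (h0 : Pt.itin (critPt ν) ∈ U) {k : ℕ}
    (hk : k < period ν) {x : Pt A} (hx : x ∈ critPath ν) (hne : Pt.shift^[k] x ≠ .itin ν) :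
    Pt.shift^[k] x ∈ U := by
  rcases hx with ⟨a, rfl, ha⟩ | ⟨a, c, t, rfl, hF⟩
  · rw [shift_iterate_itin] at hne ⊢
    rcases ha with (ha | ha) | ha
    · exact h.mem_of_mem_PInf h0 hk a ha (by simpa using hne)
    · exact h.mem_of_soft h0 hk (Or.inl ha)
    · exact h.mem_of_soft h0 hk (Or.inr ha)
  · rw [shift_iterate_fatou, (h.fatou_iff hk hF).1]
    exact h.mem_of_soft h0 hk hF.soft

end StarSplit


/-! ### Finiteness of the Hubbard tree in the `⋆`-periodic case -/

/-- The orbit of the critical point. -/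
def critOrbit (ν : StarSeq A) (r : ℕ) : StarSeq A := shift^[r] (critPt ν)

/-- The sequence `bη`. -/
def consSeq (b : Option A) (η : StarSeq A) : StarSeq A
  | 0 => b
  | i + 1 => η i

theorem shift_consSeq (b : Option A) (η : StarSeq A) : shift (consSeq b η) = η := rfl

/-- The sequence whose first `T` symbols are those of `y`, followed by `s` and `tau`. -/
noncomputable def replaceAt (ν y : StarSeq A) (T : ℕ) (s : Option A) : StarSeq A := fun i =>
  if i < T then y i else if i = T then s else tau ν (i - (T + 1))

section

variable {ν : StarSeq A}

theorem eq_replaceAt {y a : StarSeq A} {T : ℕ} {s : Option A} (h1 : ∀ i < T, a i = y i)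
    (h2 : a T = s) (h3 : shift^[T + 1] a = tau ν) : a = replaceAt ν y T s := by
  funext i
  unfold replaceAt
  split_ifs with h4 h5
  · exact h1 i h4
  · rw [h5, h2]
  · rw [← h3, shift_iterate, Nat.sub_add_cancel (by omega)]

theorem shift_replaceAt (y : StarSeq A) (T k : ℕ) (s : Option A) :
    shift^[k] (replaceAt ν y (T + k) s) = replaceAt ν (shift^[k] y) T s := by
  funext i
  rw [shift_iterate]
  simp only [replaceAt, shift_iterate, Nat.add_lt_add_iff_right, Nat.add_right_cancel_iff]
  rw [show i + k - (T + k + 1) = i - (T + 1) by omega]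

theorem critOrbit_zero : critOrbit ν 0 = critPt ν := rfl

theorem critOrbit_one : critOrbit ν 1 = ν := shift_critPt ν

theorem shift_critOrbit (r : ℕ) : shift (critOrbit ν r) = critOrbit ν (r + 1) := by
  rw [critOrbit, critOrbit, Function.iterate_succ_apply']

theorem critOrbit_succ (r : ℕ) : critOrbit ν (r + 1) = shift^[r] ν := by
  rw [critOrbit, Function.iterate_succ_apply, shift_critPt]

theorem critOrbit_succ_eq (hν : Knead ν) {s : ℕ} (hs : critOrbit ν s 0 = none) :
    critOrbit ν (s + 1) = ν := by
  cases s with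
  | zero => exact critOrbit_one
  | succ r =>
    rw [critOrbit_succ, shift_iterate, zero_add] at hs
    rw [critOrbit_succ]
    exact hν.restart r hs

/-- Pull back a pair of consecutive points of the critical orbit. -/
theorem exists_symbol (hν : Knead ν) {R : StarSeq A → StarSeq A → Prop}
    (htrans : ∀ x z, R x ν → R ν z → R x z) {η : StarSeq A} {s : ℕ}
    (h : ¬ R (critOrbit ν (s + 1)) (critOrbit ν (s + 2))) :
    ∃ b ≠ none, ¬ R (chop ν (critOrbit ν s) (consSeq b η) 1)
      (chop ν (critOrbit ν (s + 1)) (consSeq b η) 1) := by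
  have fit : ∀ {x : StarSeq A} {b : Option A}, x 0 = b → chop ν x (consSeq b η) 1 = shift x :=
    fun {x b} hx => chop_succ_of_eq (n := 0) (y := consSeq b η) hx
  have cut : ∀ {x : StarSeq A} {b : Option A}, x 0 ≠ b → chop ν x (consSeq b η) 1 = ν :=
    fun {x b} hx => chop_succ_of_ne (n := 0) (y := consSeq b η) hx
  -- A point whose symbol is `b` is shifted and the other restarts at `ν`. If the symbols differ,
  -- `ν` is not equivalent to both shifted points, which decides whose symbol to take. A point
  -- showing `⋆` may be cut without loss, as its shift is `ν`.
  by_cases h0 : critOrbit ν s 0 = none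
  · have h1 := critOrbit_succ_eq hν h0
    have h2 : critOrbit ν (s + 1) 0 ≠ none := by rw [h1]; exact hν.zero
    refine ⟨_, h2, ?_⟩
    rw [cut (by rw [h0]; exact h2.symm), fit rfl, shift_critOrbit]
    intro h3
    apply h
    rwa [h1]
  · by_cases h1 : critOrbit ν (s + 1) 0 = none
    · have h2 := critOrbit_succ_eq hν h1
      refine ⟨_, h0, ?_⟩
      rw [fit rfl, cut (by rw [h1]; exact fun he => h0 he.symm), shift_critOrbit]
      intro h3
      apply h
      rwa [h2]
    · by_cases h2 : critOrbit ν s 0 = critOrbit ν (s + 1) 0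
      · refine ⟨_, h1, ?_⟩
        rwa [fit h2, fit rfl, shift_critOrbit, shift_critOrbit]
      · by_cases h3 : R (critOrbit ν (s + 1)) ν
        · refine ⟨_, h1, ?_⟩
          rw [cut h2, fit rfl, shift_critOrbit]
          exact fun h4 => h (htrans _ _ h3 h4)
        · refine ⟨_, h0, ?_⟩
          rwa [fit rfl, cut (Ne.symm h2), shift_critOrbit]

theorem chop_one_add (x η : StarSeq A) (b : Option A) (t : ℕ) :
    chop ν x (consSeq b η) (t + 1) = chop ν (chop ν x (consSeq b η) 1) η t := by
  rw [add_comm, chop_add]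
  rfl

section

variable (h : IsStarPeriodic ν) (h2 : 2 ≤ period ν)
include h

theorem exists_eq_critOrbit {x : StarSeq A} (hx : x ∈ orb ν) :
    ∃ r < period ν, x = critOrbit ν r := by
  obtain ⟨i, hi, rfl⟩ := exists_lt_period_of_mem_orb h hx
  by_cases hip : i + 1 < period ν
  · exact ⟨i + 1, hip, (critOrbit_succ i).symm⟩
  · refine ⟨0, h.period_pos, ?_⟩
    rw [critOrbit_zero, h.critPt_eq]
    congr 2
    omega

theorem critOrbit_mem_orb (r : ℕ) : critOrbit ν r ∈ orb ν := by
  cases r with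
  | zero => exact h.critPt_mem_orb
  | succ r => rw [critOrbit_succ]; exact iterate_mem_orb ν r

/-- Two orbit points that are not equivalent can be taken as consecutive points. -/
theorem exists_consecutive {R : StarSeq A → StarSeq A → Prop} (hrefl : ∀ x ∈ orb ν, R x x)
    (hsymm : ∀ x z, R x z → R z x) (htrans : ∀ x y z, R x y → R y z → R x z) {x z : StarSeq A}
    (hx : x ∈ orb ν) (hz : z ∈ orb ν) (hne : ¬ R x z) :
    ∃ r, r + 1 < period ν ∧ ¬ R (critOrbit ν r) (critOrbit ν (r + 1)) := by
  by_contra! hcon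
  have key : ∀ j < period ν, R (critOrbit ν 0) (critOrbit ν j) := by
    intro j hj
    induction j with
    | zero => exact hrefl _ (critOrbit_mem_orb h 0)
    | succ j ih => exact htrans _ _ _ (ih (by omega)) (hcon j hj)
  obtain ⟨i, hi, rfl⟩ := exists_eq_critOrbit h hx
  obtain ⟨j, hj, rfl⟩ := exists_eq_critOrbit h hz
  exact hne (htrans _ _ _ (hsymm _ _ (key i hi)) (key j hj))

/-- Every orbit point shows its `⋆` within one period unless it is cut earlier, so it is cut along
any sequence without `⋆`. -/
theorem sync_refl {η x : StarSeq A} (hη : NoStar η) (hx : x ∈ orb ν) : Sync ν η x x := by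
  by_contra hcon
  have hag : ∀ n, chop ν x η n 0 = η n := by
    intro n
    by_contra hne
    exact hcon ⟨n, hne, hne⟩
  have hch : ∀ n, chop ν x η n = shift^[n] x := by
    intro n
    induction n with
    | zero => rfl
    | succ n ih => rw [chop_succ_of_eq (hag n), ih, Function.iterate_succ_apply']
  obtain ⟨i, hi, rfl⟩ := exists_lt_period_of_mem_orb h hx
  apply hη (period ν - 1 - i)
  rw [← hag, hch, shift_iterate, shift_iterate, h.eq_none_iff]
  exact ⟨1, by omega⟩

/-- Prefixing the symbols of `exists_symbol` moves the separated consecutive points back along the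
critical orbit until they are `⋆ν` and `ν`. -/
theorem exists_lift_noStar (hν : Knead ν) {η : StarSeq A} (hη : NoStar η) {s : ℕ}
    (hs : ¬ Sync ν η (critOrbit ν s) (critOrbit ν (s + 1))) :
    ∃ y, NoStar y ∧ shift^[s] y = η ∧ ¬ Sync ν y (critPt ν) ν := by
  induction s generalizing η with
  | zero =>
    rw [critOrbit_one] at hs
    exact ⟨η, hη, rfl, hs⟩
  | succ s ih =>
    obtain ⟨b, hb, hR⟩ := exists_symbol hν (R := Sync ν η) (η := η)
      (fun _ _ h1 h2 => h1.trans h2) hs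
    obtain ⟨y, h1, h2, h3⟩ := ih (η := consSeq b η) (fun i => by
        cases i with
        | zero => exact hb
        | succ i => exact hη i) (by
        rintro ⟨n, h4, h5⟩
        apply hR
        cases n with
        | zero =>
          rw [chop_succ_of_ne h4, chop_succ_of_ne h5]
          exact sync_refl h hη (self_mem_orb ν)
        | succ n =>
          rw [chop_one_add] at h4 h5
          exact ⟨n, h4, h5⟩)
    exact ⟨y, h1, by rw [Function.iterate_succ_apply', h2, shift_consSeq], h3⟩

include h2

/-- Chopping along `a` for one period shows that `σ^p a` separates two orbit points, hence two
consecutive ones. They are fewer than `p` steps from `⋆ν` and `ν`, so a pull-back of `σ^p a` by that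
many symbols lies on the critical path. -/
theorem Soft.exists_shift_eq {a : StarSeq A} (ha : Soft ν a) :
    ∃ k < period ν, ∃ y, Soft ν y ∧ shift^[period ν] a = shift^[k] y := by
  have hν := h.knead h2
  have hns : NoStar (shift^[period ν] a) := fun i => by rw [shift_iterate]; exact ha.noStar _
  obtain ⟨r, hr, hR⟩ := exists_consecutive h (R := Sync ν (shift^[period ν] a))
    (fun x hx => sync_refl h hns hx) (fun _ _ h1 => h1.symm) (fun _ _ _ h1 h2 => h1.trans h2)
    (chop_mem_orb (y := a) h.critPt_mem_orb (period ν))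
    (chop_mem_orb (y := a) (self_mem_orb ν) (period ν)) (by
      rintro ⟨n, h3, h4⟩
      have := (ha.loc hν).notBoth hν (period ν + n)
      unfold NotBoth at this
      rw [chop_add, chop_add, add_comm (period ν) n, ← shift_iterate a] at this
      tauto)
  obtain ⟨y, h3, h4, h5⟩ := exists_lift_noStar h hν hns hR
  refine ⟨r, by omega, y, Loc.soft h h2 (loc_of_notBoth hν h3 fun t => ?_) h3, h4.symm⟩
  by_contra hb
  unfold NotBoth at hb
  push Not at hb
  exact h5 ⟨t, hb⟩

/-- Consider the last restart before time `T`. If there is none, `x` agrees with `y` up to the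
common `⋆` and beyond; if it happens at time `u`, then `σ^u y = ν`, which is excluded. -/
theorem eq_of_chop_eq_none {x y : StarSeq A} {T : ℕ} (hx : x ∈ orb ν) (hy : IsWordStar ν T y)
    (hf : ∀ t, 1 ≤ t → t ≤ T → shift^[t] y ≠ ν) (hc : chop ν x y T 0 = none) : y = x := by
  have hν := h.knead h2
  have key : ∀ t ≤ T, (chop ν x y t = shift^[t] x ∧ ∀ i < t, x i = y i) ∨
      ∃ u, 1 ≤ u ∧ u ≤ t ∧ chop ν x y t = shift^[t - u] ν ∧ ∀ i < t - u, y (i + u) = ν i := by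
    intro t ht
    induction t with
    | zero => exact Or.inl ⟨rfl, by simp⟩
    | succ t ih =>
      by_cases hfit : chop ν x y t 0 = y t
      · rcases ih (by omega) with ⟨h3, h4⟩ | ⟨u, h3, h4, h5, h6⟩
        · left
          refine ⟨by rw [chop_succ_of_eq hfit, h3, Function.iterate_succ_apply'], fun i hi => ?_⟩
          rcases Nat.lt_succ_iff_lt_or_eq.1 hi with hi | rfl
          · exact h4 i hi
          · rw [← hfit, h3, shift_iterate, zero_add]
        · right
          refine ⟨u, h3, by omega, ?_, fun i hi => ?_⟩
          · rw [chop_succ_of_eq hfit, h5, show t + 1 - u = t - u + 1 by omega,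
              Function.iterate_succ_apply']
          · rcases Nat.lt_or_ge i (t - u) with hi' | hi'
            · exact h6 i hi'
            · rw [show i = t - u by omega, Nat.sub_add_cancel h4, ← hfit, h5, shift_iterate,
                zero_add]
      · right
        exact ⟨t + 1, by omega, le_rfl, by rw [chop_succ_of_ne hfit, Nat.sub_self]; rfl,
          fun i hi => by omega⟩
  rcases key T le_rfl with ⟨h3, h4⟩ | ⟨u, h3, h4, h5, h6⟩
  · rw [h3, shift_iterate, zero_add] at hc
    have hx' : shift^[T + 1] x = ν := by
      obtain ⟨i, rfl⟩ := hx
      rw [shift_iterate] at hc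
      have := hν.restart _ hc
      rw [shift_iterate_add, show T + 1 + i = T + i + 1 by ring, this]
    funext i
    rcases lt_trichotomy i T with hi | rfl | hi
    · exact (h4 i hi).symm
    · rw [hc, hy.2.1]
    · rw [show i = i - (T + 1) + (T + 1) by omega, ← shift_iterate y, ← shift_iterate x, hx',
        hy.2.2]
  · exfalso
    rw [h5, shift_iterate, zero_add] at hc
    have hr := hν.restart _ hc
    refine hf u h3 h4 ?_
    funext i
    rw [shift_iterate]
    rcases lt_trichotomy i (T - u) with hi | rfl | hi
    · exact h6 i hi
    · rw [hc, Nat.sub_add_cancel h4, hy.2.1]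
    · rw [show i + u = i - (T - u + 1) + (T + 1) by omega, ← shift_iterate y, hy.2.2, ← hr,
        shift_iterate, hr]
      congr 1
      omega

theorem isFatou_tau : IsFatou ν (tau ν) ν := by
  obtain ⟨a, hF, -⟩ := (node_root ν).exists_isFatou_right h h2
  rwa [eq_of_adjacent_self h h2 hF.soft.noStar (hF.notBoth h h2) hF.2.2.1] at hF

theorem exists_isFatou_self {T : ℕ} {s : Option A} (hs : s ≠ none) (hT : IsWordStar ν T ν)
    {x : StarSeq A} (hx : x ∈ orb ν) (hxs : chop ν x ν T 0 = s) :
    IsFatou ν (replaceAt ν ν T s) ν := by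
  have hTp : T = period ν - 1 := by
    have h3 := Nat.le_of_dvd (by omega) ((h.eq_none_iff T).1 hT.2.1)
    by_contra hne
    exact hT.1 (period ν - 1) (by omega) ((h.eq_none_iff _).2 ⟨1, by omega⟩)
  have h3 : arm ν 0 x = s := by rw [← hxs, hTp]; rfl
  have h4 : arm ν 0 (critPt ν) = s := by
    rcases arm_zero_of_mem_orb h h2 hx with h5 | h5
    · exact (hs (h3.symm.trans h5)).elim
    · rw [← h5, h3]
  rw [← eq_replaceAt (a := tau ν)]
  · exact isFatou_tau h h2
  · intro i hi
    unfold tau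
    rw [if_neg fun hd => hT.1 i hi ((h.eq_none_iff i).2 hd)]
  · unfold tau
    rw [if_pos ((h.eq_none_iff T).1 hT.2.1), h4]
  · funext i
    rw [shift_iterate, show T + 1 = period ν by omega, tau_add_period]

/-- Exactly one of `⋆ν` and `ν` is in the arm `s` of `y`. Hence `y` is an end of the critical path
or a midpoint, and the Fatou interval of the arm `s` is the one on the corresponding side. -/
theorem exists_isFatou_of_arm {y : StarSeq A} {T : ℕ} {s : Option A} (hs : s ≠ none)
    (hy : IsWordStar ν T y) (hf : ∀ t, 1 ≤ t → t ≤ T → shift^[t] y ≠ ν)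
    (hR : ¬ (chop ν (critPt ν) y T 0 = s ↔ chop ν ν y T 0 = s)) :
    IsFatou ν (replaceAt ν y T s) y := by
  have hν := h.knead h2
  by_cases h0 : chop ν (critPt ν) y T 0 = none
  · obtain rfl := eq_of_chop_eq_none h h2 h.critPt_mem_orb hy hf h0
    have hT : T = 0 := by
      by_contra hT
      exact hy.1 0 (by omega) rfl
    subst hT
    have h3 : ν 0 = s := by
      rw [h0] at hR
      have : chop ν ν (critPt ν) 0 0 = s := by
        by_contra hne
        exact hR (iff_of_false hs.symm hne)
      exact this
    obtain ⟨a, hF, -⟩ := (node_root ν).exists_isFatou_left h h2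
    have := eq_of_adjacent_critPt h h2 hF.soft.noStar (hF.notBoth h h2) hF.2.2.1
    rwa [eq_replaceAt (fun i hi => absurd hi (by omega)) (this.1.trans h3) this.2] at hF
  by_cases h1 : chop ν ν y T 0 = none
  · obtain rfl := eq_of_chop_eq_none h h2 (self_mem_orb ν) hy hf h1
    refine exists_isFatou_self h h2 hs hy h.critPt_mem_orb ?_
    by_contra hne
    rw [h1] at hR
    exact hR (iff_of_false hne hs.symm)
  · obtain ⟨n, l, l', e, e', hd, hK, rfl, h3, h4⟩ := exists_eq_midpoint hν hy h0 h1 (by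
      intro he
      rw [he] at hR
      exact hR Iff.rfl)
    rw [← h3, ← h4] at hR
    have hfin : ∀ a, IsFatou ν a (midpoint ν e e') → a T = s →
        IsFatou ν (replaceAt ν (midpoint ν e e') T s) (midpoint ν e e') := by
      intro a hF ha
      have h5 := hd.eq_of_adjacent h h2 hK hF.soft.noStar (hF.notBoth h h2) hF.2.2.1
      rwa [eq_replaceAt (fun i hi => ?_) ha h5.2] at hF
      have h6 := diff_eq_top_iff.1 hF.2.2.1 i
      rw [not_differ_iff] at h6
      have := hF.soft.noStar i
      have := hy.1 i hi
      tauto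
    by_cases h5 : e T = s
    · obtain ⟨a, hF, hc⟩ := (hd.left hK).node.exists_isFatou_right h h2
      exact hfin a hF ((hc.of_left hK).2.trans h5)
    · obtain ⟨a, hF, hc⟩ := (hd.right hK).node.exists_isFatou_left h h2
      refine hfin a hF ((hc.of_right hK).2.trans ?_)
      by_contra h6
      exact hR (iff_of_false h5 h6)

/-- Fatou intervals are pulled back like itineraries, with "in the arm `s` or not" in the role of
the side. -/
theorem exists_lift_isFatou {s : Option A} (hs : s ≠ none) {r T : ℕ} {η : StarSeq A}
    (hη : IsWordStar ν T η) (hf : ∀ t, 1 ≤ t → t ≤ T → shift^[t] η ≠ ν)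
    (hR : ¬ (chop ν (critOrbit ν r) η T 0 = s ↔ chop ν (critOrbit ν (r + 1)) η T 0 = s)) :
    ∃ k ≤ r, ∃ y, shift^[k] y = η ∧ IsFatou ν (replaceAt ν y (T + k) s) y := by
  have hν := h.knead h2
  induction r generalizing T η with
  | zero =>
    rw [critOrbit_one] at hR
    exact ⟨0, le_rfl, η, rfl, exists_isFatou_of_arm h h2 hs hη hf hR⟩
  | succ r ih =>
    -- The interval at `ν` is already on the critical path. Stopping here keeps the hypothesis that
    -- no later shift of the lifted point is `ν`.
    by_cases hην : η = ν
    · subst hην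
      refine ⟨0, Nat.zero_le _, η, rfl, ?_⟩
      by_cases h3 : chop η (critOrbit η (r + 1)) η T 0 = s
      · exact exists_isFatou_self h h2 hs hη (critOrbit_mem_orb h _) h3
      · refine exists_isFatou_self h h2 hs hη (critOrbit_mem_orb h (r + 1 + 1)) ?_
        by_contra h4
        exact hR (iff_of_false h3 h4)
    · obtain ⟨b, hb, hR'⟩ := exists_symbol hν (η := η)
        (R := fun x z => (chop ν x η T 0 = s ↔ chop ν z η T 0 = s))
        (fun _ _ h1 h2 => h1.trans h2) hR
      simp only [← chop_one_add] at hR'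
      obtain ⟨k, hk, y, h3, h4⟩ := ih (T := T + 1) (η := consSeq b η)
        ⟨fun i hi => by
          cases i with
          | zero => exact hb
          | succ i => exact hη.1 i (by omega), hη.2.1, by
          rw [Function.iterate_succ_apply, shift_consSeq]
          exact hη.2.2⟩
        (fun t h1 h2 => by
          obtain ⟨t, rfl⟩ := Nat.exists_eq_add_of_le' h1
          rw [Function.iterate_succ_apply, shift_consSeq]
          rcases Nat.eq_zero_or_pos t with rfl | ht
          · exact hην
          · exact hf t ht (by omega)) hR'
      refine ⟨k + 1, by omega, y, by rw [Function.iterate_succ_apply', h3, shift_consSeq], ?_⟩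
      rwa [show T + (k + 1) = T + 1 + k by ring]

/-- If `c` has depth at most `p`, the interval passes through `[tau ν, ν]` in time and `σ^p` of it
is an iterate of that one. For larger depth, `σ^p c` is still precritical and the interval is pulled
back. -/
theorem IsFatou.exists_shift_eq {a c : StarSeq A} (hF : IsFatou ν a c) : ∃ k < period ν, ∃ b y,
    IsFatou ν b y ∧ shift^[period ν] a = shift^[k] b ∧ shift^[period ν] c = shift^[k] y := by
  have hν := h.knead h2
  have ha := hF.soft.noStar
  have hb := hF.notBoth h h2
  have hshort : ∀ l, 1 ≤ l → l ≤ period ν → shift^[l] a = tau ν → shift^[l] c = ν →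
      ∃ k < period ν, ∃ b y, IsFatou ν b y ∧ shift^[period ν] a = shift^[k] b ∧
        shift^[period ν] c = shift^[k] y := by
    intro l hl hlp h3 h4
    refine ⟨period ν - l, by omega, tau ν, ν, isFatou_tau h h2, ?_, ?_⟩
    · rw [← h3, shift_iterate_add, Nat.sub_add_cancel hlp]
    · have := shift_iterate_add c (period ν - l) l
      rwa [h4, Nat.sub_add_cancel hlp, eq_comm] at this
  rcases mem_PInf_cases hν hF.2.1 with rfl | rfl | ⟨n, l, l', e, e', K, hd, hK, rfl⟩
  · have h3 := eq_of_adjacent_self h h2 ha hb hF.2.2.1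
    subst h3
    refine ⟨0, h.period_pos, _, _, hF, ?_, shift_period c⟩
    funext i
    rw [shift_iterate, tau_add_period]
    rfl
  · exact hshort 1 le_rfl (by omega) (eq_of_adjacent_critPt h h2 ha hb hF.2.2.1).2
      (shift_critPt ν)
  · have h3 := hd.eq_of_adjacent h h2 hK ha hb hF.2.2.1
    rcases Nat.lt_or_ge K (period ν) with hKp | hKp
    · exact hshort (K + 1) (by omega) hKp h3.2 (shift_midpoint hK)
    · obtain ⟨T, rfl⟩ := Nat.exists_eq_add_of_le' hKp
      have hw := (hd.good hν).isWordStar_midpoint hK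
      have harms := hd.arms_midpoint hν hK
      have hdiff := differ_iff.1 (diff_eq_succ_iff.1 hK).1
      rw [add_comm T, chop_add, chop_add] at harms
      rw [add_comm (period ν) T] at harms
      set c := midpoint ν e e'
      have hae : a = replaceAt ν c (T + period ν) (a (T + period ν)) := by
        refine eq_replaceAt (fun i hi => ?_) rfl h3.2
        have h6 := diff_eq_top_iff.1 hF.2.2.1 i
        rw [not_differ_iff] at h6
        have := ha i
        have := hw.1 i hi
        tauto
      obtain ⟨r, hr, hR⟩ := exists_consecutive h
        (R := fun x z => (chop ν x (shift^[period ν] c) T 0 = a (T + period ν) ↔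
          chop ν z (shift^[period ν] c) T 0 = a (T + period ν)))
        (fun _ _ => Iff.rfl) (fun _ _ h1 => h1.symm) (fun _ _ _ h1 h2 => h1.trans h2)
        (chop_mem_orb (y := c) h.critPt_mem_orb (period ν))
        (chop_mem_orb (y := c) (self_mem_orb ν) (period ν)) (by
          rw [harms.1, harms.2]
          intro hiff
          rcases h3.1 with h4 | h4
          · exact hdiff.2.2 (h4.symm.trans (hiff.1 h4.symm).symm)
          · exact hdiff.2.2 ((hiff.2 h4.symm).trans h4))
      obtain ⟨k, hk, y, h4, h5⟩ := exists_lift_isFatou h h2 (ha _) (η := shift^[period ν] c) (T := T)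
        ⟨fun i hi => by rw [shift_iterate]; exact hw.1 _ (by omega),
          by rw [shift_iterate]; exact hw.2.1,
          by rw [shift_iterate_add, show T + 1 + period ν = T + period ν + 1 by ring]; exact hw.2.2⟩
        (fun t ht htT => by
          rw [shift_iterate_add]
          exact hd.shift_midpoint_ne h h2 hK (by omega)) hR
      refine ⟨k, by omega, _, y, h5, ?_, h4.symm⟩
      rw [shift_replaceAt, h4]
      conv_lhs => rw [hae]
      rw [shift_replaceAt]

/-- Every point of `P_∞` is an end of some Fatou interval, so its images are controlled by those of
the interval. -/
theorem PInf_exists_shift_eq {c : StarSeq A} (hc : c ∈ PInf ν) :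
    ∃ k < period ν, ∃ y ∈ PInf ν, shift^[period ν] c = shift^[k] y := by
  have hν := h.knead h2
  obtain ⟨a, hF⟩ : ∃ a, IsFatou ν a c := by
    rcases mem_PInf_cases hν hc with rfl | rfl | ⟨n, l, l', e, e', K, hd, hK, rfl⟩
    · exact ⟨_, isFatou_tau h h2⟩
    · exact ((node_root ν).exists_isFatou_left h h2).imp fun _ h3 => h3.1
    · exact ((hd.left hK).node.exists_isFatou_right h h2).imp fun _ h3 => h3.1
  obtain ⟨k, hk, b, y, hF', -, h3⟩ := hF.exists_shift_eq h h2
  exact ⟨k, hk, y, hF'.2.1, h3⟩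

theorem critPath_exists_shift_eq {x : Pt A} (hx : x ∈ critPath ν) :
    ∃ k < period ν, ∃ y ∈ critPath ν, Pt.shift^[period ν] x = Pt.shift^[k] y := by
  rcases hx with ⟨a, rfl, ha⟩ | ⟨a, c, t, rfl, hF⟩
  · by_cases haP : a ∈ PInf ν
    · obtain ⟨k, hk, y, hy, h3⟩ := PInf_exists_shift_eq h h2 haP
      refine ⟨k, hk, _, itin_mem_critPath hy, ?_⟩
      rw [shift_iterate_itin, shift_iterate_itin, h3]
    · have ha : Soft ν a := by
        rcases ha with (ha | ha) | ha
        exacts [(haP ha).elim, Or.inl ha, Or.inr ha]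
      obtain ⟨k, hk, y, hy, h3⟩ := ha.exists_shift_eq h h2
      refine ⟨k, hk, _, hy.mem_critPath, ?_⟩
      rw [shift_iterate_itin, shift_iterate_itin, h3]
  · obtain ⟨k, hk, b, y, hF', h3, h4⟩ := hF.exists_shift_eq h h2
    refine ⟨k, hk, .fatou b y t, Or.inr ⟨_, _, _, rfl, hF'⟩, ?_⟩
    rw [shift_iterate_fatou, shift_iterate_fatou, h3, h4]

/-- For `⋆`-periodic `ν` of period `p`, the Hubbard tree is `⋃_{k < p} σ^k(C_ν)`. -/
theorem exists_lt_period_of_mem_hubbardSet {x : Pt A} (hx : x ∈ hubbardSet ν) :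
    ∃ k < period ν, ∃ y ∈ critPath ν, x = Pt.shift^[k] y := by
  obtain ⟨j, y, hy, rfl⟩ := mem_iUnion.1 hx
  clear hx
  induction j using Nat.strong_induction_on generalizing y with
  | _ j ih =>
    rcases Nat.lt_or_ge j (period ν) with hj | hj
    · exact ⟨j, hj, y, hy, rfl⟩
    · obtain ⟨k, hk, z, hz, h3⟩ := critPath_exists_shift_eq h h2 hy
      obtain ⟨m, hm, w, hw, h4⟩ := ih (j - period ν + k) (by omega) z hz
      refine ⟨m, hm, w, hw, ?_⟩
      rw [← h4, Function.iterate_add_apply, ← h3, ← Function.iterate_add_apply,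
        Nat.sub_add_cancel hj]

end

end


/-! ### The critical value is an endpoint -/

section

variable {ν : StarSeq A}

/-- Two disjoint open pieces of the complement can be named so that `U` contains `⋆ν`. Connectedness
then amounts to `U` containing everything, and `Split.symm` covers the other naming. -/
theorem isEndpoint_of_forall_split (hν : Knead ν) (τ : TopologicalSpace (Pt A))
    (hτ : hubbardTopology ν = TopologicalSpace.induced Subtype.val τ)
    (hsplit : ∀ U V, Split ν U V → IsOpen[τ] U → IsOpen[τ] V → Pt.itin (critPt ν) ∈ U →
      ∀ x ∈ hubbardSet ν, x ≠ .itin ν → x ∈ U) : IsEndpoint (criticalValue ν) := by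
  have hne : ∀ x : HubbardTree ν, x ∈ ({criticalValue ν}ᶜ : Set (HubbardTree ν)) ↔
      x.1 ≠ .itin ν := by
    intro x
    rw [mem_compl_iff, mem_singleton_iff, ← Subtype.coe_inj]
    rfl
  have hc : Pt.itin (critPt ν) ∈ hubbardSet ν :=
    itin_mem_hubbardSet (Or.inl ⟨0, critPt_mem_P ν 0⟩) 0
  have hcν : Pt.itin (critPt ν) ≠ .itin ν := fun he => critPt_ne hν (Pt.itin.inj he)
  refine ⟨⟨⟨_, hc⟩, (hne _).2 hcν⟩, ?_⟩
  intro u v hu hv huv hsu hsv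
  by_contra hcon
  have hopen : ∀ w : Set (HubbardTree ν), IsOpen w → ∃ U, IsOpen[τ] U ∧ Subtype.val ⁻¹' U = w := by
    intro w hw
    have hw' : IsOpen[TopologicalSpace.induced Subtype.val τ] w := hτ ▸ hw
    exact isOpen_induced_iff.1 hw'
  obtain ⟨U, hU, rfl⟩ := hopen u hu
  obtain ⟨V, hV, rfl⟩ := hopen v hv
  have hs : Split ν U V := ⟨fun x hx hxν => huv ((hne ⟨x, hx⟩).2 hxν), fun x hx hxν hUV =>
    hcon ⟨⟨x, hx⟩, (hne ⟨x, hx⟩).2 hxν, hUV⟩⟩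
  rcases hs.cover _ hc hcν with h0 | h0
  · obtain ⟨x, hx, hxV⟩ := hsv
    have hx := (hne x).1 hx
    exact hs.disj _ x.2 hx ⟨hsplit U V hs hU hV h0 _ x.2 hx, hxV⟩
  · obtain ⟨x, hx, hxU⟩ := hsu
    have hx := (hne x).1 hx
    exact hs.disj _ x.2 hx ⟨hxU, hsplit V U hs.symm hV hU h0 _ x.2 hx⟩

theorem isEndpoint_of_noStar (hs : NoStar ν) (hp : ν ∉ Function.periodicPts shift) :
    IsEndpoint (criticalValue ν) := by
  refine isEndpoint_of_forall_split hs.knead _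
    (by rw [hubbardTopology, if_neg hs.not_isStarPeriodic]) fun U V h hU hV h0 x hx hxν => ?_
  have h' : OpenSplit ν U V := ⟨h, hs, hp, hU, hV⟩
  exact h'.mem_of_mem_hubbardSet h0 hx hxν

theorem isEndpoint_of_isStarPeriodic (h : IsStarPeriodic ν) (h2 : 2 ≤ period ν) :
    IsEndpoint (criticalValue ν) := by
  refine isEndpoint_of_forall_split (h.knead h2) _
    (by rw [hubbardTopology, if_pos h]) fun U V hs hU hV h0 x hx hxν => ?_
  -- Openness in the quotient topology means openness of the preimages under `σ^k` for each `k < p`.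
  -- This is why points of the tree have to be written with such `k`.
  rw [isOpen_iSup_iff] at hU hV
  have h' : StarSplit ν U V := ⟨hs, h, h2, fun k hk => isOpen_coinduced.1 (hU ⟨k, hk⟩),
    fun k hk => isOpen_coinduced.1 (hV ⟨k, hk⟩)⟩
  obtain ⟨k, hk, y, hy, rfl⟩ := exists_lt_period_of_mem_hubbardSet h h2 hx
  exact h'.mem_of_mem_critPath h0 hk hy hxν

end

end HubbardTrees

theorem mainTheorem4 (d : ℕ∞) (hd : 2 ≤ d) (ν : HubbardTrees.StarSeq (HubbardTrees.Alphabet d))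
    (hν : HubbardTrees.IsKneadingSeq ν)
    (hne : ν ≠ HubbardTrees.trivialSeq (HubbardTrees.Alphabet d)) :
    HubbardTrees.IsEndpoint (HubbardTrees.criticalValue ν) := by
  rcases hν with ⟨hs, hp⟩ | h
  · exact HubbardTrees.isEndpoint_of_noStar hs hp
  · exact HubbardTrees.isEndpoint_of_isStarPeriodic h (h.two_le_period hne)
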